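/- Let $G$ be a finite, simple, connected graph with vertex set $\mathcal V(G)$ and edges $e_1,\dots,e_m$, satisfying the condition $(\sharp)$: no induced subgraph of $G$ consists of two vertex-disjoint odd cycles joined by a path of length $\ge 1$. Let $K$ be any field. For an edge $e=\{p,q\}$ let $\mathbf a_e\in\mathbb Z^{\mathcal V(G)}$ be the vector with entries $1$ at $p$ and $q$ and $0$ elsewhere, write $\mathbf a_i=\mathbf a_{e_i}$ and $\mathcal A_G=\{\mathbf a_1,\dots,\mathbf a_m\}$, and let $$I_{\mathcal A_G}=\bigl(\mathbf x^{\mathbf u_+}-\mathbf x^{\mathbf u_-} : \mathbf u\in\mathbb Z^m,\ u_1\mathbf a_1+\cdots+u_m\mathbf a_m=\mathbf 0\bigr)\subset K[x_1,\dots,x_m]$$ be the toric ideal of $G$. The $\mathcal A_G$-degree of $\mathbf x^{\mathbf u}$ is $u_1\mathbf a_1+\cdots+u_m\mathbf a_m$, and ${\rm supp}(\mathbf x^{\mathbf u})=\{i : u_i\ne 0\}$. A binomial is a difference of two monomials. A monomial $M$ is indispensable of $I_{\mathcal A_G}$ if every system of binomial generators of $I_{\mathcal A_G}$ contains a binomial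 $B$ such that $M$ is a monomial of $B$. Let $\mathcal T_{\min}$ be the set of inclusion-minimal elements of the set of supports of indispensable monomials. The simplicial complex $\Gamma_G$ has vertex set $\mathcal T_{\min}$, and $\{E_1,\dots,E_k\}\subset\mathcal T_{\min}$ is a face if there are monomials $M_1,\dots,M_k$ of the same $\mathcal A_G$-degree with ${\rm supp}(M_i)=E_i$ for all $i$. For an even closed walk $w=(e_{i_1},\dots,e_{i_{2s}})$ of $G$, with $e_{i_k}=\{v_k,v_{k+1}\}$ and $v_{2s+1}=v_1$, put $B_w=\prod_{k=1}^s x_{i_{2k-1}}-\prod_{k=1}^s x_{i_{2k}}$; the edges $e_{i_k}$ with $k$ odd (even) are the odd (even) edges of $w$. View $w$ also as a subgraph of $G$; its blocks are its maximal connected subgraphs without a cut vertex. A chord $\{v_k,v_l\}$ of $w$, $k<l\le 2s$, is an edge of $G$ that is not an edge of $w$; it is a bridge if $v_k\in\mathcal B_1$ and $v_l\in\mathcal B_2$ for two different blocks $\mathcal B_1,\mathcal B_2$ of $w$, and it is odd if it is not a bridge and the closed walks $(e_{i_1},\dots,e_{i_{k-1}},\{v_k,v_l\},e_{i_l},\dots,e_{i_{2s}})$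 and $(e_{i_k},\dots,e_{i_{l-1}},\{v_k,v_l\})$ both have odd length. Odd chords $\{v_t,v_j\}$ ($t<j$) and $\{v_{t'},v_{j'}\}$ ($t'<j'$) cross effectively if $t'-t$ is odd and either $t<t'<j<j'$ or $t'<t<j'<j$. An $\mathcal F_4$ of $w$ is a cycle $(e,f,e',f')$ of length $4$ in $G$ such that $e,e'$ are edges of $w$, both even or both odd, and $f,f'$ are odd chords of $w$ which cross effectively. Then: (1) If $M$ is an indispensable monomial of $I_{\mathcal A_G}$ that is not quadratic (i.e. not of total degree $2$), then $\{{\rm supp}(M)\}$ is a connected component of $\Gamma_G$ if and only if every even closed walk $w$ of $G$ such that $M$ is a monomial of $B_w$ has an $\mathcal F_4$. (2) Every connected component of $\Gamma_G$ is either a vertex, an edge or a $2$-simplex. -/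

import Mathlib

noncomputable section

namespace GraphToric

/-! ### Toric ideals, indispensable monomials -/

section Toric

variable {σ ι : Type*}

/-- `ker_ℤ(A)`: the lattice of integer relations among the vectors `A i`, for `i : σ`. -/
def kerZ (A : σ → ι → ℤ) : Submodule ℤ (σ →₀ ℤ) :=
  LinearMap.ker (Finsupp.linearCombination ℤ A)

/-- The positive part `u₊` of an integer vector; the negative part of `u` is `posPart (-u)`. -/
def posPart (u : σ →₀ ℤ) : σ →₀ ℕ :=
  u.mapRange Int.toNat Int.toNat_zero

/-- The lattice ideal `I_L`, generated by all `x^{u₊} - x^{u₋}` with `u ∈ L`. -/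
def latticeIdeal (K : Type*) [Field K] (L : Submodule ℤ (σ →₀ ℤ)) :
    Ideal (MvPolynomial σ K) :=
  Ideal.span {f | ∃ u ∈ L, f = MvPolynomial.monomial (posPart u) (1 : K)
    - MvPolynomial.monomial (posPart (-u)) (1 : K)}

/-- The toric ideal `I_A` of a vector configuration. -/
def toricIdeal (K : Type*) [Field K] (A : σ → ι → ℤ) : Ideal (MvPolynomial σ K) :=
  latticeIdeal K (kerZ A)

/-- The `A`-degree `u₁ a₁ + ⋯ + uₘ aₘ` of the monomial `x^u`. -/
def degA (A : σ → ι → ℤ) (u : σ →₀ ℕ) : ι → ℤ :=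
  Finsupp.linearCombination ℕ A u

/-- A binomial is a difference of two monomials. -/
def IsBinomial {K : Type*} [Field K] (f : MvPolynomial σ K) : Prop :=
  ∃ u v : σ →₀ ℕ, f = MvPolynomial.monomial u (1 : K) - MvPolynomial.monomial v (1 : K)

/-- `S` is a system of binomial generators of `I`. -/
def IsBinomialGenerators {K : Type*} [Field K] (I : Ideal (MvPolynomial σ K))
    (S : Set (MvPolynomial σ K)) : Prop :=
  (∀ f ∈ S, IsBinomial f) ∧ Ideal.span S = I

/-- The monomial `x^u` is indispensable of `I`: every system of binomial generators of `I`
contains a binomial in which `x^u` occurs. -/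
def IsIndispensableMonomial {K : Type*} [Field K] (I : Ideal (MvPolynomial σ K))
    (u : σ →₀ ℕ) : Prop :=
  ∀ S : Set (MvPolynomial σ K), IsBinomialGenerators I S → ∃ B ∈ S, u ∈ B.support

/-- The set `𝒯` of supports of indispensable monomials of `I`. -/
def indispensableSupports {K : Type*} [Field K] (I : Ideal (MvPolynomial σ K)) :
    Set (Finset σ) :=
  {E | ∃ u : σ →₀ ℕ, IsIndispensableMonomial I u ∧ u.support = E}

/-- The set `𝒯_min` of inclusion-minimal elements of `𝒯`. -/
def minimalSupports {K : Type*} [Field K] (I : Ideal (MvPolynomial σ K)) : Set (Finset σ) :=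
  {E | Minimal (fun E' => E' ∈ indispensableSupports I) E}

/-- The simplicial complex `Γ_L` of the lattice `L = ker_ℤ(A)`: its vertices are the elements of
`𝒯_min`, and a nonempty finite set of vertices is a face when its elements are the supports of
monomials that all have the same `A`-degree. -/
def gammaComplex (K : Type*) [Field K] (A : σ → ι → ℤ) :
    PreAbstractSimplicialComplex (Finset σ) where
  faces := {T | T.Nonempty ∧ (∀ E ∈ T, E ∈ minimalSupports (toricIdeal K A)) ∧
    ∃ M : Finset σ → (σ →₀ ℕ), (∀ E ∈ T, (M E).support = E) ∧
      ∀ E ∈ T, ∀ E' ∈ T, degA A (M E) = degA A (M E')}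
  isRelLowerSet_faces := by
    rintro T ⟨hT, hmin, M, hM, hdeg⟩
    refine ⟨hT, fun T' hT' hne => ⟨hne, fun E hE => hmin E (hT' hE), M,
      fun E hE => hM E (hT' hE), fun E hE E' hE' => hdeg E (hT' hE) E' (hT' hE')⟩⟩

end Toric

/-! ### Connected components of a simplicial complex -/

section Complex

variable {α : Type*}

/-- Two vertices that lie in a common face (equivalently, equal or joined by an edge). -/
def CommonFace (Δ : PreAbstractSimplicialComplex α) (a b : α) : Prop :=
  ∃ s ∈ Δ.faces, a ∈ s ∧ b ∈ s

/-- The subcomplex of all faces whose vertices can be reached from `a` along edges. -/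
def componentAt (Δ : PreAbstractSimplicialComplex α) (a : α) :
    PreAbstractSimplicialComplex α where
  faces := {s | s ∈ Δ.faces ∧ ∀ b ∈ s, Relation.ReflTransGen (CommonFace Δ) a b}
  isRelLowerSet_faces := by
    rintro s ⟨hs, hr⟩
    refine ⟨(Δ.isRelLowerSet_faces hs).1, fun t hts ht =>
      ⟨(Δ.isRelLowerSet_faces hs).2 hts ht, fun b hb => hr b (hts hb)⟩⟩

/-- `H` is a connected component of `Δ`. -/
def IsConnectedComponent (Δ H : PreAbstractSimplicialComplex α) : Prop :=
  ∃ a : α, {a} ∈ Δ.faces ∧ H = componentAt Δ a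

/-- The simplex with vertex set `s` (all nonempty subsets of `s` are faces); it is a vertex, an
edge, a `2`-simplex when `s` has `1`, `2`, `3` elements. -/
def simplexOn (s : Finset α) : PreAbstractSimplicialComplex α where
  faces := {t | t.Nonempty ∧ t ⊆ s}
  isRelLowerSet_faces := by
    rintro t ⟨ht, hts⟩
    exact ⟨ht, fun r hrt hr => ⟨hr, fun x hx => hts (hrt hx)⟩⟩

end Complex

/-! ### Graphs and closed walks -/

section Graph

variable {V : Type*}

/-- The vector `a_e`, with entry `1` at the two endpoints of `e` and `0` elsewhere. -/
def edgeVec (G : SimpleGraph V) (e : G.edgeSet) : V → ℤ :=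
  Set.indicator {v | v ∈ (e : Sym2 V)} 1

/-- The condition `(♯)`: no induced subgraph of `G` consists of two vertex disjoint odd cycles
`c₁`, `c₂` joined by a path `p` of length at least `1` (which meets the cycles only in its
endpoints). -/
def CondSharp (G : SimpleGraph V) : Prop :=
  ∀ (u v : V) (c₁ : G.Walk u u) (c₂ : G.Walk v v) (p : G.Walk u v),
    c₁.IsCycle → Odd c₁.length → c₂.IsCycle → Odd c₂.length →
    (∀ x ∈ c₁.support, x ∉ c₂.support) →
    p.IsPath → 1 ≤ p.length →
    (∀ x ∈ p.support, x ∈ c₁.support → x = u) →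
    (∀ x ∈ p.support, x ∈ c₂.support → x = v) →
    ¬ (c₁.toSubgraph ⊔ p.toSubgraph ⊔ c₂.toSubgraph).IsInduced

variable {G : SimpleGraph V} {u : V}

/-- The edge of `w` at position `i`, where positions are counted from `0`. -/
def walkEdge (w : G.Walk u u) (i : Fin w.length) : G.edgeSet :=
  ⟨s(w.getVert i, w.getVert (i + 1)), w.adj_getVert_succ i.2⟩

/-- The binomial `B_w = B_w^{(+)} - B_w^{(-)}`: with positions counted from `0`, the first product
runs over the 1st, 3rd, 5th, … edges of `w` and the second over the 2nd, 4th, 6th, … edges. -/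
def walkBinomial (K : Type*) [Field K] (w : G.Walk u u) : MvPolynomial G.edgeSet K :=
  (∏ i : Fin w.length with Even i.val, MvPolynomial.X (walkEdge w i))
    - ∏ i : Fin w.length with Odd i.val, MvPolynomial.X (walkEdge w i)

/-- A biconnected subgraph: connected, without a cut vertex (for a connected graph, a cut vertex
is one whose removal leaves a disconnected graph). -/
def IsBiconnected (H : G.Subgraph) : Prop :=
  H.Connected ∧ ∀ v ∈ H.verts, (H.deleteVerts {v}).Preconnected

/-- A block of the walk `w`: a maximal biconnected subgraph of `w`, regarded as a subgraph. -/
def IsBlock (w : G.Walk u u) (B : G.Subgraph) : Prop :=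
  Maximal (fun H : G.Subgraph => H ≤ w.toSubgraph ∧ IsBiconnected H) B

/-- With `v₀, v₁, …` the successive vertices of `w`: the vertices `v_k`, `v_l` lie in two different
blocks of `w`. A chord `{v_k, v_l}` with this property is a bridge of `w`. -/
def IsBridgeAt (w : G.Walk u u) (k l : ℕ) : Prop :=
  ∃ B₁ B₂ : G.Subgraph, IsBlock w B₁ ∧ IsBlock w B₂ ∧ B₁ ≠ B₂ ∧
    w.getVert k ∈ B₁.verts ∧ w.getVert l ∈ B₂.verts

/-- `{v_k, v_l}` (with `k < l`) is an odd chord of the even closed walk `w`: it is an edge of `G`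
that is not an edge of `w`, it is not a bridge, and both closed walks into which it breaks `w`
have odd length. -/
def IsOddChord (w : G.Walk u u) (k l : ℕ) : Prop :=
  k < l ∧ l < w.length ∧ G.Adj (w.getVert k) (w.getVert l) ∧
    s(w.getVert k, w.getVert l) ∉ w.edges ∧ ¬ IsBridgeAt w k l ∧
    Odd ((l - k) + 1) ∧ Odd ((w.length - (l - k)) + 1)

/-- The odd chords `{v_t, v_j}` and `{v_t', v_j'}` (`t < j`, `t' < j'`) cross effectively. -/
def CrossEffectively (t j t' j' : ℕ) : Prop :=
  Odd ((t' : ℤ) - (t : ℤ)) ∧ ((t < t' ∧ t' < j ∧ j < j') ∨ (t' < t ∧ t < j' ∧ j' < j))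

/-- `w` has an `𝓕₄`: there is a cycle `ξ = (e, f, e', f')` of length `4` in `G` in which `e`, `e'`
are edges of `w`, both odd or both even, and `f`, `f'` are odd chords of `w` which cross
effectively. -/
def HasF4 (w : G.Walk u u) : Prop :=
  ∃ (i i' : Fin w.length) (t j t' j' : ℕ) (a : V) (ξ : G.Walk a a),
    (Even (i : ℕ) ↔ Even (i' : ℕ)) ∧
    IsOddChord w t j ∧ IsOddChord w t' j' ∧ CrossEffectively t j t' j' ∧
    ξ.IsCycle ∧
    ξ.edges = [(walkEdge w i : Sym2 V), s(w.getVert t, w.getVert j),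
      (walkEdge w i' : Sym2 V), s(w.getVert t', w.getVert j')]

/-- The simplicial complex `Γ_G` of the toric ideal of the graph `G`. -/
def gammaGraph (K : Type*) [Field K] (G : SimpleGraph V) :
    PreAbstractSimplicialComplex (Finset G.edgeSet) :=
  gammaComplex K (edgeVec G)

end Graph

end GraphToric

end

noncomputable section

namespace GraphToric

/-! ### Monomials of a toric ideal -/

section Fibres

variable {σ ι : Type*} {A : σ → ι → ℤ}

/-! Indispensable monomials are the critical ones: they share their degree with another monomial,
but no proper divisor does (`isIndispensableMonomial_iff`). Two distinct monomials of one degree,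
one of them critical, form a primitive binomial and are the two halves of an even closed walk.

In a primitive walk a vertex recurs only at odd distance, and recurrences do not cross, since
otherwise some arcs of the walk would give a proper homogeneous divisor. If a half is critical, the
walk has moreover no chord that splits it into shorter even walks. Two separate recurrences would
then be the cut vertices of two disjoint odd closed walks. An odd closed walk contains an induced
odd cycle with an induced tail to its base vertex (`exists_induced_lollipop`), so the condition (♯)
forbids this (`ClosedSeq.false_of_two_doubles`). Consequently critical monomials are squarefree and
their supports are incomparable. A count of edges (`ClosedSeq.card_edges_of_double`) then shows that
supports of critical monomials carry monomials of equal degree only if the critical monomials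
themselves have equal degree (`IsCritical.degA_eq_of_support`). So the components of the complex are
the full simplices on the critical monomials of one degree, and both claims become claims about
fibres.

Let M be critical and N the other half of a walk. A third monomial of the fibre contains two
effectively crossing chords (`ClosedSeq.exists_crossing_chords`), and criticality of M makes them
opposite sides of a square whose other two sides divide N (`ClosedSeq.square_of_crossing_chords`).
If N is not critical, a third monomial arises by exchanging a critical divisor of N, so the walk has
an 𝓕₄. Conversely an 𝓕₄ is a quadratic non-rigid divisor of M or N, so if both are critical they are
quadratic. If three monomials of the fibre are critical, the walk is a square, any third monomial
contains its diagonals, and coprimality excludes a fourth. -/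

theorem degA_add (u v : σ →₀ ℕ) : degA A (u + v) = degA A u + degA A v :=
  map_add _ u v

theorem degA_zero : degA A 0 = 0 :=
  map_zero _

theorem degA_single (e : σ) : degA A (Finsupp.single e 1) = A e := by
  simp [degA]

theorem degA_sub {u v : σ →₀ ℕ} (h : v ≤ u) : degA A (u - v) = degA A u - degA A v := by
  rw [eq_sub_iff_add_eq, ← degA_add, tsub_add_cancel_of_le h]

/-- The monomial `x^u` is the only one of its `A`-degree. -/
def IsRigid (A : σ → ι → ℤ) (u : σ →₀ ℕ) : Prop :=
  ∀ v, degA A v = degA A u → v = u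

/-- `x^u` shares its `A`-degree with another monomial, but no proper divisor of it does. -/
def IsCritical (A : σ → ι → ℤ) (u : σ →₀ ℕ) : Prop :=
  ¬ IsRigid A u ∧ ∀ u' < u, IsRigid A u'

theorem not_isRigid_iff {u : σ →₀ ℕ} : ¬ IsRigid A u ↔ ∃ v, degA A v = degA A u ∧ v ≠ u := by
  simp [IsRigid]

/-- Exhibits any binomial of equal degrees as a monomial multiple of one of the defining generators
of the lattice ideal. -/
theorem posPart_add_eq (a b : σ →₀ ℕ) :
    ∃ c, a = c + posPart (a.mapRange (Nat.cast : ℕ → ℤ) rfl - b.mapRange (Nat.cast : ℕ → ℤ) rfl) ∧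
      b = c + posPart
        (-(a.mapRange (Nat.cast : ℕ → ℤ) rfl - b.mapRange (Nat.cast : ℕ → ℤ) rfl)) := by
  refine ⟨a ⊓ b, ?_, ?_⟩ <;> ext i <;> simp [posPart] <;> omega

theorem linearCombination_mapRange (a : σ →₀ ℕ) :
    Finsupp.linearCombination ℤ A (a.mapRange (Nat.cast : ℕ → ℤ) rfl) = degA A a := by
  induction a using Finsupp.induction_linear with
  | zero => simp [degA]
  | add f g hf hg =>
    rw [Finsupp.mapRange_add (by simp), map_add, hf, hg, degA_add]
  | single e n => simp [degA]

theorem posPart_sub_posPart (u : σ →₀ ℤ) :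
    (posPart u).mapRange (Nat.cast : ℕ → ℤ) rfl - (posPart (-u)).mapRange (Nat.cast : ℕ → ℤ) rfl
      = u := by
  ext i
  simp [posPart]

theorem degA_posPart_eq {u : σ →₀ ℤ} (hu : u ∈ kerZ A) :
    degA A (posPart u) = degA A (posPart (-u)) := by
  rw [← sub_eq_zero, ← linearCombination_mapRange, ← linearCombination_mapRange, ← map_sub,
    posPart_sub_posPart]
  exact hu

variable {K : Type*} [Field K]

/-- The substitution of the group algebra element with exponent `A e` for each variable kills the
toric ideal, and so detects degrees. -/
theorem aeval_monomial_degA (u : σ →₀ ℕ) :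
    MvPolynomial.aeval (fun e => AddMonoidAlgebra.single (A e) (1 : K))
      (MvPolynomial.monomial u (1 : K)) = AddMonoidAlgebra.single (degA A u) (1 : K) := by
  induction u using Finsupp.induction_linear with
  | zero =>
    rw [MvPolynomial.monomial_zero', map_one, map_one, degA_zero, AddMonoidAlgebra.one_def]
  | add f g hf hg =>
    have : MvPolynomial.monomial (f + g) (1 : K)
        = MvPolynomial.monomial f 1 * MvPolynomial.monomial g 1 := by
      rw [MvPolynomial.monomial_mul, one_mul]
    rw [this, map_mul, hf, hg, AddMonoidAlgebra.single_mul_single, degA_add, one_mul]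
  | single e n =>
    rw [← MvPolynomial.X_pow_eq_monomial, map_pow, MvPolynomial.aeval_X,
      AddMonoidAlgebra.single_pow, one_pow]
    simp [degA]

theorem aeval_eq_zero_of_mem_toricIdeal {f : MvPolynomial σ K} (hf : f ∈ toricIdeal K A) :
    MvPolynomial.aeval (fun e => AddMonoidAlgebra.single (A e) (1 : K)) f = 0 := by
  suffices toricIdeal K A ≤ RingHom.ker
      (MvPolynomial.aeval (R := K) (fun e => AddMonoidAlgebra.single (A e) (1 : K))) from this hf
  refine Ideal.span_le.2 ?_
  rintro _ ⟨u, hu, rfl⟩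
  simp only [SetLike.mem_coe, RingHom.mem_ker, map_sub, aeval_monomial_degA, degA_posPart_eq hu,
    sub_self]

theorem monomial_sub_mem_toricIdeal {a b : σ →₀ ℕ} :
    MvPolynomial.monomial a (1 : K) - MvPolynomial.monomial b 1 ∈ toricIdeal K A ↔
      degA A a = degA A b := by
  constructor
  · intro h
    have := aeval_eq_zero_of_mem_toricIdeal h
    rw [map_sub, aeval_monomial_degA, aeval_monomial_degA, sub_eq_zero] at this
    exact AddMonoidAlgebra.single_left_injective one_ne_zero this
  · intro h
    obtain ⟨c, ha, hb⟩ := posPart_add_eq a b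
    set u := a.mapRange (Nat.cast : ℕ → ℤ) rfl - b.mapRange (Nat.cast : ℕ → ℤ) rfl with hu
    have hmem : u ∈ kerZ A := by
      simp [kerZ, hu, linearCombination_mapRange, h]
    have : MvPolynomial.monomial a (1 : K) - MvPolynomial.monomial b 1
        = MvPolynomial.monomial c 1 * (MvPolynomial.monomial (posPart u) 1
          - MvPolynomial.monomial (posPart (-u)) 1) := by
      rw [mul_sub, MvPolynomial.monomial_mul, MvPolynomial.monomial_mul, one_mul, ← ha, ← hb]
    rw [this]
    exact Ideal.mul_mem_left _ _ (Ideal.subset_span ⟨u, hmem, rfl⟩)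

theorem mem_support_monomial_sub {a b u : σ →₀ ℕ} :
    u ∈ (MvPolynomial.monomial a (1 : K) - MvPolynomial.monomial b 1).support ↔
      a ≠ b ∧ (u = a ∨ u = b) := by
  classical
  rw [MvPolynomial.mem_support_iff, MvPolynomial.coeff_sub, MvPolynomial.coeff_monomial,
    MvPolynomial.coeff_monomial]
  by_cases h1 : a = u <;> by_cases h2 : b = u <;> simp [h1, h2, eq_comm]

/-- The ideal generated by `S` lies in the monomial ideal generated by all monomials that occur in
`S`. -/
theorem exists_le_mem_support {I : Ideal (MvPolynomial σ K)} {S : Set (MvPolynomial σ K)}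
    (hS : Ideal.span S = I) {f : MvPolynomial σ K} (hf : f ∈ I) {u : σ →₀ ℕ}
    (hu : u ∈ f.support) : ∃ B ∈ S, ∃ w ∈ B.support, w ≤ u := by
  have hle : I ≤ Ideal.span ((fun s => MvPolynomial.monomial s (1 : K)) ''
      {w | ∃ B ∈ S, w ∈ B.support}) := by
    rw [← hS, Ideal.span_le]
    intro B hB
    exact MvPolynomial.mem_ideal_span_monomial_image.2 fun w hw => ⟨w, ⟨B, hB, hw⟩, le_rfl⟩
  obtain ⟨w, ⟨B, hB, hw⟩, hwu⟩ := MvPolynomial.mem_ideal_span_monomial_image.1 (hle hf) u hu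
  exact ⟨B, hB, w, hw, hwu⟩

/-- A rigid monomial occurs in none of the defining generators, and one with a non-rigid proper
divisor can be bypassed through that divisor. Conversely, every generating system contains a divisor
of a critical `u` as a non-rigid monomial, which must be `u`. The hypothesis `hA` keeps a proper
divisor from having the degree of `u` itself. -/
theorem isIndispensableMonomial_iff
    (hA : ∀ a b, degA A a = degA A b → a.degree = b.degree) {u : σ →₀ ℕ} :
    IsIndispensableMonomial (toricIdeal K A) u ↔ IsCritical A u := by
  constructor
  · intro h
    refine ⟨fun hr => ?_, fun u' hu' => ?_⟩
    · obtain ⟨B, ⟨v, hv, rfl⟩, hB⟩ := h _ ⟨by rintro f ⟨v, -, rfl⟩; exact ⟨_, _, rfl⟩, rfl⟩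
      obtain ⟨hne, rfl | rfl⟩ := mem_support_monomial_sub.1 hB
      · exact hne (hr _ (degA_posPart_eq hv).symm).symm
      · exact hne (hr _ (degA_posPart_eq hv))
    · by_contra hne'
      obtain ⟨v', hv', hvu⟩ := not_isRigid_iff.1 hne'
      have hlt : ∀ {w : σ →₀ ℕ}, degA A w = degA A u' → w ≠ u := by
        rintro w hw rfl
        have h1 := hA _ _ hw
        have h2 : (w - u').degree + u'.degree = w.degree := by
          rw [← map_add, tsub_add_cancel_of_le hu'.le]
        have h3 : w - u' = 0 := by
          rw [← Finsupp.degree_eq_zero_iff]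
          omega
        exact absurd (tsub_eq_zero_iff_le.1 h3) hu'.not_ge
      let S : Set (MvPolynomial σ K) := {f | ∃ a b, a ≠ u ∧ b ≠ u ∧ degA A a = degA A b ∧
        f = MvPolynomial.monomial a (1 : K) - MvPolynomial.monomial b 1}
      have hSI : Ideal.span S ≤ toricIdeal K A := by
        rw [Ideal.span_le]
        rintro _ ⟨a, b, -, -, hab, rfl⟩
        exact monomial_sub_mem_toricIdeal.2 hab
      have key : ∀ b, degA A u = degA A b →
          MvPolynomial.monomial u (1 : K) - MvPolynomial.monomial b 1 ∈ Ideal.span S := by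
        intro b hb
        by_cases hbu : b = u
        · simp [hbu]
        have hu : u - u' + u' = u := tsub_add_cancel_of_le hu'.le
        -- The detour from `u` to `b` passes through `u - u' + v'`; both binomials on the right
        -- avoid `u`.
        have : MvPolynomial.monomial u (1 : K) - MvPolynomial.monomial b 1
            = MvPolynomial.monomial (u - u') 1 * (MvPolynomial.monomial u' 1
              - MvPolynomial.monomial v' 1) + (MvPolynomial.monomial (u - u' + v') 1
              - MvPolynomial.monomial b 1) := by
          rw [mul_sub, MvPolynomial.monomial_mul, MvPolynomial.monomial_mul, one_mul, hu]
          ring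
        rw [this]
        refine add_mem (Ideal.mul_mem_left _ _ (Ideal.subset_span
          ⟨u', v', hu'.ne, hlt hv', hv'.symm, rfl⟩)) (Ideal.subset_span ⟨_, b, ?_, hbu, ?_, rfl⟩)
        · intro h'
          exact hvu (add_left_cancel (h'.trans hu.symm))
        · rw [degA_add, hv', ← degA_add, hu, hb]
      obtain ⟨B, ⟨a, b, ha, hb, -, rfl⟩, hB⟩ := h S ⟨by
        rintro _ ⟨a, b, -, -, -, rfl⟩; exact ⟨a, b, rfl⟩, by
        refine le_antisymm hSI (Ideal.span_le.2 ?_)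
        rintro _ ⟨w, hw, rfl⟩
        have hd := degA_posPart_eq hw
        by_cases ha : posPart w = u
        · rw [ha]
          exact key _ (ha ▸ hd)
        by_cases hb : posPart (-w) = u
        · rw [hb, ← neg_sub]
          exact neg_mem (key _ (by rw [← hb]; exact hd.symm))
        exact Ideal.subset_span ⟨_, _, ha, hb, hd, rfl⟩⟩
      obtain ⟨-, rfl | rfl⟩ := mem_support_monomial_sub.1 hB
      exacts [ha rfl, hb rfl]
  · rintro ⟨hu, hmin⟩ S ⟨hbin, hspan⟩
    obtain ⟨v, hv, hvu⟩ := not_isRigid_iff.1 hu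
    obtain ⟨B, hB, w, hw, hwu⟩ := exists_le_mem_support hspan
      (monomial_sub_mem_toricIdeal.2 hv.symm)
      (mem_support_monomial_sub.2 ⟨hvu.symm, Or.inl rfl⟩)
    obtain ⟨a, b, rfl⟩ := hbin B hB
    have hab : degA A a = degA A b :=
      monomial_sub_mem_toricIdeal.1 (hspan ▸ Ideal.subset_span hB)
    obtain ⟨hne, hw'⟩ := mem_support_monomial_sub.1 hw
    have hwr : ¬ IsRigid A w := by
      rcases hw' with rfl | rfl
      · exact fun h => hne (h b hab.symm).symm
      · exact fun h => hne (h a hab)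
    refine ⟨_, hB, ?_⟩
    rcases hwu.lt_or_eq with h | h
    · exact absurd (hmin w h) hwr
    · exact h ▸ hw

theorem exists_isCritical_le {u : σ →₀ ℕ} (hu : ¬ IsRigid A u) :
    ∃ u' ≤ u, IsCritical A u' := by
  obtain ⟨m, hm, hmin⟩ := WellFounded.has_min (wellFounded_lt (α := σ →₀ ℕ))
    {w | w ≤ u ∧ ¬ IsRigid A w} ⟨u, le_rfl, hu⟩
  refine ⟨m, hm.1, hm.2, fun w hw => ?_⟩
  by_contra h
  exact hmin w ⟨hw.le.trans hm.1, h⟩ hw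

theorem IsCritical.eq_of_le {u w : σ →₀ ℕ} (hu : IsCritical A u) (hw : ¬ IsRigid A w)
    (hle : w ≤ u) : w = u := by
  rcases hle.lt_or_eq with h | h
  · exact absurd (hu.2 w h) hw
  · exact h

/-- Two monomials of the same degree, one of them critical, have no common variable. -/
theorem IsCritical.disjoint {u v : σ →₀ ℕ} (hu : IsCritical A u) (hv : degA A v = degA A u)
    (hne : v ≠ u) (e : σ) : u e = 0 ∨ v e = 0 := by
  by_contra! h
  have hue : Finsupp.single e 1 ≤ u := by simp; omega
  have hve : Finsupp.single e 1 ≤ v := by simp; omega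
  have hlt : u - Finsupp.single e 1 < u := by
    refine lt_of_le_of_ne tsub_le_self fun h' => ?_
    have := DFunLike.congr_fun h' e
    simp at this
    omega
  -- Dividing both monomials by the common variable keeps their degrees equal, and the quotient of
  -- `u` is rigid.
  have := hu.2 _ hlt (v - Finsupp.single e 1) (by rw [degA_sub hue, degA_sub hve, hv])
  refine hne ?_
  rw [← tsub_add_cancel_of_le hve, this, tsub_add_cancel_of_le hue]

end Fibres

/-! ### Degrees of edge monomials -/

section EdgeMonomials

variable {V : Type*} {G : SimpleGraph V}

/-- The unit vector at the vertex `x`. -/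
def delta (x : V) : V → ℤ :=
  Set.indicator {x} 1

theorem delta_self (x : V) : delta x x = 1 := by
  simp [delta]

theorem delta_of_ne {x y : V} (h : y ≠ x) : delta x y = 0 := by
  simp [delta, h]

theorem edgeVec_mk {x y : V} (h : G.Adj x y) : edgeVec G ⟨s(x, y), h⟩ = delta x + delta y := by
  funext z
  by_cases hx : z = x
  · subst hx
    simp [edgeVec, delta, h.ne]
  · by_cases hy : z = y
    · subst hy
      simp [edgeVec, delta, h.ne.symm]
    · simp [edgeVec, delta, hx, hy]

theorem edgeVec_of_mem {e : G.edgeSet} {x : V} (h : x ∈ (e : Sym2 V)) : edgeVec G e x = 1 := by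
  simp [edgeVec, h]

theorem edgeVec_of_notMem {e : G.edgeSet} {x : V} (h : x ∉ (e : Sym2 V)) :
    edgeVec G e x = 0 := by
  simp [edgeVec, h]

theorem edgeVec_nonneg (e : G.edgeSet) (x : V) : 0 ≤ edgeVec G e x :=
  Set.indicator_nonneg (fun _ _ => zero_le_one) x

theorem degA_apply [Fintype G.edgeSet] (u : G.edgeSet →₀ ℕ) (x : V) :
    degA (edgeVec G) u x = ∑ e, (u e : ℤ) * edgeVec G e x := by
  rw [degA, Finsupp.linearCombination_apply, Finsupp.sum_fintype _ _ (by simp), Finset.sum_apply]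
  simp

theorem sum_delta [Fintype V] (x : V) : ∑ y, delta x y = 1 := by
  rw [Finset.sum_eq_single x (fun y _ h => delta_of_ne h) (by simp), delta_self]

theorem sum_edgeVec [Fintype V] (e : G.edgeSet) : ∑ x, edgeVec G e x = 2 := by
  obtain ⟨e, he⟩ := e
  induction e with
  | h x y =>
    rw [edgeVec_mk he]
    simp only [Pi.add_apply, Finset.sum_add_distrib, sum_delta]
    norm_num

theorem sum_degA [Fintype V] (u : G.edgeSet →₀ ℕ) :
    ∑ x, degA (edgeVec G) u x = 2 * (u.degree : ℤ) := by
  induction u using Finsupp.induction_linear with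
  | zero => simp [degA_zero]
  | add f g hf hg => simp [degA_add, Finset.sum_add_distrib, hf, hg, mul_add]
  | single e n =>
    simp [degA, mul_comm _ (n : ℤ), ← Finset.mul_sum, sum_edgeVec]

theorem degree_lt_of_lt {a b : G.edgeSet →₀ ℕ} (h : a < b) : a.degree < b.degree := by
  have h2 : (b - a).degree + a.degree = b.degree := by
    rw [← map_add, tsub_add_cancel_of_le h.le]
  rcases Nat.eq_zero_or_pos (b - a).degree with h0 | h0
  · rw [Finsupp.degree_eq_zero_iff] at h0
    exact absurd (tsub_eq_zero_iff_le.1 h0) h.not_ge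
  · omega

variable [Finite V]

theorem degA_apply_le {Y Z : G.edgeSet →₀ ℕ} {x : V}
    (h : ∀ e : G.edgeSet, x ∈ (e : Sym2 V) → Y e ≤ Z e) :
    degA (edgeVec G) Y x ≤ degA (edgeVec G) Z x := by
  have : Fintype G.edgeSet := Fintype.ofFinite _
  rw [degA_apply, degA_apply]
  refine Finset.sum_le_sum fun e _ => ?_
  by_cases he : x ∈ (e : Sym2 V)
  · exact mul_le_mul_of_nonneg_right (by exact_mod_cast h e he) (edgeVec_nonneg e x)
  · simp [edgeVec_of_notMem he]

theorem eq_of_degA_apply_eq {Y Z : G.edgeSet →₀ ℕ} {x : V}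
    (h : ∀ e : G.edgeSet, x ∈ (e : Sym2 V) → Y e ≤ Z e)
    (heq : degA (edgeVec G) Y x = degA (edgeVec G) Z x) {e : G.edgeSet}
    (he : x ∈ (e : Sym2 V)) : Y e = Z e := by
  have : Fintype G.edgeSet := Fintype.ofFinite _
  rw [degA_apply, degA_apply, Finset.sum_eq_sum_iff_of_le] at heq
  · have := heq e (Finset.mem_univ e)
    rw [edgeVec_of_mem he] at this
    simpa using this
  · intro e _
    by_cases he : x ∈ (e : Sym2 V)
    · exact mul_le_mul_of_nonneg_right (by exact_mod_cast h e he) (edgeVec_nonneg e x)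
    · simp [edgeVec_of_notMem he]

theorem exists_lt_of_degA_apply_lt {Y Z : G.edgeSet →₀ ℕ} {x : V}
    (h : degA (edgeVec G) Y x < degA (edgeVec G) Z x) :
    ∃ e : G.edgeSet, x ∈ (e : Sym2 V) ∧ Y e < Z e := by
  by_contra! hc
  exact h.not_ge (degA_apply_le hc)

theorem degA_apply_mono {Y Z : G.edgeSet →₀ ℕ} (h : Y ≤ Z) (x : V) :
    degA (edgeVec G) Y x ≤ degA (edgeVec G) Z x :=
  degA_apply_le fun e _ => h e

theorem le_degA_apply (u : G.edgeSet →₀ ℕ) {e : G.edgeSet} {x : V} (he : x ∈ (e : Sym2 V)) :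
    (u e : ℤ) ≤ degA (edgeVec G) u x := by
  have : Finsupp.single e (u e) ≤ u := by simp
  refine le_trans ?_ (degA_apply_mono this x)
  simp [degA, edgeVec_of_mem he]

theorem exists_of_degA_apply_pos {u : G.edgeSet →₀ ℕ} {x : V}
    (h : 0 < degA (edgeVec G) u x) : ∃ e : G.edgeSet, x ∈ (e : Sym2 V) ∧ 0 < u e := by
  obtain ⟨e, he, hlt⟩ := exists_lt_of_degA_apply_lt (Y := 0) (Z := u) (x := x)
    (by simpa [degA_zero] using h)
  exact ⟨e, he, by simpa using hlt⟩

theorem degree_eq_of_degA_eq {a b : G.edgeSet →₀ ℕ}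
    (h : degA (edgeVec G) a = degA (edgeVec G) b) : a.degree = b.degree := by
  have : Fintype V := Fintype.ofFinite V
  have h1 := sum_degA a
  have h2 := sum_degA b
  rw [h] at h1
  have := h1.symm.trans h2
  omega

theorem eq_of_le_of_degA_eq {a b : G.edgeSet →₀ ℕ} (hle : a ≤ b)
    (h : degA (edgeVec G) a = degA (edgeVec G) b) : a = b := by
  have h1 := degree_eq_of_degA_eq h
  have h2 : (b - a).degree + a.degree = b.degree := by
    rw [← map_add, tsub_add_cancel_of_le hle]
  have h3 : b - a = 0 := by
    rw [← Finsupp.degree_eq_zero_iff]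
    omega
  exact le_antisymm hle (tsub_eq_zero_iff_le.1 h3)

end EdgeMonomials

/-! ### The two monomials of a walk -/

section WalkMonomials

variable {V : Type*} {G : SimpleGraph V}

/-- The edge of `w` at position `i`. -/
def edgeAt {x y : V} (w : G.Walk x y) (i : Fin w.length) : G.edgeSet :=
  ⟨s(w.getVert i, w.getVert (i + 1)), w.adj_getVert_succ i.2⟩

/-- The product of the edges at the positions `0, 2, 4, …`. -/
def evenPart {x y : V} (w : G.Walk x y) : G.edgeSet →₀ ℕ :=
  ∑ i : Fin w.length with Even i.val, Finsupp.single (edgeAt w i) 1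

/-- The product of the edges at the positions `1, 3, 5, …`. -/
def oddPart {x y : V} (w : G.Walk x y) : G.edgeSet →₀ ℕ :=
  ∑ i : Fin w.length with Odd i.val, Finsupp.single (edgeAt w i) 1

theorem evenPart_nil {x : V} : evenPart (SimpleGraph.Walk.nil : G.Walk x x) = 0 :=
  rfl

theorem oddPart_nil {x : V} : oddPart (SimpleGraph.Walk.nil : G.Walk x x) = 0 :=
  rfl

theorem evenPart_cons {x y z : V} (h : G.Adj x y) (p : G.Walk y z) :
    evenPart (SimpleGraph.Walk.cons h p) = Finsupp.single ⟨s(x, y), h⟩ 1 + oddPart p := by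
  rw [evenPart, oddPart, Finset.sum_filter, Finset.sum_filter]
  refine (Fin.sum_univ_succ (n := p.length) _).trans ?_
  congr 1
  · simp [edgeAt]
  · refine Finset.sum_congr rfl fun i _ => ?_
    simp [Nat.even_add_one, edgeAt]

theorem oddPart_cons {x y z : V} (h : G.Adj x y) (p : G.Walk y z) :
    oddPart (SimpleGraph.Walk.cons h p) = evenPart p := by
  rw [evenPart, oddPart, Finset.sum_filter, Finset.sum_filter]
  refine (Fin.sum_univ_succ (n := p.length) _).trans ?_
  rw [if_neg (by simp), zero_add]
  refine Finset.sum_congr rfl fun i _ => ?_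
  simp [Nat.odd_add_one, edgeAt]

/-- The inner vertices cancel. In an even closed walk the two ends cancel as well; in an odd closed
walk the base vertex counts twice. -/
theorem degA_evenPart_sub_oddPart {x y : V} (w : G.Walk x y) :
    degA (edgeVec G) (evenPart w) - degA (edgeVec G) (oddPart w)
      = delta x - (-1) ^ w.length * delta y := by
  induction w with
  | nil => simp [evenPart_nil, oddPart_nil]
  | cons h p ih =>
    rw [evenPart_cons, oddPart_cons, degA_add, degA_single, edgeVec_mk,
      SimpleGraph.Walk.length_cons, pow_succ]
    linear_combination -ih

theorem degree_evenPart_add_degree_oddPart {x y : V} (w : G.Walk x y) :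
    (evenPart w).degree + (oddPart w).degree = w.length := by
  induction w with
  | nil => simp [evenPart_nil, oddPart_nil]
  | cons h p ih =>
    rw [evenPart_cons, oddPart_cons, map_add, Finsupp.degree_single, SimpleGraph.Walk.length_cons]
    omega

theorem degA_evenPart_eq {x : V} {w : G.Walk x x} (hw : Even w.length) :
    degA (edgeVec G) (evenPart w) = degA (edgeVec G) (oddPart w) := by
  rw [← sub_eq_zero, degA_evenPart_sub_oddPart, hw.neg_one_pow]
  simp

theorem walkBinomial_eq (K : Type*) [Field K] {x : V} (w : G.Walk x x) :
    walkBinomial K w = MvPolynomial.monomial (evenPart w) 1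
      - MvPolynomial.monomial (oddPart w) 1 := by
  rw [walkBinomial, evenPart, oddPart, MvPolynomial.monomial_sum_one,
    MvPolynomial.monomial_sum_one]
  rfl

/-- Equality of degrees forces an even closed walk whose edges alternate between the two
monomials. -/
theorem exists_closed_walk [Finite V] {X Y : G.edgeSet →₀ ℕ}
    (hXY : degA (edgeVec G) X = degA (edgeVec G) Y) (hX : X ≠ 0) :
    ∃ (x : V) (w : G.Walk x x), Even w.length ∧ 0 < w.length ∧
      ((evenPart w ≤ X ∧ oddPart w ≤ Y) ∨ (evenPart w ≤ Y ∧ oddPart w ≤ X)) := by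
  by_contra! hno
  -- Without the desired closed walk an alternating walk can always be prolonged at its start, while
  -- the degrees of `X` and `Y` bound its length.
  have key : ∀ n, ∃ (x y : V) (w : G.Walk x y), w.length = n + 1 ∧
      ((evenPart w ≤ X ∧ oddPart w ≤ Y) ∨ (evenPart w ≤ Y ∧ oddPart w ≤ X)) := by
    have step : ∀ (X Y : G.edgeSet →₀ ℕ), degA (edgeVec G) X = degA (edgeVec G) Y →
        ∀ (x y : V) (w : G.Walk x y), evenPart w ≤ X → oddPart w ≤ Y → 0 < w.length →
        (x = y → Odd w.length) → ∃ (z : V) (h : G.Adj z x),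
        oddPart (SimpleGraph.Walk.cons h w) ≤ X ∧ evenPart (SimpleGraph.Walk.cons h w) ≤ Y := by
      intro X Y hXY x y w hwX hwY hpos hodd
      have hd := congrFun (degA_evenPart_sub_oddPart w) x
      simp only [Pi.sub_apply, Pi.mul_apply, Pi.pow_apply, Pi.neg_apply, Pi.one_apply,
        delta_self] at hd
      -- At `x` the half with the first edge exceeds the other by 1, or by 2 when `w` is closed of
      -- odd length. So `Y` has an unused edge at `x`.
      have hlt : degA (edgeVec G) (oddPart w) x < degA (edgeVec G) Y x := by
        rw [← hXY]
        refine lt_of_lt_of_le ?_ (degA_apply_mono hwX x)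
        by_cases hxy : x = y
        · have hy : delta y x = 1 := by rw [hxy, delta_self]
          rw [(hodd hxy).neg_one_pow, hy] at hd
          omega
        · rw [delta_of_ne hxy] at hd
          omega
      obtain ⟨⟨e, he⟩, hxe, hlt⟩ := exists_lt_of_degA_apply_lt hlt
      obtain ⟨z, rfl⟩ := Sym2.mem_iff_exists.1 hxe
      have hadj : G.Adj z x := G.adj_symm he
      refine ⟨z, hadj, (oddPart_cons hadj w).le.trans hwX, ?_⟩
      have heq : (⟨s(z, x), hadj⟩ : G.edgeSet) = ⟨s(x, z), he⟩ := Subtype.ext Sym2.eq_swap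
      rw [evenPart_cons, heq]
      intro f
      by_cases hf : f = ⟨s(x, z), he⟩
      · subst hf
        simp
        omega
      · rw [Finsupp.add_apply, Finsupp.single_eq_of_ne hf, zero_add]
        exact hwY f
    intro n
    induction n with
    | zero =>
      obtain ⟨e, he⟩ := Finsupp.ne_iff.1 hX
      obtain ⟨e, hadj⟩ := e
      induction e with
      | h x y =>
        have h : G.Adj x y := hadj
        refine ⟨x, y, SimpleGraph.Walk.cons h SimpleGraph.Walk.nil, by simp, Or.inl ⟨?_, ?_⟩⟩
        · rw [evenPart_cons, oddPart_nil, add_zero, Finsupp.single_le_iff]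
          exact Nat.one_le_iff_ne_zero.2 he
        · simp [oddPart_cons, evenPart_nil]
    | succ n ih =>
      obtain ⟨x, y, w, hlen, hw⟩ := ih
      have hodd : x = y → Odd w.length := by
        rintro rfl
        by_contra hev
        rw [Nat.not_odd_iff_even] at hev
        obtain ⟨h1, h2⟩ := hno x w hev (by omega)
        rcases hw with hw | hw
        · exact h1 hw.1 hw.2
        · exact h2 hw.1 hw.2
      rcases hw with hw | hw
      · obtain ⟨z, h, h1, h2⟩ := step X Y hXY x y w hw.1 hw.2 (by omega) hodd
        exact ⟨z, y, _, by simp [hlen], Or.inr ⟨h2, h1⟩⟩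
      · obtain ⟨z, h, h1, h2⟩ := step Y X hXY.symm x y w hw.1 hw.2 (by omega) hodd
        exact ⟨z, y, _, by simp [hlen], Or.inl ⟨h2, h1⟩⟩
  obtain ⟨x, y, w, hlen, hw⟩ := key (X.degree + Y.degree)
  have := degree_evenPart_add_degree_oddPart w
  rcases hw with hw | hw
  · have h1 := Finsupp.degree_mono hw.1
    have h2 := Finsupp.degree_mono hw.2
    omega
  · have h1 := Finsupp.degree_mono hw.1
    have h2 := Finsupp.degree_mono hw.2
    omega

end WalkMonomials

/-! ### Induced odd cycles with a tail -/

section Lollipop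

open SimpleGraph

variable {V : Type*} {H : SimpleGraph V}

theorem isPath_append {x y z : V} {p : H.Walk x y} {q : H.Walk y z} (hp : p.IsPath)
    (hq : q.IsPath) (h : ∀ a ∈ p.support, a ∈ q.support → a = y) : (p.append q).IsPath := by
  have hq' : (y :: q.support.tail).Nodup := by
    rw [Walk.cons_tail_support]
    exact hq.support_nodup
  rw [List.nodup_cons] at hq'
  rw [Walk.isPath_def, Walk.support_append, List.nodup_append]
  refine ⟨hp.support_nodup, hq'.2, ?_⟩
  rintro a ha _ hb rfl
  have := h a ha (List.mem_of_mem_tail hb)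
  exact hq'.1 (this ▸ hb)

theorem dist_getVert_of_geodesic {v z x : V} (p : H.Walk v z) (q : H.Walk z x)
    (h : p.length + q.length = H.dist v x) {r : ℕ} (hr : r ≤ q.length) :
    H.dist v (q.getVert r) = p.length + r := by
  have h1 := dist_le (p.append (q.take r))
  have h2 := dist_le (q.drop r)
  have h3 := Reachable.dist_triangle_left (p.append (q.take r)).reachable x
  rw [Walk.length_append, Walk.take_length] at h1
  rw [Walk.drop_length] at h2
  omega

/-- Otherwise adjacent vertices would have distances from `v` of opposite parity, a 2-colouring that
no odd closed walk admits. -/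
theorem exists_adj_dist_eq {v : V} (c : H.Walk v v) (hc : Odd c.length) :
    ∃ x y, H.Adj x y ∧ H.Reachable v x ∧ H.dist v x = H.dist v y := by
  by_contra! hno
  have key : ∀ {x y : V} (p : H.Walk x y), H.Reachable v x →
      Even (p.length + H.dist v x + H.dist v y) := by
    intro x y p
    induction p with
    | nil => intro _; simp
    | cons h p ih =>
      intro hr
      have h1 := ih (hr.trans h.reachable)
      have h2 := hno _ _ h hr
      have h3 := h.diff_dist_adj (u := v)
      rw [Walk.length_cons]
      rcases h3 with h3 | h3 | h3
      · exact absurd h3.symm h2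
      all_goals
        rw [Nat.even_iff] at *
        omega
  have := key c (Reachable.refl v)
  rw [dist_self, add_zero, add_zero] at this
  exact (Nat.not_even_iff_odd.2 hc) this

/-- A graph with a closed walk of odd length at `v` has an induced subgraph which consists of an
odd cycle and of a path that joins it to `v`. -/
theorem exists_induced_lollipop {v : V} (c : H.Walk v v) (hc : Odd c.length) :
    ∃ (z : V) (p : H.Walk v z) (o : H.Walk z z), p.IsPath ∧ o.IsCycle ∧ Odd o.length ∧
      (∀ a ∈ p.support, a ∈ o.support → a = z) ∧
      ∀ a b, (a ∈ p.support ∨ a ∈ o.support) → (b ∈ p.support ∨ b ∈ o.support) → H.Adj a b →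
        s(a, b) ∈ p.edges ∨ s(a, b) ∈ o.edges := by
  classical
  have hex : ∃ k x y, H.Adj x y ∧ H.Reachable v x ∧ H.dist v x = k ∧ H.dist v y = k := by
    obtain ⟨x, y, h1, h2, h3⟩ := exists_adj_dist_eq c hc
    exact ⟨_, x, y, h1, h2, rfl, h3.symm⟩
  -- The lowest level, by distance from `v`, that contains an edge.
  set k := Nat.find hex with hk
  have hkmin : ∀ x y, H.Adj x y → H.Reachable v x → H.dist v x = H.dist v y →
      k ≤ H.dist v x := fun x y h1 h2 h3 => Nat.find_min' hex ⟨x, y, h1, h2, rfl, h3.symm⟩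
  -- Shortest paths from `v` to both ends of an edge in level `k`, with a common initial part of
  -- length `m`. The choice of a maximal `m` makes them branch as late as possible.
  let P : ℕ → Prop := fun m => ∃ (x y z : V) (p : H.Walk v z) (q₁ : H.Walk z x)
    (q₂ : H.Walk z y), H.Adj x y ∧ H.dist v x = k ∧ H.dist v y = k ∧ p.length = m ∧
      p.length + q₁.length = k ∧ p.length + q₂.length = k
  have hP0 : P 0 := by
    obtain ⟨x, y, h1, h2, h3, h4⟩ := Nat.find_spec hex
    obtain ⟨q₁, hq₁⟩ := h2.exists_walk_length_eq_dist
    obtain ⟨q₂, hq₂⟩ := (h2.trans h1.reachable).exists_walk_length_eq_dist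
    exact ⟨x, y, v, Walk.nil, q₁, q₂, h1, h3, h4, rfl, by simp [hq₁, h3, hk],
      by simp [hq₂, h4, hk]⟩
  have hPle : ∀ m, P m → m ≤ k := by
    rintro m ⟨x, y, z, p, q₁, q₂, -, -, -, h1, h2, -⟩
    omega
  obtain ⟨m, hPm, hmmax⟩ : ∃ m, P m ∧ ∀ m', m < m' → ¬ P m' :=
    ⟨Nat.findGreatest P k, Nat.findGreatest_spec (Nat.zero_le k) hP0, fun m' h h' =>
      Nat.findGreatest_is_greatest h (hPle m' h') h'⟩
  obtain ⟨x, y, z, p, q₁, q₂, hxy, hx, hy, hp, hq₁, hq₂⟩ := hPm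
  have hd₁ : ∀ r ≤ q₁.length, H.dist v (q₁.getVert r) = m + r := fun r hr => by
    rw [dist_getVert_of_geodesic p q₁ (by omega) hr, hp]
  have hd₂ : ∀ r ≤ q₂.length, H.dist v (q₂.getVert r) = m + r := fun r hr => by
    rw [dist_getVert_of_geodesic p q₂ (by omega) hr, hp]
  have hdz : H.dist v z = m := by simpa using hd₁ 0 (Nat.zero_le _)
  have hdp : ∀ r ≤ p.length, H.dist v (p.getVert r) = r := fun r hr => by
    rw [dist_getVert_of_geodesic Walk.nil p (by simp [hp, hdz]) hr]
    simp
  have hmk : m < k := by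
    by_contra hmk
    have h1 := Walk.eq_of_length_eq_zero (p := q₁) (by omega)
    have h2 := Walk.eq_of_length_eq_zero (p := q₂) (by omega)
    exact hxy.ne (h1.symm.trans h2)
  -- vertices of the two geodesics beyond their branching point
  have hmeet : ∀ r, 0 < r → r ≤ q₁.length → q₁.getVert r ≠ q₂.getVert r := by
    intro r hr0 hr heq
    refine hmmax (m + r) (by omega) ⟨x, y, q₁.getVert r, p.append (q₁.take r), q₁.drop r,
      (q₂.drop r).copy heq.symm rfl, hxy, hx, hy, ?_, ?_, ?_⟩ <;>
      simp only [Walk.length_append, Walk.take_length, Walk.drop_length, Walk.length_copy] <;>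
      omega
  -- Such an edge would let the path to `y` follow the path to `x` up to level `m + r`, against the
  -- maximality of `m`.
  have hcross₁ : ∀ r, 0 < r → r + 1 ≤ q₁.length → ¬ H.Adj (q₁.getVert r) (q₂.getVert (r + 1)) := by
    intro r hr0 hr hadj
    refine hmmax (m + r) (by omega) ⟨x, y, q₁.getVert r, p.append (q₁.take r), q₁.drop r,
      Walk.cons hadj (q₂.drop (r + 1)), hxy, hx, hy, ?_, ?_, ?_⟩ <;>
      simp only [Walk.length_append, Walk.take_length, Walk.drop_length, Walk.length_cons] <;>
      omega
  have hcross₂ : ∀ r, 0 < r → r + 1 ≤ q₁.length → ¬ H.Adj (q₂.getVert r) (q₁.getVert (r + 1)) := by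
    intro r hr0 hr hadj
    refine hmmax (m + r) (by omega) ⟨x, y, q₂.getVert r, p.append (q₂.take r),
      Walk.cons hadj (q₁.drop (r + 1)), q₂.drop r, hxy, hx, hy, ?_, ?_, ?_⟩ <;>
      simp only [Walk.length_append, Walk.take_length, Walk.drop_length, Walk.length_cons] <;>
      omega
  have hp' : p.IsPath := Walk.isPath_of_length_eq_dist p (by rw [hp, hdz])
  have hq₁' : q₁.IsPath := by
    have := Walk.isPath_of_length_eq_dist (p.append q₁) (by rw [Walk.length_append]; omega)
    exact this.of_append_right
  have hq₂' : q₂.IsPath := by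
    have := Walk.isPath_of_length_eq_dist (p.append q₂) (by rw [Walk.length_append]; omega)
    exact this.of_append_right
  have hdisj : ∀ a ∈ q₂.support, a ∈ q₁.support → a = z := by
    intro a ha hb
    obtain ⟨i, rfl, hi⟩ := Walk.mem_support_iff_exists_getVert.1 ha
    obtain ⟨j, hj, hj'⟩ := Walk.mem_support_iff_exists_getVert.1 hb
    have h1 := hd₁ j hj'
    have h2 := hd₂ i hi
    rw [hj] at h1
    obtain rfl : i = j := by omega
    rcases Nat.eq_zero_or_pos i with h0 | h0
    · simp [h0]
    · exact absurd hj (hmeet i h0 hj')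
  have hq : (q₂.reverse.append q₁).IsPath :=
    isPath_append hq₂'.reverse hq₁' fun a ha hb => hdisj a (by simpa using ha) hb
  have hmono : ∀ (y : V) (q : H.Walk z y), (∀ r ≤ q.length, H.dist v (q.getVert r) = m + r) →
      ∀ a b, s(a, b) ∈ q.edges → H.dist v a ≠ H.dist v b := by
    intro y q hq a b hab
    rw [← Walk.adj_toSubgraph_iff_mem_edges, Walk.toSubgraph_adj_iff] at hab
    obtain ⟨i, hi, hi'⟩ := hab
    have h1 := hq i hi'.le
    have h2 := hq (i + 1) hi'
    rcases Sym2.eq_iff.1 hi with ⟨rfl, rfl⟩ | ⟨rfl, rfl⟩ <;> omega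
  have hnot : s(x, y) ∉ (q₂.reverse.append q₁).edges := by
    rw [Walk.edges_append, Walk.edges_reverse, List.mem_append, List.mem_reverse]
    rintro (h | h)
    · exact hmono _ _ hd₂ _ _ h (hx.trans hy.symm)
    · exact hmono _ _ hd₁ _ _ h (hx.trans hy.symm)
  have hcyc : (Walk.cons hxy (q₂.reverse.append q₁)).IsCycle :=
    (Walk.cons_isCycle_iff _ _).2 ⟨hq, hnot⟩
  have hzmem : z ∈ (Walk.cons hxy (q₂.reverse.append q₁)).support := by simp
  have hsupp : ∀ a, a ∈ ((Walk.cons hxy (q₂.reverse.append q₁)).rotate z hzmem).support ↔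
      a ∈ q₁.support ∨ a ∈ q₂.support := by
    intro a
    rw [Walk.mem_support_rotate_iff, Walk.support_cons, List.mem_cons,
      Walk.mem_support_append_iff, Walk.support_reverse, List.mem_reverse]
    constructor
    · rintro (rfl | h | h)
      · exact Or.inl q₁.end_mem_support
      · exact Or.inr h
      · exact Or.inl h
    · rintro (h | h)
      · exact Or.inr (Or.inr h)
      · exact Or.inr (Or.inl h)
  have hedges : ∀ e, e ∈ ((Walk.cons hxy (q₂.reverse.append q₁)).rotate z hzmem).edges ↔
      e = s(x, y) ∨ e ∈ q₁.edges ∨ e ∈ q₂.edges := by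
    intro e
    rw [(Walk.rotate_edges _ _ _).mem_iff, Walk.edges_cons, List.mem_cons, Walk.edges_append,
      Walk.edges_reverse, List.mem_append, List.mem_reverse]
    tauto
  have hlen : 2 * q₁.length = 2 * q₂.length := by omega
  refine ⟨z, p, _, hp', (Walk.isCycle_rotate hzmem).2 hcyc, ?_, ?_, ?_⟩
  · rw [Walk.length_rotate, Walk.length_cons, Walk.length_append, Walk.length_reverse]
    exact ⟨q₁.length, by omega⟩
  · intro a ha hb
    rw [hsupp] at hb
    obtain ⟨i, rfl, hi⟩ := Walk.mem_support_iff_exists_getVert.1 ha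
    have h1 := hdp i hi
    have : i = p.length := by
      rcases hb with hb | hb <;> obtain ⟨j, hj, hj'⟩ := Walk.mem_support_iff_exists_getVert.1 hb
      · have h2 := hd₁ j hj'
        rw [hj] at h2
        omega
      · have h2 := hd₂ j hj'
        rw [hj] at h2
        omega
    rw [this, Walk.getVert_length]
  · -- both ends are on `v → z → x` or on `v → z → y`, and their levels differ by at most one
    simp only [hsupp, hedges]
    have hr : ∀ a, (a ∈ p.support ∨ a ∈ q₁.support ∨ a ∈ q₂.support) → H.Reachable v a := by
      rintro a (h | h | h)
      · exact (p.takeUntil a h).reachable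
      · exact (p.append (q₁.takeUntil a h)).reachable
      · exact (p.append (q₂.takeUntil a h)).reachable
    have hform : ∀ a, (a ∈ p.support ∨ a ∈ q₁.support ∨ a ∈ q₂.support) →
        H.dist v a ≤ k ∧ (H.dist v a = k → a = x ∨ a = y) := by
      rintro a (h | h | h) <;> obtain ⟨i, rfl, hi⟩ := Walk.mem_support_iff_exists_getVert.1 h
      · rw [hdp i hi]
        omega
      · rw [hd₁ i hi]
        refine ⟨by omega, fun h => Or.inl ?_⟩
        rw [Walk.getVert_of_length_le _ (by omega)]
      · rw [hd₂ i hi]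
        refine ⟨by omega, fun h => Or.inr ?_⟩
        rw [Walk.getVert_of_length_le _ (by omega)]
    have hstep : ∀ a b, (a ∈ p.support ∨ a ∈ q₁.support ∨ a ∈ q₂.support) →
        (b ∈ p.support ∨ b ∈ q₁.support ∨ b ∈ q₂.support) → H.Adj a b →
        H.dist v b = H.dist v a + 1 →
        s(a, b) ∈ p.edges ∨ s(a, b) = s(x, y) ∨ s(a, b) ∈ q₁.edges ∨ s(a, b) ∈ q₂.edges := by
      have hedge : ∀ {u w : V} (q : H.Walk u w) (i : ℕ), i + 1 ≤ q.length →
          s(q.getVert i, q.getVert (i + 1)) ∈ q.edges := by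
        intro u w q i hi
        rw [← Walk.adj_toSubgraph_iff_mem_edges]
        exact q.toSubgraph_adj_getVert hi
      rintro a b ha hb hab hd
      rcases hb with hb | hb | hb <;> obtain ⟨j, rfl, hj⟩ := Walk.mem_support_iff_exists_getVert.1 hb
      · rw [hdp j hj] at hd
        rcases ha with ha | ha | ha <;>
          obtain ⟨i, rfl, hi⟩ := Walk.mem_support_iff_exists_getVert.1 ha
        · rw [hdp i hi] at hd
          subst hd
          exact Or.inl (hedge p i hj)
        · rw [hd₁ i hi] at hd
          omega
        · rw [hd₂ i hi] at hd
          omega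
      · rw [hd₁ j hj] at hd
        rcases ha with ha | ha | ha <;>
          obtain ⟨i, rfl, hi⟩ := Walk.mem_support_iff_exists_getVert.1 ha
        · rw [hdp i hi] at hd
          rcases Nat.eq_zero_or_pos j with rfl | hj0
          · obtain rfl : i + 1 = m := by omega
            have := hedge p i hp.ge
            rw [← hp, Walk.getVert_length] at this
            exact Or.inl (by simpa using this)
          · obtain ⟨rfl, rfl⟩ : i = p.length ∧ j = 1 := by omega
            rw [Walk.getVert_length]
            have := hedge q₁ 0 hj
            rw [Walk.getVert_zero] at this
            exact Or.inr (Or.inr (Or.inl this))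
        · rw [hd₁ i hi] at hd
          obtain rfl : j = i + 1 := by omega
          exact Or.inr (Or.inr (Or.inl (hedge q₁ i hj)))
        · rw [hd₂ i hi] at hd
          obtain rfl : j = i + 1 := by omega
          rcases Nat.eq_zero_or_pos i with rfl | hi0
          · have := hedge q₁ 0 hj
            rw [Walk.getVert_zero] at this ⊢
            exact Or.inr (Or.inr (Or.inl this))
          · exact absurd hab (hcross₂ i hi0 hj)
      · rw [hd₂ j hj] at hd
        rcases ha with ha | ha | ha <;>
          obtain ⟨i, rfl, hi⟩ := Walk.mem_support_iff_exists_getVert.1 ha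
        · rw [hdp i hi] at hd
          rcases Nat.eq_zero_or_pos j with rfl | hj0
          · obtain rfl : i + 1 = m := by omega
            have := hedge p i hp.ge
            rw [← hp, Walk.getVert_length] at this
            exact Or.inl (by simpa using this)
          · obtain ⟨rfl, rfl⟩ : i = p.length ∧ j = 1 := by omega
            rw [Walk.getVert_length]
            have := hedge q₂ 0 hj
            rw [Walk.getVert_zero] at this
            exact Or.inr (Or.inr (Or.inr this))
        · rw [hd₁ i hi] at hd
          obtain rfl : j = i + 1 := by omega
          rcases Nat.eq_zero_or_pos i with rfl | hi0
          · have := hedge q₂ 0 hj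
            rw [Walk.getVert_zero] at this ⊢
            exact Or.inr (Or.inr (Or.inr this))
          · exact absurd hab (hcross₁ i hi0 (by omega))
        · rw [hd₂ i hi] at hd
          obtain rfl : j = i + 1 := by omega
          exact Or.inr (Or.inr (Or.inr (hedge q₂ i hj)))
    intro a b ha hb hab
    have ha' : a ∈ p.support ∨ a ∈ q₁.support ∨ a ∈ q₂.support := ha
    have hb' : b ∈ p.support ∨ b ∈ q₁.support ∨ b ∈ q₂.support := hb
    rcases hab.diff_dist_adj (u := v) with h | h | h
    · have h1 := hkmin a b hab (hr a ha') h.symm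
      obtain ⟨h2, h3⟩ := hform a ha'
      obtain ⟨-, h4⟩ := hform b hb'
      have h5 := h3 (by omega)
      have h6 := h4 (by omega)
      have hne := hab.ne
      rcases h5 with rfl | rfl <;> rcases h6 with rfl | rfl
      · exact absurd rfl hne
      · exact Or.inr (Or.inl rfl)
      · exact Or.inr (Or.inl Sym2.eq_swap)
      · exact absurd rfl hne
    · exact hstep a b ha' hb' hab h
    · have := hstep b a hb' ha' hab.symm (by
        have := hr a ha'
        rcases Nat.eq_zero_or_pos (H.dist v a) with h0 | h0
        · have h1 := hkmin a b hab this
          omega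
        · omega)
      rwa [Sym2.eq_swap] at this

end Lollipop

/-! ### Pairs of odd closed walks separated by cut vertices -/

section Sharp

open SimpleGraph

variable {V : Type*} {G : SimpleGraph V}

/-- The graph on all of `V` whose edges are the edges of `G` inside `S`. -/
def within (G : SimpleGraph V) (S : Set V) : SimpleGraph V where
  Adj a b := a ∈ S ∧ b ∈ S ∧ G.Adj a b
  symm := ⟨fun _ _ h => ⟨h.2.1, h.1, h.2.2.symm⟩⟩
  loopless := ⟨fun _ h => h.2.2.ne rfl⟩

theorem within_le (G : SimpleGraph V) (S : Set V) : within G S ≤ G :=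
  fun _ _ h => h.2.2

theorem support_subset_of_within {S : Set V} {x y : V} (p : (within G S).Walk x y) (hx : x ∈ S) :
    ∀ a ∈ p.support, a ∈ S := by
  induction p with
  | nil => simpa using hx
  | cons h p ih =>
    intro a ha
    rw [Walk.support_cons, List.mem_cons] at ha
    rcases ha with rfl | ha
    · exact hx
    · exact ih h.2.1 a ha

theorem exists_walk_within {S : Set V} {x y : V} (p : G.Walk x y) (hp : ∀ a ∈ p.support, a ∈ S) :
    ∃ q : (within G S).Walk x y, q.length = p.length := by
  have h : ∀ e ∈ p.edges, e ∈ (within G S).edgeSet := by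
    intro e he
    induction e with
    | h a b => exact ⟨hp a (p.fst_mem_support_of_mem_edges he),
        hp b (p.snd_mem_support_of_mem_edges he), p.adj_of_mem_edges he⟩
  exact ⟨p.transfer _ h, p.length_transfer h⟩

/-- Distances from `v` grow by one along the path and differ by at most one across an edge. -/
theorem geodesic_induced {H : SimpleGraph V} {v w : V} (q : H.Walk v w)
    (hq : q.length = H.dist v w) {a b : V} (ha : a ∈ q.support) (hb : b ∈ q.support)
    (hab : H.Adj a b) : s(a, b) ∈ q.edges := by
  have hd : ∀ r ≤ q.length, H.dist v (q.getVert r) = r := fun r hr => by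
    rw [dist_getVert_of_geodesic Walk.nil q (by simp [hq]) hr]
    simp
  obtain ⟨i, rfl, hi⟩ := Walk.mem_support_iff_exists_getVert.1 ha
  obtain ⟨j, rfl, hj⟩ := Walk.mem_support_iff_exists_getVert.1 hb
  have hne : i ≠ j := by
    rintro rfl
    exact hab.ne rfl
  have h := hab.diff_dist_adj (u := v)
  rw [hd i hi, hd j hj] at h
  rw [← Walk.adj_toSubgraph_iff_mem_edges]
  obtain rfl | rfl : j = i + 1 ∨ i = j + 1 := by omega
  · exact q.toSubgraph_adj_getVert hj
  · exact (q.toSubgraph_adj_getVert hi).symm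

/-- To leave `S` the path has to pass through `v`, and a shortest path from `v` does not return
there. -/
theorem eq_start_of_geodesic {H : SimpleGraph V} {v w : V} (q : H.Walk v w)
    (hq : q.length = H.dist v w) {S : Set V} (hw : w ∉ S)
    (hcut : ∀ a b, a ∈ S → b ∉ S → H.Adj a b → a = v) :
    ∀ a ∈ q.support, a ∈ S → a = v := by
  classical
  intro a ha haS
  by_contra hne
  obtain ⟨d, hd, hd₁, hd₂⟩ := (q.dropUntil a ha).exists_boundary_dart S haS hw
  have h1 := (q.dropUntil a ha).dart_fst_mem_support_of_mem_darts hd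
  rw [hcut _ _ hd₁ hd₂ d.adj] at h1
  have h2 := dist_le ((q.dropUntil a ha).dropUntil v h1)
  have h3 := (q.dropUntil a ha).length_dropUntil_le_length h1
  have h4 := q.length_dropUntil_lt_length ha hne
  omega

/-- Odd closed walks inside two disjoint sets `S₁`, `S₂` which communicate with each other only
through cut vertices `v₁`, `v₂` are excluded by the condition `(♯)`. -/
theorem CondSharp.false_of_odd_walks (hG : CondSharp G) {S₁ S₂ U : Set V} {v₁ v₂ : V}
    (c₁ : G.Walk v₁ v₁) (hc₁ : Odd c₁.length) (hS₁ : ∀ a ∈ c₁.support, a ∈ S₁)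
    (c₂ : G.Walk v₂ v₂) (hc₂ : Odd c₂.length) (hS₂ : ∀ a ∈ c₂.support, a ∈ S₂)
    (hdisj : ∀ a ∈ S₁, a ∉ S₂) (hSU₁ : S₁ ⊆ U) (hSU₂ : S₂ ⊆ U)
    (hcut₁ : ∀ a b, a ∈ S₁ → b ∈ U → b ∉ S₁ → G.Adj a b → a = v₁)
    (hcut₂ : ∀ a b, a ∈ S₂ → b ∈ U → b ∉ S₂ → G.Adj a b → a = v₂)
    (q : G.Walk v₁ v₂) (hq : ∀ a ∈ q.support, a ∈ U) : False := by
  have hv₁ : v₁ ∈ S₁ := hS₁ _ c₁.start_mem_support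
  have hv₂ : v₂ ∈ S₂ := hS₂ _ c₂.start_mem_support
  obtain ⟨c₁', hc₁'⟩ := exists_walk_within c₁ hS₁
  obtain ⟨c₂', hc₂'⟩ := exists_walk_within c₂ hS₂
  obtain ⟨q', -⟩ := exists_walk_within q hq
  -- A shortest connection inside `U` is induced and meets each `Sᵢ` only in `vᵢ`. With the induced
  -- tail and odd cycle on either side it is the configuration excluded by (♯).
  obtain ⟨r, hr⟩ := q'.reachable.exists_walk_length_eq_dist
  obtain ⟨z₁, p₁, o₁, hp₁, ho₁, hodd₁, hpo₁, hind₁⟩ :=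
    exists_induced_lollipop c₁' (by rwa [hc₁'])
  obtain ⟨z₂, p₂, o₂, hp₂, ho₂, hodd₂, hpo₂, hind₂⟩ :=
    exists_induced_lollipop c₂' (by rwa [hc₂'])
  have hp₁S := support_subset_of_within p₁ hv₁
  have hp₂S := support_subset_of_within p₂ hv₂
  have ho₁S := support_subset_of_within o₁ (hp₁S _ p₁.end_mem_support)
  have ho₂S := support_subset_of_within o₂ (hp₂S _ p₂.end_mem_support)
  have hrU := support_subset_of_within r (hSU₁ hv₁)
  have hrS₁ : ∀ a ∈ r.support, a ∈ S₁ → a = v₁ :=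
    eq_start_of_geodesic r hr (fun h => hdisj _ h hv₂)
      fun a b ha hb h => hcut₁ a b ha h.2.1 hb h.2.2
  have hrS₂ : ∀ a ∈ r.support, a ∈ S₂ → a = v₂ := by
    intro a ha
    refine eq_start_of_geodesic r.reverse (by rw [Walk.length_reverse, hr, dist_comm])
      (hdisj _ hv₁) (fun a b ha hb h => hcut₂ a b ha h.2.1 hb h.2.2) a (by simpa using ha)
  have hrp : r.IsPath := r.isPath_of_length_eq_dist hr
  let P₁ : G.Walk v₁ z₁ := p₁.mapLe (within_le G S₁)
  let P₂ : G.Walk v₂ z₂ := p₂.mapLe (within_le G S₂)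
  let R : G.Walk v₁ v₂ := r.mapLe (within_le G U)
  have hP₁ : ∀ a, a ∈ P₁.support ↔ a ∈ p₁.support := by simp [P₁]
  have hP₂ : ∀ a, a ∈ P₂.support ↔ a ∈ p₂.support := by simp [P₂]
  have hR : ∀ a, a ∈ R.support ↔ a ∈ r.support := by simp [R]
  have hRP : (R.append P₂).IsPath := by
    refine isPath_append ((Walk.isPath_mapLe _).2 hrp) ((Walk.isPath_mapLe _).2 hp₂) ?_
    intro a ha hb
    exact hrS₂ a ((hR a).1 ha) (hp₂S a ((hP₂ a).1 hb))
  have hPP : (P₁.reverse.append (R.append P₂)).IsPath := by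
    refine isPath_append ((Walk.isPath_mapLe _).2 hp₁).reverse hRP ?_
    intro a ha hb
    rw [Walk.support_reverse, List.mem_reverse, hP₁] at ha
    rw [Walk.mem_support_append_iff, hR, hP₂] at hb
    rcases hb with hb | hb
    · exact hrS₁ a hb (hp₁S a ha)
    · exact absurd (hp₂S a hb) (hdisj a (hp₁S a ha))
  have hlen : 1 ≤ r.length := by
    rcases Nat.eq_zero_or_pos r.length with h | h
    · exact absurd hv₂ (hdisj _ (Walk.eq_of_length_eq_zero h ▸ hv₁))
    · exact h
  have hmem : ∀ a, a ∈ (P₁.reverse.append (R.append P₂)).support ↔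
      a ∈ p₁.support ∨ a ∈ r.support ∨ a ∈ p₂.support := by
    intro a
    rw [Walk.mem_support_append_iff, Walk.mem_support_append_iff, Walk.support_reverse,
      List.mem_reverse, hP₁, hR, hP₂]
  refine hG z₁ z₂ (o₁.mapLe (within_le G S₁)) (o₂.mapLe (within_le G S₂))
    (P₁.reverse.append (R.append P₂)) ((Walk.isCycle_mapLe _).2 ho₁) (by simpa using hodd₁)
    ((Walk.isCycle_mapLe _).2 ho₂) (by simpa using hodd₂) ?_ hPP ?_ ?_ ?_ ?_
  · intro a ha hb
    rw [Walk.support_mapLe_eq_support] at ha hb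
    exact hdisj a (ho₁S a ha) (ho₂S a hb)
  · simp only [Walk.length_append, R, Walk.length_mapLe]
    omega
  · intro a ha hb
    rw [Walk.support_mapLe_eq_support] at hb
    rw [hmem] at ha
    rcases ha with ha | ha | ha
    · exact hpo₁ a ha hb
    · have := hrS₁ a ha (ho₁S a hb)
      subst this
      exact hpo₁ _ p₁.start_mem_support hb
    · exact absurd (hp₂S a ha) (hdisj a (ho₁S a hb))
  · intro a ha hb
    rw [Walk.support_mapLe_eq_support] at hb
    rw [hmem] at ha
    rcases ha with ha | ha | ha
    · exact absurd (ho₂S a hb) (hdisj a (hp₁S a ha))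
    · have := hrS₂ a ha (ho₂S a hb)
      subst this
      exact hpo₂ _ p₂.start_mem_support hb
    · exact hpo₂ a ha hb
  · have hverts : ∀ a, a ∈ ((o₁.mapLe (within_le G S₁)).toSubgraph ⊔
        (P₁.reverse.append (R.append P₂)).toSubgraph ⊔
        (o₂.mapLe (within_le G S₂)).toSubgraph).verts ↔
        (a ∈ p₁.support ∨ a ∈ o₁.support) ∨ a ∈ r.support ∨ (a ∈ p₂.support ∨ a ∈ o₂.support) := by
      intro a
      rw [Subgraph.verts_sup, Subgraph.verts_sup, Set.mem_union, Set.mem_union,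
        Walk.mem_verts_toSubgraph, Walk.mem_verts_toSubgraph, Walk.mem_verts_toSubgraph,
        Walk.support_mapLe_eq_support, Walk.support_mapLe_eq_support, hmem]
      tauto
    have hT₁ : ∀ a, (a ∈ p₁.support ∨ a ∈ o₁.support) → a ∈ S₁ := fun a h =>
      h.elim (hp₁S a) (ho₁S a)
    have hT₂ : ∀ a, (a ∈ p₂.support ∨ a ∈ o₂.support) → a ∈ S₂ := fun a h =>
      h.elim (hp₂S a) (ho₂S a)
    have hU : ∀ a, ((a ∈ p₁.support ∨ a ∈ o₁.support) ∨ a ∈ r.support ∨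
        (a ∈ p₂.support ∨ a ∈ o₂.support)) → a ∈ U := by
      rintro a (h | h | h)
      · exact hSU₁ (hT₁ a h)
      · exact hrU a h
      · exact hSU₂ (hT₂ a h)
    have hback₁ : ∀ a, ((a ∈ p₁.support ∨ a ∈ o₁.support) ∨ a ∈ r.support ∨
        (a ∈ p₂.support ∨ a ∈ o₂.support)) → a ∈ S₁ → (a ∈ p₁.support ∨ a ∈ o₁.support) := by
      rintro a (h | h | h) hS
      · exact h
      · rw [hrS₁ a h hS]
        exact Or.inl p₁.start_mem_support
      · exact absurd (hT₂ a h) (hdisj a hS)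
    have hback₂ : ∀ a, ((a ∈ p₁.support ∨ a ∈ o₁.support) ∨ a ∈ r.support ∨
        (a ∈ p₂.support ∨ a ∈ o₂.support)) → a ∈ S₂ → (a ∈ p₂.support ∨ a ∈ o₂.support) := by
      rintro a (h | h | h) hS
      · exact absurd hS (hdisj a (hT₁ a h))
      · rw [hrS₂ a h hS]
        exact Or.inl p₂.start_mem_support
      · exact h
    -- An edge of the configuration inside neither `S₁` nor `S₂` has its ends on the shortest path,
    -- because each `Sᵢ` is left only through `vᵢ`.
    have hmid : ∀ a b, ((a ∈ p₁.support ∨ a ∈ o₁.support) ∨ a ∈ r.support ∨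
        (a ∈ p₂.support ∨ a ∈ o₂.support)) → b ∈ U → G.Adj a b → ¬ (a ∈ S₁ ∧ b ∈ S₁) →
        ¬ (a ∈ S₂ ∧ b ∈ S₂) → a ∈ r.support := by
      rintro a b (h | h | h) hb hab hn₁ hn₂
      · rw [hcut₁ a b (hT₁ a h) hb (fun h' => hn₁ ⟨hT₁ a h, h'⟩) hab]
        exact r.start_mem_support
      · exact h
      · rw [hcut₂ a b (hT₂ a h) hb (fun h' => hn₂ ⟨hT₂ a h, h'⟩) hab]
        exact r.end_mem_support
    intro a ha b hb hab
    rw [hverts] at ha hb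
    rw [Subgraph.sup_adj, Subgraph.sup_adj, Walk.adj_toSubgraph_iff_mem_edges,
      Walk.adj_toSubgraph_iff_mem_edges, Walk.adj_toSubgraph_iff_mem_edges, Walk.edges_append,
      Walk.edges_append, Walk.edges_reverse, List.mem_append, List.mem_append, List.mem_reverse]
    simp only [P₁, P₂, R, Walk.edges_mapLe_eq_edges]
    by_cases h₁ : a ∈ S₁ ∧ b ∈ S₁
    · have := hind₁ a b (hback₁ a ha h₁.1) (hback₁ b hb h₁.2) ⟨h₁.1, h₁.2, hab⟩
      exact this.elim (fun h => Or.inl (Or.inr (Or.inl h))) (fun h => Or.inl (Or.inl h))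
    by_cases h₂ : a ∈ S₂ ∧ b ∈ S₂
    · have := hind₂ a b (hback₂ a ha h₂.1) (hback₂ b hb h₂.2) ⟨h₂.1, h₂.2, hab⟩
      exact this.elim (fun h => Or.inl (Or.inr (Or.inr (Or.inr h)))) Or.inr
    have := geodesic_induced r hr (hmid a b ha (hU b hb) hab h₁ h₂)
      (hmid b a hb (hU a ha) hab.symm (fun h => h₁ h.symm) (fun h => h₂ h.symm))
      ⟨hU a ha, hU b hb, hab⟩
    exact Or.inl (Or.inr (Or.inr (Or.inl this)))

end Sharp

/-! ### Alternating closed sequences of vertices -/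

section Pairs

variable {V : Type*} {G : SimpleGraph V}

/-- The binomial `x^a - x^b` is homogeneous, its monomials are coprime, and it has no proper
homogeneous divisor. -/
def IsPrimitivePair (a b : G.edgeSet →₀ ℕ) : Prop :=
  degA (edgeVec G) a = degA (edgeVec G) b ∧ (∀ e, a e = 0 ∨ b e = 0) ∧
    ∀ a' ≤ a, ∀ b' ≤ b, degA (edgeVec G) a' = degA (edgeVec G) b' →
      (a' = 0 ∧ b' = 0) ∨ (a' = a ∧ b' = b)

theorem IsPrimitivePair.symm {a b : G.edgeSet →₀ ℕ} (h : IsPrimitivePair a b) :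
    IsPrimitivePair b a := by
  refine ⟨h.1.symm, fun e => (h.2.1 e).symm, fun b' hb a' ha hd => ?_⟩
  exact (h.2.2 a' ha b' hb hd.symm).imp And.symm And.symm

/-- Both `x^a` and `x^b` have proper non-rigid divisors, whose degrees add up to `deg x^a + 1`. -/
def HasSplit (a b : G.edgeSet →₀ ℕ) : Prop :=
  ∃ a' < a, ∃ b' < b, ¬ IsRigid (edgeVec G) a' ∧ ¬ IsRigid (edgeVec G) b' ∧
    a'.degree + b'.degree = a.degree + 1

theorem HasSplit.symm [Finite V] {a b : G.edgeSet →₀ ℕ}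
    (hd : degA (edgeVec G) a = degA (edgeVec G) b) (h : HasSplit a b) : HasSplit b a := by
  obtain ⟨a', ha, b', hb, h1, h2, h3⟩ := h
  exact ⟨b', hb, a', ha, h2, h1, by rw [add_comm, h3, degree_eq_of_degA_eq hd]⟩

end Pairs

theorem neg_one_pow_eq_of_even_add {R : Type*} [Ring R] {m n : ℕ} (h : Even (m + n)) :
    (-1 : R) ^ n = (-1) ^ m := by
  rcases Nat.even_or_odd m with hm | hm
  · rw [hm.neg_one_pow, ((Nat.even_add.1 h).1 hm).neg_one_pow]
  · have : Odd n := Nat.not_even_iff_odd.1 fun hn =>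
      Nat.not_even_iff_odd.2 hm ((Nat.even_add.1 h).2 hn)
    rw [hm.neg_one_pow, this.neg_one_pow]

theorem neg_one_pow_eq_of_odd_add {R : Type*} [Ring R] {m n : ℕ} (h : Odd (m + n)) :
    (-1 : R) ^ n = -(-1) ^ m := by
  have : Even (m + 1 + n) := by
    rw [add_right_comm]
    exact h.add_one
  rw [neg_one_pow_eq_of_even_add this, pow_succ]
  simp

/-- A closed walk of positive even length, as a periodic sequence of vertices. -/
structure ClosedSeq {V : Type*} (G : SimpleGraph V) where
  /-- the successive vertices -/
  vert : ℕ → V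
  /-- half of the period -/
  half : ℕ
  half_pos : 0 < half
  adj : ∀ n, G.Adj (vert n) (vert (n + 1))
  periodic : ∀ n, vert (n + 2 * half) = vert n

namespace ClosedSeq

variable {V : Type*} {G : SimpleGraph V} (c : ClosedSeq G)

/-- The edge at position `n`. -/
def edge (n : ℕ) : G.edgeSet :=
  ⟨s(c.vert n, c.vert (n + 1)), c.adj n⟩

/-- The product of the edges at the even positions in `S`. -/
def evenOn (S : Finset ℕ) : G.edgeSet →₀ ℕ :=
  ∑ n ∈ S with Even n, Finsupp.single (c.edge n) 1

/-- The product of the edges at the odd positions in `S`. -/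
def oddOn (S : Finset ℕ) : G.edgeSet →₀ ℕ :=
  ∑ n ∈ S with Odd n, Finsupp.single (c.edge n) 1

/-- The product of the edges at even positions in one period. -/
def plus : G.edgeSet →₀ ℕ :=
  c.evenOn (Finset.range (2 * c.half))

/-- The product of the edges at odd positions in one period. -/
def minus : G.edgeSet →₀ ℕ :=
  c.oddOn (Finset.range (2 * c.half))

/-- The closed walk started at position `n`. -/
def shift (n : ℕ) : ClosedSeq G where
  vert k := c.vert (k + n)
  half := c.half
  half_pos := c.half_pos
  adj k := by
    have := c.adj (k + n)
    rwa [add_right_comm] at this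
  periodic k := by rw [add_right_comm, c.periodic]

theorem shift_vert (n k : ℕ) : (c.shift n).vert k = c.vert (k + n) :=
  rfl

theorem edge_periodic (n : ℕ) : c.edge (n + 2 * c.half) = c.edge n := by
  refine Subtype.ext ?_
  simp only [edge]
  rw [c.periodic, add_right_comm, c.periodic]

theorem vert_add_mul (n k : ℕ) : c.vert (n + k * (2 * c.half)) = c.vert n := by
  induction k with
  | zero => simp
  | succ k ih => rw [add_mul, one_mul, ← add_assoc, c.periodic, ih]

theorem vert_mod (n : ℕ) : c.vert (n % (2 * c.half)) = c.vert n := by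
  conv_rhs => rw [← Nat.mod_add_div' n (2 * c.half)]
  rw [c.vert_add_mul]

theorem exists_lt_vert_eq (n : ℕ) : ∃ m < 2 * c.half, c.vert m = c.vert n :=
  ⟨n % (2 * c.half), Nat.mod_lt _ (by have := c.half_pos; omega), c.vert_mod n⟩

theorem plus_eq_sum :
    c.plus = ∑ k ∈ Finset.range c.half, Finsupp.single (c.edge (2 * k)) 1 := by
  rw [plus, evenOn]
  generalize c.half = s
  induction s with
  | zero => rfl
  | succ s ih =>
    rw [Finset.sum_range_succ, ← ih, Finset.sum_filter, Finset.sum_filter, mul_add_one,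
      Finset.sum_range_succ, Finset.sum_range_succ, if_pos (by simp), if_neg (by simp), add_zero]

theorem minus_eq_sum :
    c.minus = ∑ k ∈ Finset.range c.half, Finsupp.single (c.edge (2 * k + 1)) 1 := by
  rw [minus, oddOn]
  generalize c.half = s
  induction s with
  | zero => rfl
  | succ s ih =>
    rw [Finset.sum_range_succ, ← ih, Finset.sum_filter, Finset.sum_filter, mul_add_one,
      Finset.sum_range_succ, Finset.sum_range_succ, if_neg (by simp), if_pos (by simp), add_zero]

theorem shift_one_plus : (c.shift 1).plus = c.minus := by
  rw [plus_eq_sum, minus_eq_sum]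
  rfl

theorem shift_one_minus : (c.shift 1).minus = c.plus := by
  rw [plus_eq_sum, minus_eq_sum]
  change ∑ k ∈ Finset.range c.half, Finsupp.single (c.edge (2 * (k + 1))) 1 = _
  have h1 := Finset.sum_range_succ (fun k => Finsupp.single (c.edge (2 * k)) 1) c.half
  have h2 := Finset.sum_range_succ' (fun k => Finsupp.single (c.edge (2 * k)) 1) c.half
  have h3 : c.edge (2 * c.half) = c.edge 0 := by
    simpa using c.edge_periodic 0
  rw [h1, mul_zero, h3] at h2
  exact (add_right_cancel h2).symm

theorem shift_succ (n : ℕ) : c.shift (n + 1) = (c.shift n).shift 1 := by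
  simp only [shift, ClosedSeq.mk.injEq, and_true]
  funext k
  rw [add_right_comm, add_assoc]

/-- This lets later arguments start at position 0: a shift at most exchanges the halves, and the
properties of pairs in use are symmetric. -/
theorem shift_plus_minus (n : ℕ) :
    ((c.shift n).plus = c.plus ∧ (c.shift n).minus = c.minus) ∨
      ((c.shift n).plus = c.minus ∧ (c.shift n).minus = c.plus) := by
  induction n with
  | zero => exact Or.inl ⟨rfl, rfl⟩
  | succ n ih =>
    rw [shift_succ, shift_one_plus, shift_one_minus]
    exact ih.symm.imp And.symm And.symm

variable {c}

theorem primitive_shift (h : IsPrimitivePair c.plus c.minus) (n : ℕ) :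
    IsPrimitivePair (c.shift n).plus (c.shift n).minus := by
  rcases c.shift_plus_minus n with ⟨h1, h2⟩ | ⟨h1, h2⟩ <;> rw [h1, h2]
  exacts [h, h.symm]

theorem hasSplit_of_shift [Finite V] (hc : degA (edgeVec G) c.plus = degA (edgeVec G) c.minus)
    {n : ℕ} (h : HasSplit (c.shift n).plus (c.shift n).minus) : HasSplit c.plus c.minus := by
  rcases c.shift_plus_minus n with ⟨h1, h2⟩ | ⟨h1, h2⟩ <;> rw [h1, h2] at h
  exacts [h, h.symm hc.symm]

variable (c)

theorem degree_evenOn_add (S : Finset ℕ) :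
    (c.evenOn S).degree + (c.oddOn S).degree = S.card := by
  simp only [evenOn, oddOn, map_sum, Finsupp.degree_single, Finset.sum_const, smul_eq_mul, mul_one,
    ← Nat.not_even_iff_odd]
  exact Finset.card_filter_add_card_filter_not _

theorem evenOn_add_sdiff {S T : Finset ℕ} (h : S ⊆ T) :
    c.evenOn S + c.evenOn (T \ S) = c.evenOn T := by
  simp only [evenOn, Finset.sum_filter]
  rw [add_comm, Finset.sum_sdiff h]

theorem oddOn_add_sdiff {S T : Finset ℕ} (h : S ⊆ T) :
    c.oddOn S + c.oddOn (T \ S) = c.oddOn T := by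
  simp only [oddOn, Finset.sum_filter]
  rw [add_comm, Finset.sum_sdiff h]

/-- The signed degree of a set of positions. -/
def altDeg (S : Finset ℕ) : V → ℤ :=
  ∑ n ∈ S, (-1) ^ n * (delta (c.vert n) + delta (c.vert (n + 1)))

theorem degA_evenOn_sub_oddOn (S : Finset ℕ) :
    degA (edgeVec G) (c.evenOn S) - degA (edgeVec G) (c.oddOn S) = c.altDeg S := by
  induction S using Finset.induction_on with
  | empty => simp [evenOn, oddOn, altDeg, degA_zero]
  | insert n S hn ih =>
    rw [altDeg, Finset.sum_insert hn, ← altDeg, ← ih, evenOn, oddOn, Finset.sum_filter,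
      Finset.sum_filter, Finset.sum_insert hn, Finset.sum_insert hn, ← Finset.sum_filter,
      ← Finset.sum_filter, ← evenOn, ← oddOn, degA_add, degA_add]
    rcases Nat.even_or_odd n with h | h
    · rw [if_pos h, if_neg (Nat.not_odd_iff_even.2 h), degA_single, edge, edgeVec_mk, degA_zero,
        h.neg_one_pow]
      ring
    · rw [if_pos h, if_neg (Nat.not_even_iff_odd.2 h), degA_single, edge, edgeVec_mk, degA_zero,
        h.neg_one_pow]
      ring

/-- Consecutive edges carry opposite signs, so all inner vertices of the arc cancel. -/
theorem altDeg_Ico {a b : ℕ} (h : a ≤ b) :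
    c.altDeg (Finset.Ico a b) = (-1) ^ a * delta (c.vert a) - (-1) ^ b * delta (c.vert b) := by
  induction b, h using Nat.le_induction with
  | base => simp [altDeg]
  | succ b hab ih =>
    rw [altDeg] at ih ⊢
    rw [Finset.sum_Ico_succ_top hab, ih, pow_succ]
    ring

theorem altDeg_union {S T : Finset ℕ} (h : Disjoint S T) :
    c.altDeg (S ∪ T) = c.altDeg S + c.altDeg T :=
  Finset.sum_union h

theorem altDeg_Ico_union {p r q t : ℕ} (h1 : p ≤ r) (h2 : r ≤ q) (h3 : q ≤ t) :
    c.altDeg (Finset.Ico p r ∪ Finset.Ico q t)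
      = (-1) ^ p * delta (c.vert p) - (-1) ^ r * delta (c.vert r)
        + ((-1) ^ q * delta (c.vert q) - (-1) ^ t * delta (c.vert t)) := by
  rw [altDeg_union, altDeg_Ico _ h1, altDeg_Ico _ h3]
  rw [Finset.disjoint_left]
  intro n hn hn'
  rw [Finset.mem_Ico] at hn hn'
  omega

theorem altDeg_range : c.altDeg (Finset.range (2 * c.half)) = 0 := by
  have h : c.vert (2 * c.half) = c.vert 0 := by simpa using c.periodic 0
  rw [Finset.range_eq_Ico, altDeg_Ico _ (Nat.zero_le _), h, (even_two_mul _).neg_one_pow]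
  simp

theorem degA_plus_eq : degA (edgeVec G) c.plus = degA (edgeVec G) c.minus := by
  rw [← sub_eq_zero, plus, minus, degA_evenOn_sub_oddOn, altDeg_range]

theorem altDeg_sdiff {S : Finset ℕ} (h : S ⊆ Finset.range (2 * c.half)) :
    c.altDeg (Finset.range (2 * c.half) \ S) = -c.altDeg S := by
  have := Finset.sum_sdiff (f := fun n => (-1) ^ n *
    (delta (c.vert n) + delta (c.vert (n + 1)))) h
  rw [eq_neg_iff_add_eq_zero, ← c.altDeg_range]
  exact this

theorem card_Ico_union {p r q t : ℕ} (h2 : r ≤ q) :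
    (Finset.Ico p r ∪ Finset.Ico q t).card = (r - p) + (t - q) := by
  rw [Finset.card_union_of_disjoint, Nat.card_Ico, Nat.card_Ico]
  rw [Finset.disjoint_left]
  intro n hn hn'
  rw [Finset.mem_Ico] at hn hn'
  omega

theorem degree_plus [Finite V] : c.plus.degree = c.half := by
  have h1 := c.degree_evenOn_add (Finset.range (2 * c.half))
  have h2 := degree_eq_of_degA_eq c.degA_plus_eq
  rw [plus, minus] at *
  rw [Finset.card_range] at h1
  omega

variable {c}

/-- The form in which primitivity is used: a set of positions of signed degree zero is a homogeneous
divisor of the binomial. -/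
theorem subset_eq_of_altDeg_eq_zero (hP : IsPrimitivePair c.plus c.minus) {S : Finset ℕ}
    (hS : S ⊆ Finset.range (2 * c.half)) (h : c.altDeg S = 0) :
    S.card = 0 ∨ S.card = 2 * c.half := by
  rw [← degA_evenOn_sub_oddOn, sub_eq_zero] at h
  have h1 : c.evenOn S ≤ c.plus := by
    rw [plus, ← c.evenOn_add_sdiff hS]
    exact le_self_add
  have h2 : c.oddOn S ≤ c.minus := by
    rw [minus, ← c.oddOn_add_sdiff hS]
    exact le_self_add
  have h3 := c.degree_evenOn_add S
  have h4 := c.degree_evenOn_add (Finset.range (2 * c.half))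
  rw [Finset.card_range] at h4
  rcases hP.2.2 _ h1 _ h2 h with ⟨h5, h6⟩ | ⟨h5, h6⟩
  · left
    rw [← h3, h5, h6]
    simp
  · right
    rw [← h3, h5, h6]
    exact h4

/-! ### Splitting a primitive walk along an edge -/

section Split

variable [Finite V]

/-- With `T` the complement of `S`, the even edges of `S` have the degree of the odd edges of `S`
times `f`, and the odd edges of `T` that of the even edges of `T` times `f`. As the halves are
coprime and both sets have at least two elements, these are different monomials and proper divisors
of the halves. Each exchange lowers the number of walk edges by one, whence the sum of degrees. -/
theorem hasSplit_of_altDeg_eq_aux (hP : IsPrimitivePair c.plus c.minus) {S : Finset ℕ}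
    (hS : S ⊆ Finset.range (2 * c.half)) (h2 : 2 ≤ S.card) (h2' : S.card + 2 ≤ 2 * c.half)
    {f : G.edgeSet} (hf : c.altDeg S = edgeVec G f) : HasSplit c.plus c.minus := by
  set T := Finset.range (2 * c.half) \ S with hT
  have hTa : c.altDeg T = -edgeVec G f := by rw [hT, c.altDeg_sdiff hS, hf]
  have hTc : T.card + S.card = 2 * c.half := by
    rw [hT, Finset.card_sdiff_add_card_eq_card hS, Finset.card_range]
  rw [← degA_evenOn_sub_oddOn] at hf hTa
  have hS' : degA (edgeVec G) (c.oddOn S + Finsupp.single f 1) = degA (edgeVec G) (c.evenOn S) := by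
    rw [degA_add, degA_single, ← hf]
    ring
  have hT' : degA (edgeVec G) (c.evenOn T + Finsupp.single f 1) = degA (edgeVec G) (c.oddOn T) := by
    rw [degA_add, degA_single, ← neg_eq_iff_eq_neg.2 hTa]
    ring
  have dS := degree_eq_of_degA_eq hS'
  have dT := degree_eq_of_degA_eq hT'
  rw [map_add, Finsupp.degree_single] at dS dT
  have cS := c.degree_evenOn_add S
  have cT := c.degree_evenOn_add T
  have eE := c.evenOn_add_sdiff hS
  have eO := c.oddOn_add_sdiff hS
  rw [← hT] at eE eO
  change _ = c.plus at eE
  change _ = c.minus at eO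
  have lE : c.evenOn S < c.plus := by
    refine lt_of_le_of_ne (eE ▸ le_self_add) fun h => ?_
    have := congrArg Finsupp.degree eE
    rw [map_add, h] at this
    omega
  have lO : c.oddOn T < c.minus := by
    refine lt_of_le_of_ne (eO ▸ le_add_self) fun h => ?_
    have := congrArg Finsupp.degree eO
    rw [map_add, h] at this
    omega
  have hsum := congrArg Finsupp.degree eE
  rw [map_add] at hsum
  refine ⟨_, lE, _, lO, fun hr => ?_, fun hr => ?_, by omega⟩
  · have heq := hr _ hS'
    have hne : c.oddOn S ≠ 0 := by
      intro h
      rw [h, map_zero] at dS cS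
      omega
    obtain ⟨e, he⟩ := Finsupp.ne_iff.1 hne
    have h1 := DFunLike.congr_fun heq e
    have h3 := lE.le e
    have h4 := DFunLike.congr_fun eO e
    have h5 := hP.2.1 e
    simp only [Finsupp.add_apply, Finsupp.coe_zero, Pi.zero_apply] at h1 h4 he
    omega
  · have heq := hr _ hT'
    have hne : c.evenOn T ≠ 0 := by
      intro h
      rw [h, map_zero] at dT cT
      omega
    obtain ⟨e, he⟩ := Finsupp.ne_iff.1 hne
    have h1 := DFunLike.congr_fun heq e
    have h3 := lO.le e
    have h4 := DFunLike.congr_fun eE e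
    have h5 := hP.2.1 e
    simp only [Finsupp.add_apply, Finsupp.coe_zero, Pi.zero_apply] at h1 h4 he
    omega

theorem hasSplit_of_altDeg_eq (hP : IsPrimitivePair c.plus c.minus) {S : Finset ℕ}
    (hS : S ⊆ Finset.range (2 * c.half)) (h2 : 2 ≤ S.card) (h2' : S.card + 2 ≤ 2 * c.half)
    {f : G.edgeSet} (hf : c.altDeg S = edgeVec G f ∨ c.altDeg S = -edgeVec G f) :
    HasSplit c.plus c.minus := by
  rcases hf with hf | hf
  · exact hasSplit_of_altDeg_eq_aux hP hS h2 h2' hf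
  · have hTc : (Finset.range (2 * c.half) \ S).card + S.card = 2 * c.half := by
      rw [Finset.card_sdiff_add_card_eq_card hS, Finset.card_range]
    refine hasSplit_of_altDeg_eq_aux hP (S := Finset.range (2 * c.half) \ S) (f := f)
      Finset.sdiff_subset (by omega) (by omega) ?_
    rw [c.altDeg_sdiff hS, hf, neg_neg]

end Split

/-! ### Repeated vertices of a primitive walk -/

theorem Ico_subset_period {a b : ℕ} (h : b ≤ 2 * c.half) :
    Finset.Ico a b ⊆ Finset.range (2 * c.half) := fun n hn => by
  rw [Finset.mem_Ico] at hn
  rw [Finset.mem_range]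
  omega

/-- A return after an even number of steps would close a proper even subwalk. -/
theorem odd_of_vert_eq_zero (hP : IsPrimitivePair c.plus c.minus) {b : ℕ} (h0 : 0 < b)
    (hb : b < 2 * c.half) (h : c.vert 0 = c.vert b) : Odd b := by
  by_contra hodd
  rw [Nat.not_odd_iff_even] at hodd
  have := subset_eq_of_altDeg_eq_zero hP (S := Finset.Ico 0 b) (Ico_subset_period hb.le)
    (by rw [altDeg_Ico _ (Nat.zero_le _), h, hodd.neg_one_pow, pow_zero, sub_self])
  rw [Nat.card_Ico] at this
  omega

theorem odd_of_vert_eq (hP : IsPrimitivePair c.plus c.minus) {a b : ℕ} (hab : a < b)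
    (hb : b < a + 2 * c.half) (h : c.vert a = c.vert b) : Odd (a + b) := by
  have := odd_of_vert_eq_zero (primitive_shift hP a) (b := b - a) (by omega)
    (show b - a < 2 * c.half by omega)
    (by rw [shift_vert, shift_vert, zero_add, Nat.sub_add_cancel hab.le, h])
  rw [Nat.odd_iff] at *
  omega

/-- Both returns take an odd number of steps, so the boundary terms of `[p, r) ∪ [q, t)` cancel in
pairs and this proper nonempty set of positions has signed degree zero. -/
theorem false_of_crossing (hP : IsPrimitivePair c.plus c.minus) {p r q t : ℕ} (hpr : p < r)
    (hrq : r < q) (hqt : q < t) (ht : t < p + 2 * c.half) (h : c.vert p = c.vert q)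
    (h' : c.vert r = c.vert t) : False := by
  have key : ∀ {c : ClosedSeq G}, IsPrimitivePair c.plus c.minus → ∀ {r q t : ℕ}, 0 < r → r < q →
      q < t → t < 2 * c.half → c.vert 0 = c.vert q → c.vert r = c.vert t → False := by
    intro c hP r q t hpr hrq hqt ht h h'
    have h1 := odd_of_vert_eq hP (a := 0) (b := q) (by omega) (by omega) h
    have h2 := odd_of_vert_eq hP (a := r) (b := t) (by omega) (by omega) h'
    have := subset_eq_of_altDeg_eq_zero hP (S := Finset.Ico 0 r ∪ Finset.Ico q t)
      (Finset.union_subset (Ico_subset_period (by omega)) (Ico_subset_period ht.le))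
      (by
        rw [c.altDeg_Ico_union hpr.le hrq.le hqt.le, neg_one_pow_eq_of_odd_add h1,
          neg_one_pow_eq_of_odd_add h2, h, h']
        ring)
    rw [card_Ico_union hrq.le] at this
    omega
  refine key (primitive_shift hP p) (r := r - p) (q := q - p) (t := t - p) (by omega) (by omega)
    (by omega) (show t - p < 2 * c.half by omega) ?_ ?_
  · rw [shift_vert, shift_vert, zero_add, Nat.sub_add_cancel (by omega), h]
  · rw [shift_vert, shift_vert, Nat.sub_add_cancel (by omega), Nat.sub_add_cancel (by omega), h']

/-! ### Chords of a walk without a split -/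

section Chords

variable [Finite V]

/-- Any other edge between positions of opposite parity closes both arcs between them to shorter
even closed walks. -/
theorem consecutive_of_adj (hP : IsPrimitivePair c.plus c.minus) (hS : ¬ HasSplit c.plus c.minus)
    {a b : ℕ} (hab : a < b) (hb : b < a + 2 * c.half) (hodd : Odd (a + b))
    (hadj : G.Adj (c.vert a) (c.vert b)) : b = a + 1 ∨ b + 1 = a + 2 * c.half := by
  by_contra! hno
  refine hS (hasSplit_of_shift c.degA_plus_eq (n := a) ?_)
  have hodd' : Odd (b - a) := by
    rw [Nat.odd_iff] at *
    omega
  rw [Nat.odd_iff] at hodd'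
  refine hasSplit_of_altDeg_eq (primitive_shift hP a) (S := Finset.Ico 0 (b - a))
    (Ico_subset_period (show b - a ≤ 2 * c.half by omega)) ?_ ?_ (f := ⟨s(_, _), hadj⟩)
    (Or.inl ?_)
  · rw [Nat.card_Ico]
    omega
  · rw [Nat.card_Ico]
    change _ ≤ 2 * c.half
    omega
  · rw [altDeg_Ico _ (Nat.zero_le _), edgeVec_mk, shift_vert, shift_vert, zero_add,
      Nat.sub_add_cancel hab.le, (Nat.odd_iff.2 hodd').neg_one_pow]
    ring

/-- If `r + t` is even, reversing the odd loop from `p` to `q` turns the chord into one between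
positions of opposite parity; the corresponding set of positions is `[p, r) ∪ [q, t)`. If `r + t` is
odd, `consecutive_of_adj` applies directly. -/
theorem not_adj_of_crossing (hP : IsPrimitivePair c.plus c.minus)
    (hS : ¬ HasSplit c.plus c.minus) {p r q t : ℕ} (hpr : p < r) (hrq : r < q) (hqt : q < t)
    (ht : t < p + 2 * c.half) (h : c.vert p = c.vert q) : ¬ G.Adj (c.vert r) (c.vert t) := by
  intro hadj
  rcases Nat.even_or_odd (r + t) with hrt | hrt
  · refine hS (hasSplit_of_shift c.degA_plus_eq (n := p) ?_)
    have hpq := odd_of_vert_eq hP (by omega) (by omega) h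
    have h1 : Odd (0 + (q - p)) := by
      rw [Nat.odd_iff] at *
      omega
    have h2 : Even (r - p + (t - p)) := by
      rw [Nat.even_iff] at *
      omega
    have h3 : Odd (q - p) := by simpa using h1
    rw [Nat.odd_iff] at h3
    have h4 := h2
    rw [Nat.even_iff] at h4
    have e1 : (c.shift p).altDeg (Finset.Ico 0 (r - p) ∪ Finset.Ico (q - p) (t - p))
        = -(-1) ^ (r - p) * edgeVec G ⟨s(_, _), hadj⟩ := by
      rw [altDeg_Ico_union _ (by omega) (by omega) (by omega), edgeVec_mk,
        neg_one_pow_eq_of_odd_add h1, neg_one_pow_eq_of_even_add h2, shift_vert, shift_vert,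
        shift_vert, shift_vert, zero_add, Nat.sub_add_cancel (by omega),
        Nat.sub_add_cancel (by omega), Nat.sub_add_cancel (by omega), h]
      ring
    refine hasSplit_of_altDeg_eq (primitive_shift hP p)
      (S := Finset.Ico 0 (r - p) ∪ Finset.Ico (q - p) (t - p))
      (Finset.union_subset (Ico_subset_period (show r - p ≤ 2 * c.half by omega))
        (Ico_subset_period (show t - p ≤ 2 * c.half by omega))) ?_ ?_ (f := ⟨s(_, _), hadj⟩) ?_
    · rw [card_Ico_union (by omega)]
      omega
    · rw [card_Ico_union (by omega)]
      change _ ≤ 2 * c.half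
      omega
    · rw [e1]
      rcases Nat.even_or_odd (r - p) with h | h
      · right
        rw [h.neg_one_pow]
        ring
      · left
        rw [h.neg_one_pow]
        ring
  · have := consecutive_of_adj hP hS (by omega) (by omega) hrt hadj
    omega

end Chords

/-- The part of the walk of length `n` from position `a` on. -/
def seg (c : ClosedSeq G) (a : ℕ) : (n : ℕ) → G.Walk (c.vert a) (c.vert (a + n))
  | 0 => SimpleGraph.Walk.nil
  | n + 1 => (c.seg a n).concat (c.adj (a + n))

theorem length_seg (c : ClosedSeq G) (a n : ℕ) : (c.seg a n).length = n := by
  induction n with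
  | zero => rfl
  | succ n ih => rw [seg, SimpleGraph.Walk.length_concat, ih]

theorem mem_support_seg (c : ClosedSeq G) (a n : ℕ) {x : V} (hx : x ∈ (c.seg a n).support) :
    ∃ i, a ≤ i ∧ i ≤ a + n ∧ c.vert i = x := by
  induction n with
  | zero => exact ⟨a, le_rfl, le_rfl, by simpa [seg, eq_comm] using hx⟩
  | succ n ih =>
    rw [seg, SimpleGraph.Walk.support_concat, List.mem_append,
      List.mem_singleton] at hx
    rcases hx with hx | hx
    · obtain ⟨i, h1, h2, h3⟩ := ih hx
      exact ⟨i, h1, by omega, h3⟩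
    · exact ⟨a + n + 1, by omega, by omega, hx.symm⟩

/-- The loops `[0, j]` and `[k, l]` are odd closed walks, and by `not_adj_of_crossing` each is
attached to the rest of the walk only at its base vertex. -/
theorem false_of_two_doubles_zero [Finite V] (hG : CondSharp G)
    (hP : IsPrimitivePair c.plus c.minus) (hS : ¬ HasSplit c.plus c.minus) {j k l : ℕ}
    (hj : 0 < j) (hjk : j < k) (hkl : k < l) (hl : l < 2 * c.half) (h : c.vert 0 = c.vert j)
    (h' : c.vert k = c.vert l) : False := by
  have hoj := odd_of_vert_eq hP (a := 0) (b := j) (by omega) (by omega) h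
  have hokl := odd_of_vert_eq hP hkl (by omega) h'
  have e₁ : c.vert (0 + j) = c.vert 0 := by rw [zero_add, h]
  have e₂ : c.vert (k + (l - k)) = c.vert k := by rw [Nat.add_sub_cancel' hkl.le, h']
  have e₃ : c.vert (0 + k) = c.vert k := by rw [zero_add]
  refine hG.false_of_odd_walks (S₁ := c.vert '' Set.Icc 0 j) (S₂ := c.vert '' Set.Icc k l)
    (U := Set.range c.vert) ((c.seg 0 j).copy rfl e₁) ?_ ?_ ((c.seg k (l - k)).copy rfl e₂) ?_ ?_
    ?_ (Set.image_subset_range _ _) (Set.image_subset_range _ _) ?_ ?_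
    ((c.seg 0 k).copy rfl e₃) ?_
  · rw [SimpleGraph.Walk.length_copy, length_seg]
    simpa using hoj
  · intro a ha
    rw [SimpleGraph.Walk.support_copy] at ha
    obtain ⟨i, h1, h2, rfl⟩ := c.mem_support_seg _ _ ha
    exact ⟨i, ⟨h1, by omega⟩, rfl⟩
  · rw [SimpleGraph.Walk.length_copy, length_seg]
    rw [Nat.odd_iff] at *
    omega
  · intro a ha
    rw [SimpleGraph.Walk.support_copy] at ha
    obtain ⟨i, h1, h2, rfl⟩ := c.mem_support_seg _ _ ha
    exact ⟨i, ⟨h1, by omega⟩, rfl⟩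
  -- A vertex common to both loops either gives a crossing recurrence or is visited at three
  -- positions whose pairwise distances are odd.
  · rintro _ ⟨a, ⟨-, ha⟩, rfl⟩ ⟨b, ⟨hb, hb'⟩, hab⟩
    have hoab := odd_of_vert_eq hP (a := a) (b := b) (by omega) (by omega) hab.symm
    rcases Nat.eq_zero_or_pos a with rfl | ha0
    · have := odd_of_vert_eq hP (a := j) (b := b) (by omega) (by omega) (h.symm.trans hab.symm)
      rw [Nat.odd_iff] at *
      omega
    · rcases ha.lt_or_eq with ha' | rfl
      · exact false_of_crossing hP ha0 ha' (by omega) (by omega) h hab.symm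
      · have := odd_of_vert_eq hP (a := 0) (b := b) (by omega) (by omega) (h.trans hab.symm)
        rw [Nat.odd_iff] at *
        omega
  · rintro _ _ ⟨a, ⟨-, ha⟩, rfl⟩ ⟨b, rfl⟩ hb hab
    obtain ⟨b', hb', hbb⟩ := c.exists_lt_vert_eq b
    rw [← hbb] at hb hab
    have hbj : j < b' := by
      by_contra! hle
      exact hb ⟨b', ⟨Nat.zero_le _, hle⟩, rfl⟩
    rcases Nat.eq_zero_or_pos a with rfl | ha0
    · rfl
    · rcases ha.lt_or_eq with ha' | rfl
      · exact absurd hab (not_adj_of_crossing hP hS ha0 ha' hbj (by omega) h)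
      · exact h.symm
  · rintro _ _ ⟨a, ⟨ha, ha'⟩, rfl⟩ ⟨b, rfl⟩ hb hab
    obtain ⟨b', hb', hbb⟩ := c.exists_lt_vert_eq b
    rw [← hbb] at hb hab
    have hbj : b' < k ∨ l < b' := by
      by_contra! hle
      exact hb ⟨b', ⟨hle.1, hle.2⟩, rfl⟩
    rcases ha.lt_or_eq with ha1 | rfl
    · rcases ha'.lt_or_eq with ha2 | rfl
      · rcases hbj with hbj | hbj
        · rw [← c.periodic b'] at hab
          exact absurd hab (not_adj_of_crossing hP hS ha1 ha2 (by omega) (by omega) h')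
        · exact absurd hab (not_adj_of_crossing hP hS ha1 ha2 hbj (by omega) h')
      · exact h'.symm
    · rfl
  · intro a ha
    rw [SimpleGraph.Walk.support_copy] at ha
    obtain ⟨i, -, -, rfl⟩ := c.mem_support_seg _ _ ha
    exact ⟨i, rfl⟩

theorem false_of_two_doubles [Finite V] (hG : CondSharp G)
    (hP : IsPrimitivePair c.plus c.minus) (hS : ¬ HasSplit c.plus c.minus) {i j k l : ℕ}
    (hij : i < j) (hjk : j < k) (hkl : k < l) (hl : l < i + 2 * c.half) (h : c.vert i = c.vert j)
    (h' : c.vert k = c.vert l) : False := by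
  refine false_of_two_doubles_zero hG (primitive_shift hP i)
    (fun hs => hS (hasSplit_of_shift c.degA_plus_eq hs)) (j := j - i) (k := k - i) (l := l - i)
    (by omega) (by omega) (by omega) (show l - i < 2 * c.half by omega) ?_ ?_
  · rw [shift_vert, shift_vert, zero_add, Nat.sub_add_cancel (by omega), h]
  · rw [shift_vert, shift_vert, Nat.sub_add_cancel (by omega), Nat.sub_add_cancel (by omega), h']

end ClosedSeq

/-! ### Repeated edges of a primitive walk -/

namespace ClosedSeq

variable {V : Type*} {G : SimpleGraph V} {c : ClosedSeq G}

theorem odd_of_vert_eq_of_ne (hP : IsPrimitivePair c.plus c.minus) {a b : ℕ} (hab : a ≠ b)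
    (ha : a < b + 2 * c.half) (hb : b < a + 2 * c.half) (h : c.vert a = c.vert b) :
    Odd (a + b) := by
  rcases hab.lt_or_gt with hlt | hlt
  · exact odd_of_vert_eq hP hlt hb h
  · rw [add_comm]
    exact odd_of_vert_eq hP hlt ha h.symm

theorem plus_apply [DecidableEq G.edgeSet] (c : ClosedSeq G) (e : G.edgeSet) :
    c.plus e = ((Finset.range (2 * c.half)).filter fun n => Even n ∧ c.edge n = e).card := by
  rw [plus, evenOn, Finsupp.finsetSum_apply, Finset.card_filter, Finset.sum_filter]
  refine Finset.sum_congr rfl fun n _ => ?_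
  by_cases h : Even n <;> simp [h, Finsupp.single_apply]

theorem minus_apply [DecidableEq G.edgeSet] (c : ClosedSeq G) (e : G.edgeSet) :
    c.minus e = ((Finset.range (2 * c.half)).filter fun n => Odd n ∧ c.edge n = e).card := by
  rw [minus, oddOn, Finsupp.finsetSum_apply, Finset.card_filter, Finset.sum_filter]
  refine Finset.sum_congr rfl fun n _ => ?_
  by_cases h : Odd n <;> simp [h, Finsupp.single_apply]

theorem plus_pos {n : ℕ} (hn : n < 2 * c.half) (h : Even n) : 0 < c.plus (c.edge n) := by
  classical
  rw [plus_apply, Finset.card_pos]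
  exact ⟨n, by simp [hn, h]⟩

theorem minus_pos {n : ℕ} (hn : n < 2 * c.half) (h : Odd n) : 0 < c.minus (c.edge n) := by
  classical
  rw [minus_apply, Finset.card_pos]
  exact ⟨n, by simp [hn, h]⟩

theorem exists_of_plus_pos {e : G.edgeSet} (h : 0 < c.plus e) :
    ∃ n < 2 * c.half, Even n ∧ c.edge n = e := by
  classical
  rw [plus_apply, Finset.card_pos] at h
  obtain ⟨n, hn⟩ := h
  rw [Finset.mem_filter, Finset.mem_range] at hn
  exact ⟨n, hn⟩

theorem exists_of_minus_pos {e : G.edgeSet} (h : 0 < c.minus e) :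
    ∃ n < 2 * c.half, Odd n ∧ c.edge n = e := by
  classical
  rw [minus_apply, Finset.card_pos] at h
  obtain ⟨n, hn⟩ := h
  rw [Finset.mem_filter, Finset.mem_range] at hn
  exact ⟨n, hn⟩

theorem even_of_edge_eq (hP : IsPrimitivePair c.plus c.minus) {a b : ℕ} (ha : a < 2 * c.half)
    (hb : b < 2 * c.half) (h : c.edge a = c.edge b) : Even (a + b) := by
  by_contra hodd
  rw [Nat.not_even_iff_odd] at hodd
  rcases Nat.even_or_odd a with ha' | ha'
  · have hb' : Odd b := by
      rw [Nat.odd_iff, Nat.even_iff] at *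
      omega
    have h1 := plus_pos ha ha'
    have h2 := minus_pos hb hb'
    rw [← h] at h2
    have := hP.2.1 (c.edge a)
    omega
  · have hb' : Even b := by
      rw [Nat.odd_iff] at *
      rw [Nat.even_iff]
      omega
    have h1 := minus_pos ha ha'
    have h2 := plus_pos hb hb'
    rw [← h] at h2
    have := hP.2.1 (c.edge a)
    omega

/-- An edge that occurs at two positions is traversed in both directions. -/
theorem vert_eq_of_edge_eq (hP : IsPrimitivePair c.plus c.minus) {a b : ℕ} (hab : a ≠ b)
    (ha : a < 2 * c.half) (hb : b < 2 * c.half) (h : c.edge a = c.edge b) :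
    c.vert a = c.vert (b + 1) ∧ c.vert (a + 1) = c.vert b := by
  have heven := even_of_edge_eq hP ha hb h
  rcases Sym2.eq_iff.1 (congrArg Subtype.val h) with h' | h'
  · have := odd_of_vert_eq_of_ne hP hab (by omega) (by omega) h'.1
    exact absurd heven (Nat.not_even_iff_odd.2 this)
  · exact h'

/-- Such an edge is traversed in both directions, so both its ends recur. The loops `[a + 1, b]` and
`[b + 1, a + 2 * c.half]` are then separate. -/
theorem edge_ne [Finite V] (hG : CondSharp G) (hP : IsPrimitivePair c.plus c.minus)
    (hS : ¬ HasSplit c.plus c.minus) {a b : ℕ} (hab : a < b) (hb : b < 2 * c.half) :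
    c.edge a ≠ c.edge b := by
  intro h
  have heven := even_of_edge_eq hP (by omega) hb h
  obtain ⟨h1, h2⟩ := vert_eq_of_edge_eq hP hab.ne (by omega) hb h
  rw [Nat.even_iff] at heven
  refine false_of_two_doubles hG hP hS (i := a + 1) (j := b) (k := b + 1) (l := a + 2 * c.half)
    (by omega) (by omega) (by omega) (by omega) h2 ?_
  rw [c.periodic, h1]

theorem squarefree [Finite V] (hG : CondSharp G) (hP : IsPrimitivePair c.plus c.minus)
    (hS : ¬ HasSplit c.plus c.minus) (e : G.edgeSet) : c.plus e ≤ 1 ∧ c.minus e ≤ 1 := by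
  classical
  have key : ∀ m n, m < 2 * c.half → n < 2 * c.half → c.edge m = e → c.edge n = e → m = n := by
    intro m n hm hn h1 h2
    by_contra hne
    rcases Nat.lt_or_gt_of_ne hne with h | h
    · exact edge_ne hG hP hS h hn (h1.trans h2.symm)
    · exact edge_ne hG hP hS h hm (h2.trans h1.symm)
  constructor
  · rw [plus_apply, Finset.card_le_one]
    intro m hm n hn
    rw [Finset.mem_filter, Finset.mem_range] at hm hn
    exact key m n hm.1 hn.1 hm.2.2 hn.2.2
  · rw [minus_apply, Finset.card_le_one]
    intro m hm n hn
    rw [Finset.mem_filter, Finset.mem_range] at hm hn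
    exact key m n hm.1 hn.1 hm.2.2 hn.2.2

/-! ### Counting the distinct edges -/

section Count

/-- A second visit of an inner vertex of a shortest loop would give a shorter loop if it lies
inside, and a crossing recurrence if it lies outside. -/
theorem eq_of_vert_eq_of_minimal (hP : IsPrimitivePair c.plus c.minus) {d : ℕ}
    (h : c.vert 0 = c.vert d)
    (hmin : ∀ i d', 0 < d' → d' < d → c.vert i ≠ c.vert (i + d')) {x m : ℕ} (hx : 0 < x)
    (hxd : x < d) (hm : m ≤ 2 * c.half) (hxm : c.vert x = c.vert m) : m = x := by
  have hp : c.vert (2 * c.half) = c.vert 0 := by simpa using c.periodic 0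
  by_contra hne
  have hm' : m < 2 * c.half := by
    refine lt_of_le_of_ne hm fun hm' => ?_
    rw [hm', hp] at hxm
    exact hmin 0 x hx hxd (by rw [zero_add, hxm])
  by_cases hmd : m ≤ d
  · rcases Nat.lt_or_gt_of_ne hne with hlt | hlt
    · exact hmin m (x - m) (by omega) (by omega) (by rw [Nat.add_sub_cancel' hlt.le, hxm])
    · exact hmin x (m - x) (by omega) (by omega) (by rw [Nat.add_sub_cancel' hlt.le, hxm])
  · exact false_of_crossing hP hx hxd (by omega) (by omega) h hxm

theorem edge_ne_of_minimal (hP : IsPrimitivePair c.plus c.minus) {d : ℕ} (hd1 : 1 < d)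
    (hd : d < 2 * c.half) (h : c.vert 0 = c.vert d)
    (hmin : ∀ i d', 0 < d' → d' < d → c.vert i ≠ c.vert (i + d')) {n n' : ℕ} (hn : n < d)
    (hn' : n' < 2 * c.half) (hne : n ≠ n') : c.edge n ≠ c.edge n' := by
  intro heq
  have heven := even_of_edge_eq hP (by omega) hn' heq
  rw [Nat.even_iff] at heven
  obtain ⟨h1, h2⟩ := vert_eq_of_edge_eq hP hne (by omega) hn' heq
  rcases Nat.eq_zero_or_pos n with rfl | hn0
  · have := eq_of_vert_eq_of_minimal hP h hmin zero_lt_one hd1 hn'.le h2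
    omega
  · have := eq_of_vert_eq_of_minimal hP h hmin hn0 hn (m := n' + 1) (by omega) h1
    omega

/-- If the walk passes through some vertex twice, then it has many edges. -/
theorem card_edges_of_double [DecidableEq G.edgeSet] (hP : IsPrimitivePair c.plus c.minus)
    {i j : ℕ} (hij : i < j) (hj : j < i + 2 * c.half) (h : c.vert i = c.vert j) :
    c.half + 2 ≤ (c.plus.support ∪ c.minus.support).card := by
  have hex : ∃ d, 0 < d ∧ d < 2 * c.half ∧ ∃ i, c.vert i = c.vert (i + d) :=
    ⟨j - i, by omega, by omega, i, by rw [Nat.add_sub_cancel' hij.le, h]⟩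
  classical
  obtain ⟨hd0, hd, i, hi⟩ := Nat.find_spec hex
  have hmin := @Nat.find_min _ _ hex
  set d := Nat.find hex with hd_def
  clear_value d
  have hsupp : (c.shift i).plus.support ∪ (c.shift i).minus.support
      = c.plus.support ∪ c.minus.support := by
    rcases c.shift_plus_minus i with ⟨h1, h2⟩ | ⟨h1, h2⟩
    · rw [h1, h2]
    · rw [h1, h2, Finset.union_comm]
  rw [← hsupp]
  have hP' := primitive_shift hP i
  have hi' : (c.shift i).vert 0 = (c.shift i).vert d := by
    rw [shift_vert, shift_vert, zero_add, add_comm d i, hi]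
  have hmin' : ∀ k d', 0 < d' → d' < d → (c.shift i).vert k ≠ (c.shift i).vert (k + d') := by
    intro k d' h0 h1 heq
    refine hmin h1 ⟨h0, h1.trans hd, k + i, ?_⟩
    rw [shift_vert, shift_vert] at heq
    rw [heq]
    congr 1
    omega
  change (c.shift i).half + 2 ≤ _
  have hd' : d < 2 * (c.shift i).half := hd
  generalize c.shift i = b at *
  have hodd := odd_of_vert_eq_zero hP' hd0 hd' hi'
  have hd3 : 3 ≤ d := by
    rw [Nat.odd_iff] at hodd
    by_contra hlt
    have : d = 1 := by omega
    rw [this] at hi'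
    exact (b.adj 0).ne hi'
  -- The first three edges belong to the shortest loop and occur at one position each. The other `2
  -- * b.half - 3` positions carry each edge at most twice, hence at least `b.half - 1` edges.
  set R := Finset.range (2 * b.half) \ Finset.range 3 with hR
  have hsub : Finset.range 3 ⊆ Finset.range (2 * b.half) := by
    intro n hn
    rw [Finset.mem_range] at *
    omega
  have hRcard : R.card + 3 = 2 * b.half := by
    have := Finset.card_sdiff_add_card_eq_card hsub
    rwa [Finset.card_range, Finset.card_range] at this
  have hfib : R.card ≤ 2 * (R.image b.edge).card := by
    refine Finset.card_le_mul_card_image _ _ fun e _ => ?_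
    by_contra hlt
    obtain ⟨x, hx, y, hy, z, hz, hxy, hxz, hyz⟩ := Finset.two_lt_card.1 (not_le.1 hlt)
    rw [Finset.mem_filter, hR, Finset.mem_sdiff, Finset.mem_range] at hx hy hz
    -- Positions `y` and `z` both run against `x`, hence in the same direction, which their equal
    -- parity excludes.
    have h1 := (vert_eq_of_edge_eq hP' hxy hx.1.1 hy.1.1 (hx.2.trans hy.2.symm)).1
    have h2 := (vert_eq_of_edge_eq hP' hxz hx.1.1 hz.1.1 (hx.2.trans hz.2.symm)).1
    have h3 := odd_of_vert_eq_of_ne hP' (a := y + 1) (b := z + 1) (by omega) (by omega) (by omega)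
      (h1.symm.trans h2)
    have h4 := even_of_edge_eq hP' hy.1.1 hz.1.1 (hy.2.trans hz.2.symm)
    rw [Nat.odd_iff, Nat.even_iff] at *
    omega
  have hthree : ((Finset.range 3).image b.edge).card = 3 := by
    rw [Finset.card_image_of_injOn, Finset.card_range]
    intro x hx y hy hxy
    rw [Finset.mem_coe, Finset.mem_range] at hx hy
    by_contra hne
    exact edge_ne_of_minimal hP' (by omega) hd' hi' hmin' (by omega) (by omega) hne hxy
  have hdisj : Disjoint ((Finset.range 3).image b.edge) (R.image b.edge) := by
    rw [Finset.disjoint_left]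
    intro e he he'
    obtain ⟨x, hx, rfl⟩ := Finset.mem_image.1 he
    obtain ⟨y, hy, hxy⟩ := Finset.mem_image.1 he'
    rw [hR, Finset.mem_sdiff, Finset.mem_range] at hy
    rw [Finset.mem_range] at hx
    refine edge_ne_of_minimal hP' (by omega) hd' hi' hmin' (by omega) hy.1 ?_ hxy.symm
    rintro rfl
    exact hy.2 (Finset.mem_range.2 hx)
  have himage : (Finset.range 3).image b.edge ∪ R.image b.edge ⊆
      b.plus.support ∪ b.minus.support := by
    intro e he
    obtain ⟨n, hn, rfl⟩ : ∃ n < 2 * b.half, b.edge n = e := by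
      rw [Finset.mem_union] at he
      rcases he with he | he <;> obtain ⟨x, hx, rfl⟩ := Finset.mem_image.1 he
      · rw [Finset.mem_range] at hx
        exact ⟨x, by omega, rfl⟩
      · rw [hR, Finset.mem_sdiff, Finset.mem_range] at hx
        exact ⟨x, hx.1, rfl⟩
    rw [Finset.mem_union, Finsupp.mem_support_iff, Finsupp.mem_support_iff]
    rcases Nat.even_or_odd n with h | h
    · exact Or.inl (plus_pos hn h).ne'
    · exact Or.inr (minus_pos hn h).ne'
  have := Finset.card_le_card himage
  rw [Finset.card_union_of_disjoint hdisj, hthree] at this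
  omega

end Count

/-! ### Passage from closed walks to periodic sequences -/

section OfWalk

/-- A closed walk of positive even length, as a closed sequence. -/
def ofWalk {u : V} (w : G.Walk u u) (heven : Even w.length) (hpos : 0 < w.length) :
    ClosedSeq G where
  vert n := w.getVert (n % w.length)
  half := w.length / 2
  half_pos := by
    rw [Nat.even_iff] at heven
    omega
  adj n := by
    have hlt := Nat.mod_lt n hpos
    have h := w.adj_getVert_succ hlt
    rw [Nat.add_mod]
    rcases (Nat.succ_le_of_lt hlt).lt_or_eq with h1 | h1
    · rwa [Nat.mod_eq_of_lt (a := 1) (by omega), Nat.mod_eq_of_lt (a := n % w.length + 1) (by omega)]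
    · have h2 : n % w.length + 1 = w.length := h1
      have hne : w.length ≠ 1 := by
        rintro h3
        rw [h3] at heven
        exact absurd heven (by decide)
      rw [h2, SimpleGraph.Walk.getVert_length] at h
      rw [Nat.mod_eq_of_lt (a := 1) (by omega), h2, Nat.mod_self, SimpleGraph.Walk.getVert_zero]
      exact h
  periodic n := by rw [Nat.two_mul_div_two_of_even heven, Nat.add_mod_right]

variable {u : V} {w : G.Walk u u} {heven : Even w.length} {hpos : 0 < w.length}

theorem ofWalk_two_mul_half : 2 * (ofWalk w heven hpos).half = w.length :=
  Nat.two_mul_div_two_of_even heven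

theorem ofWalk_vert {n : ℕ} (hn : n ≤ w.length) : (ofWalk w heven hpos).vert n = w.getVert n := by
  change w.getVert (n % w.length) = _
  rcases hn.lt_or_eq with hn | rfl
  · rw [Nat.mod_eq_of_lt hn]
  · rw [Nat.mod_self, SimpleGraph.Walk.getVert_zero, SimpleGraph.Walk.getVert_length]

theorem ofWalk_edge (i : Fin w.length) : (ofWalk w heven hpos).edge i = edgeAt w i := by
  refine Subtype.ext ?_
  simp only [edge, edgeAt]
  rw [ofWalk_vert i.2.le, ofWalk_vert i.2]

theorem ofWalk_plus : (ofWalk w heven hpos).plus = evenPart w := by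
  rw [plus, evenOn, ofWalk_two_mul_half, evenPart, Finset.sum_filter, Finset.sum_filter,
    ← Fin.sum_univ_eq_sum_range (fun n => if Even n then
      Finsupp.single ((ofWalk w heven hpos).edge n) 1 else 0)]
  simp only [ofWalk_edge]

theorem ofWalk_minus : (ofWalk w heven hpos).minus = oddPart w := by
  rw [minus, oddOn, ofWalk_two_mul_half, oddPart, Finset.sum_filter, Finset.sum_filter,
    ← Fin.sum_univ_eq_sum_range (fun n => if Odd n then
      Finsupp.single ((ofWalk w heven hpos).edge n) 1 else 0)]
  simp only [ofWalk_edge]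

end OfWalk

end ClosedSeq

/-! ### Critical monomials as halves of walks -/

section Critical

variable {V : Type*} {G : SimpleGraph V}

theorem IsCritical.not_hasSplit {M : G.edgeSet →₀ ℕ} (hM : IsCritical (edgeVec G) M) (N : G.edgeSet →₀ ℕ) :
    ¬ HasSplit M N := by
  rintro ⟨a, ha, b, hb, h1, -, -⟩
  exact h1 (hM.2 a ha)

theorem le_of_squarefree {u v : G.edgeSet →₀ ℕ} (hu : ∀ e, u e ≤ 1)
    (h : u.support ⊆ v.support) : u ≤ v := by
  intro e
  by_cases he : u e = 0
  · rw [he]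
    exact Nat.zero_le _
  · have := Finsupp.mem_support_iff.1 (h (Finsupp.mem_support_iff.2 he))
    have := hu e
    omega

theorem card_support_eq_degree {u : G.edgeSet →₀ ℕ} (hu : ∀ e, u e ≤ 1) :
    u.support.card = u.degree := by
  rw [Finsupp.degree_apply, Finset.card_eq_sum_ones]
  refine Finset.sum_congr rfl fun e he => ?_
  have h1 := Finsupp.mem_support_iff.1 he
  have h2 := hu e
  omega

theorem eq_of_le_of_degree_le {u v : G.edgeSet →₀ ℕ} (h : u ≤ v) (hd : v.degree ≤ u.degree) :
    u = v := by
  rcases h.lt_or_eq with hlt | heq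
  · have := degree_lt_of_lt hlt
    omega
  · exact heq

variable [Finite V]

/-- The halves of an alternating closed walk form a nontrivial homogeneous divisor, which by
primitivity is the whole pair. -/
theorem IsPrimitivePair.exists_walk {a b : G.edgeSet →₀ ℕ} (h : IsPrimitivePair a b)
    (ha : a ≠ 0) : ∃ (u : V) (w : G.Walk u u), Even w.length ∧ 0 < w.length ∧
      ((evenPart w = a ∧ oddPart w = b) ∨ (evenPart w = b ∧ oddPart w = a)) := by
  obtain ⟨u, w, heven, hpos, hw⟩ := exists_closed_walk h.1 ha
  refine ⟨u, w, heven, hpos, ?_⟩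
  have hd := degA_evenPart_eq heven
  have hlen := degree_evenPart_add_degree_oddPart w
  have key : ∀ {p q : G.edgeSet →₀ ℕ}, p.degree + q.degree = w.length → ¬ (p = 0 ∧ q = 0) := by
    rintro p q hpq ⟨rfl, rfl⟩
    rw [map_zero] at hpq
    omega
  rcases hw with ⟨h1, h2⟩ | ⟨h1, h2⟩
  · exact Or.inl ((h.2.2 _ h1 _ h2 hd).resolve_left (key hlen))
  · exact Or.inr ((h.2.2 _ h2 _ h1 hd.symm).resolve_left (key (by omega))).symm

theorem IsPrimitivePair.exists_closedSeq {a b : G.edgeSet →₀ ℕ} (h : IsPrimitivePair a b)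
    (ha : a ≠ 0) : ∃ c : ClosedSeq G, c.plus = a ∧ c.minus = b := by
  obtain ⟨u, w, heven, hpos, hw⟩ := h.exists_walk ha
  rcases hw with ⟨h1, h2⟩ | ⟨h1, h2⟩
  · exact ⟨ClosedSeq.ofWalk w heven hpos, by rw [ClosedSeq.ofWalk_plus, h1],
      by rw [ClosedSeq.ofWalk_minus, h2]⟩
  · refine ⟨(ClosedSeq.ofWalk w heven hpos).shift 1, ?_, ?_⟩
    · rw [ClosedSeq.shift_one_plus, ClosedSeq.ofWalk_minus, h2]
    · rw [ClosedSeq.shift_one_minus, ClosedSeq.ofWalk_plus, h1]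

variable {M N : G.edgeSet →₀ ℕ}

/-- A proper divisor of `M` is rigid, so a divisor of `N` of the same degree equals it, and by
coprimality both are trivial. -/
theorem IsCritical.primitivePair (hM : IsCritical (edgeVec G) M)
    (hN : degA (edgeVec G) N = degA (edgeVec G) M) (hne : N ≠ M) : IsPrimitivePair M N := by
  have hdisj := hM.disjoint hN hne
  refine ⟨hN.symm, hdisj, fun a ha b hb hab => ?_⟩
  rcases ha.lt_or_eq with hlt | rfl
  · have hba := hM.2 a hlt b hab.symm
    have ha0 : a = 0 := by
      ext e
      have h1 := ha e
      have h2 := hb e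
      have h3 := hdisj e
      rw [hba] at h2
      rw [Finsupp.coe_zero, Pi.zero_apply]
      omega
    exact Or.inl ⟨ha0, hba.trans ha0⟩
  · exact Or.inr ⟨rfl, eq_of_le_of_degA_eq hb (hab.symm.trans hN.symm)⟩

theorem IsCritical.ne_zero (hM : IsCritical (edgeVec G) M) : M ≠ 0 := by
  rintro rfl
  refine hM.1 fun v hv => ?_
  rw [← Finsupp.degree_eq_zero_iff, degree_eq_of_degA_eq hv, map_zero]

theorem IsCritical.squarefree_pair (hG : CondSharp G) (hM : IsCritical (edgeVec G) M)
    (hN : degA (edgeVec G) N = degA (edgeVec G) M) (hne : N ≠ M) (e : G.edgeSet) :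
    M e ≤ 1 ∧ N e ≤ 1 := by
  have hP := hM.primitivePair hN hne
  obtain ⟨c, rfl, rfl⟩ := hP.exists_closedSeq hM.ne_zero
  exact c.squarefree hG hP (hM.not_hasSplit _) e

theorem IsCritical.squarefree (hG : CondSharp G) (hM : IsCritical (edgeVec G) M) (e : G.edgeSet) :
    M e ≤ 1 := by
  obtain ⟨N, hN, hne⟩ := not_isRigid_iff.1 hM.1
  exact (hM.squarefree_pair hG hN hne e).1

/-- Some critical monomial divides `u`; being squarefree, it also divides `M` and is therefore `M`.
-/
theorem IsCritical.le_of_support_subset (hG : CondSharp G) (hM : IsCritical (edgeVec G) M)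
    {u : G.edgeSet →₀ ℕ} (hu : ¬ IsRigid (edgeVec G) u) (h : u.support ⊆ M.support) : M ≤ u := by
  obtain ⟨u', hle, hu'⟩ := exists_isCritical_le hu
  have hle' : u' ≤ M :=
    le_of_squarefree (hu'.squarefree hG) ((Finsupp.support_mono hle).trans h)
  rw [← hM.eq_of_le hu'.1 hle']
  exact hle

/-- Two critical monomials whose supports carry monomials of the same degree have the same
degree themselves. -/
theorem IsCritical.degA_eq_of_support (hG : CondSharp G) {M' : G.edgeSet →₀ ℕ}
    (hM : IsCritical (edgeVec G) M) (hM' : IsCritical (edgeVec G) M')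
    {u u' : G.edgeSet →₀ ℕ} (hu : u.support = M.support) (hu' : u'.support = M'.support)
    (h : degA (edgeVec G) u = degA (edgeVec G) u') :
    degA (edgeVec G) M = degA (edgeVec G) M' := by
  classical
  by_cases hMM : M = M'
  · rw [hMM]
  have hsupp : M.support ≠ M'.support := fun hs => hMM
    (le_antisymm (le_of_squarefree (hM.squarefree hG) hs.le)
      (le_of_squarefree (hM'.squarefree hG) hs.ge))
  -- Among the pairs of distinct monomials of equal degree supported in `M.support` and
  -- `M'.support`, one of least degree is coprime and primitive.
  have hex : ∃ n, ∃ a b : G.edgeSet →₀ ℕ, degA (edgeVec G) a = degA (edgeVec G) b ∧ a ≠ b ∧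
      a.support ⊆ M.support ∧ b.support ⊆ M'.support ∧ a.degree = n :=
    ⟨_, u, u', h, fun he => hsupp (by rw [← hu, ← hu', he]), hu.le, hu'.le, rfl⟩
  obtain ⟨a, b, hab, hne, ha, hb, hdeg⟩ := Nat.find_spec hex
  have hmin : ∀ a' b' : G.edgeSet →₀ ℕ, degA (edgeVec G) a' = degA (edgeVec G) b' → a' ≠ b' →
      a'.support ⊆ M.support → b'.support ⊆ M'.support → a.degree ≤ a'.degree :=
    fun a' b' h1 h2 h3 h4 => hdeg ▸ Nat.find_min' hex ⟨a', b', h1, h2, h3, h4, rfl⟩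
  have hdisj : ∀ e, a e = 0 ∨ b e = 0 := by
    intro e
    by_contra! hc
    have h1 : Finsupp.single e 1 ≤ a := by simp; omega
    have h2 : Finsupp.single e 1 ≤ b := by simp; omega
    have h3 := hmin (a - Finsupp.single e 1) (b - Finsupp.single e 1)
      (by rw [degA_sub h1, degA_sub h2, hab])
      (fun h => hne (by rw [← tsub_add_cancel_of_le h1, h, tsub_add_cancel_of_le h2]))
      ((Finsupp.support_mono tsub_le_self).trans ha)
      ((Finsupp.support_mono tsub_le_self).trans hb)
    have h4 : (a - Finsupp.single e 1).degree + 1 = a.degree := by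
      conv_rhs => rw [← tsub_add_cancel_of_le h1]
      rw [map_add, Finsupp.degree_single]
    omega
  have hP : IsPrimitivePair a b := by
    refine ⟨hab, hdisj, fun a' ha' b' hb' hd => ?_⟩
    by_cases h0 : a' = 0
    · refine Or.inl ⟨h0, ?_⟩
      rw [← Finsupp.degree_eq_zero_iff, ← degree_eq_of_degA_eq hd, h0, map_zero]
    · have hne' : a' ≠ b' := by
        rintro rfl
        refine h0 (Finsupp.ext fun e => ?_)
        have h1 := ha' e
        have h2 := hb' e
        have h3 := hdisj e
        rw [Finsupp.coe_zero, Pi.zero_apply]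
        omega
      have h1 := hmin a' b' hd hne' ((Finsupp.support_mono ha').trans ha)
        ((Finsupp.support_mono hb').trans hb)
      have h2 := degree_eq_of_degA_eq hd
      have h3 := degree_eq_of_degA_eq hab
      exact Or.inr ⟨eq_of_le_of_degree_le ha' h1, eq_of_le_of_degree_le hb' (by omega)⟩
  have hra : ¬ IsRigid (edgeVec G) a := fun hr => hne (hr b hab.symm).symm
  have hrb : ¬ IsRigid (edgeVec G) b := fun hr => hne (hr a hab)
  have hMa := hM.le_of_support_subset hG hra ha
  have hMb := hM'.le_of_support_subset hG hrb hb
  have ha0 : a ≠ 0 := by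
    rintro rfl
    exact hM.ne_zero (le_zero_iff.1 hMa)
  obtain ⟨c, rfl, rfl⟩ := hP.exists_closedSeq ha0
  -- Without a split the pair is squarefree, hence equal to `(M, M')`. With a split, `M` and `M'`
  -- divide its two members, so the walk has at most `M.degree + M'.degree ≤ c.half + 1` distinct
  -- edges. But `M` is then a proper divisor of `c.plus`, which repeats an edge and so a vertex, and
  -- this requires `c.half + 2` distinct edges.
  by_cases hS : HasSplit c.plus c.minus
  · exfalso
    obtain ⟨a', ha', b', hb', hra', hrb', hsum⟩ := hS
    have h1 := hM.le_of_support_subset hG hra' ((Finsupp.support_mono ha'.le).trans ha)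
    have h2 := hM'.le_of_support_subset hG hrb' ((Finsupp.support_mono hb'.le).trans hb)
    have h3 := Finsupp.degree_mono h1
    have h4 := Finsupp.degree_mono h2
    have hnsq : ∃ e, 1 < c.plus e := by
      by_contra! hsq
      exact (h1.trans_lt ha').not_ge (le_of_squarefree hsq ha)
    obtain ⟨e, he⟩ := hnsq
    rw [ClosedSeq.plus_apply, Finset.one_lt_card] at he
    obtain ⟨m, hm, n, hn, hmn⟩ := he
    rw [Finset.mem_filter, Finset.mem_range] at hm hn
    have hdouble : ∃ i j, i < j ∧ j < i + 2 * c.half ∧ c.vert i = c.vert j := by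
      have key : ∀ m n, m < n → m < 2 * c.half → n < 2 * c.half → Even m → Even n →
          c.edge m = c.edge n → ∃ i j, i < j ∧ j < i + 2 * c.half ∧ c.vert i = c.vert j := by
        intro m n hmn hm hn hm' hn' h
        rw [Nat.even_iff] at hm' hn'
        exact ⟨m, n + 1, by omega, by omega, (c.vert_eq_of_edge_eq hP hmn.ne hm hn h).1⟩
      rcases Nat.lt_or_gt_of_ne hmn with hlt | hlt
      · exact key m n hlt hm.1 hn.1 hm.2.1 hn.2.1 (hm.2.2.trans hn.2.2.symm)
      · exact key n m hlt hn.1 hm.1 hn.2.1 hm.2.1 (hn.2.2.trans hm.2.2.symm)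
    obtain ⟨i, j, hij, hj, hv⟩ := hdouble
    have h5 := ClosedSeq.card_edges_of_double hP hij hj hv
    have h6 := Finset.card_union_le c.plus.support c.minus.support
    have h7 := Finset.card_le_card ha
    have h8 := Finset.card_le_card hb
    rw [card_support_eq_degree (hM.squarefree hG)] at h7
    rw [card_support_eq_degree (hM'.squarefree hG)] at h8
    rw [c.degree_plus] at hsum
    omega
  · have hsq := c.squarefree hG hP hS
    have e1 : c.plus = M := le_antisymm (le_of_squarefree (fun e => (hsq e).1) ha) hMa
    have e2 : c.minus = M' := le_antisymm (le_of_squarefree (fun e => (hsq e).2) hb) hMb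
    rw [← e1, ← e2, c.degA_plus_eq]

end Critical

/-! ### Blocks of a walk -/

section Blocks

open SimpleGraph

variable {V : Type*} {G : SimpleGraph V}

theorem IsBiconnected.preconnected_deleteVerts {H : G.Subgraph} (h : IsBiconnected H) (x : V) :
    (H.deleteVerts {x}).Preconnected := by
  by_cases hx : x ∈ H.verts
  · exact h.2 x hx
  · have : H.deleteVerts {x} = H := by
      rw [← Subgraph.deleteVerts_inter_verts_left_eq, Set.inter_singleton_eq_empty.2 hx,
        Subgraph.deleteVerts_empty]
    rw [this]
    exact h.1.preconnected

/-- After the deletion of one vertex the two connected remainders still share `x` or `y`. -/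
theorem IsBiconnected.sup {H K : G.Subgraph} (hH : IsBiconnected H) (hK : IsBiconnected K)
    {x y : V} (hxy : x ≠ y) (hxH : x ∈ H.verts) (hxK : x ∈ K.verts) (hyH : y ∈ H.verts)
    (hyK : y ∈ K.verts) : IsBiconnected (H ⊔ K) := by
  refine ⟨Subgraph.connected_sup hH.1.preconnected hK.1.preconnected ⟨x, hxH, hxK⟩, ?_⟩
  intro z _
  have heq : (H ⊔ K).deleteVerts {z} = H.deleteVerts {z} ⊔ K.deleteVerts {z} := by
    ext a b
    · simp only [Subgraph.deleteVerts_verts, Subgraph.verts_sup, Set.mem_sdiff, Set.mem_union]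
      tauto
    · simp only [Subgraph.deleteVerts_adj, Subgraph.verts_sup, Subgraph.sup_adj, Set.mem_union]
      constructor
      · rintro ⟨-, h1, -, h2, h | h⟩
        · exact Or.inl ⟨h.fst_mem, h1, h.snd_mem, h2, h⟩
        · exact Or.inr ⟨h.fst_mem, h1, h.snd_mem, h2, h⟩
      · tauto
  rw [heq]
  refine (Subgraph.connected_sup (hH.preconnected_deleteVerts z)
    (hK.preconnected_deleteVerts z) ?_).preconnected
  by_cases hzx : x = z
  · have hyz : y ≠ z := fun h => hxy (hzx.trans h.symm)
    exact ⟨y, ⟨hyH, hyz⟩, ⟨hyK, hyz⟩⟩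
  · exact ⟨x, ⟨hxH, hzx⟩, ⟨hxK, hzx⟩⟩

variable {u : V} {w : G.Walk u u}

/-- A nontrivial block contains an edge of `w` at `x`, so it shares both ends with `C` and absorbs
`C` by maximality. A block with a single vertex is contained in `C`. -/
theorem le_of_isBlock {B C : G.Subgraph} (hB : IsBlock w B) (hCw : C ≤ w.toSubgraph)
    (hC : IsBiconnected C) {x : V} (hxB : x ∈ B.verts) (hxC : x ∈ C.verts)
    (hnbr : ∀ y, w.toSubgraph.Adj x y → y ∈ C.verts) : C ≤ B := by
  by_cases hnt : Nontrivial B.verts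
  · obtain ⟨y, hy⟩ := hB.1.2.1.preconnected.exists_adj_of_nontrivial ⟨x, hxB⟩
    have := hC.sup hB.1.2 hy.ne hxC hxB (hnbr y (hB.1.1.2 hy)) hy.snd_mem
    exact le_sup_left.trans (hB.2 ⟨sup_le hCw hB.1.1, this⟩ le_sup_right)
  · rw [not_nontrivial_iff_subsingleton, Set.subsingleton_coe] at hnt
    refine hB.2 ⟨hCw, hC⟩ ⟨fun y hy => ?_, fun a b hab => ?_⟩
    · rw [hnt hy hxB]
      exact hxC
    · exact absurd (hnt hab.fst_mem hab.snd_mem) hab.ne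

theorem eq_of_isBlock {B₁ B₂ C : G.Subgraph} (hB₁ : IsBlock w B₁) (hB₂ : IsBlock w B₂)
    (h₁ : C ≤ B₁) (h₂ : C ≤ B₂) {x y : V} (hxy : x ≠ y) (hx : x ∈ C.verts) (hy : y ∈ C.verts) :
    B₁ = B₂ := by
  have h := hB₁.1.2.sup hB₂.1.2 hxy (h₁.1 hx) (h₂.1 hx) (h₁.1 hy) (h₂.1 hy)
  have hle := sup_le hB₁.1.1 hB₂.1.1
  exact le_antisymm (le_sup_left.trans (hB₂.2 ⟨hle, h⟩ le_sup_right))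
    (le_sup_right.trans (hB₁.2 ⟨hle, h⟩ le_sup_left))

end Blocks

namespace ClosedSeq

open SimpleGraph

variable {V : Type*} {G : SimpleGraph V} {c : ClosedSeq G}

/-- The walk visits the vertex at position `p` only once in each period. -/
def IsSimpleAt (c : ClosedSeq G) (p : ℕ) : Prop :=
  ∀ m < 2 * c.half, c.vert m = c.vert p → m = p

/-- The closed part of the walk of length `L` from position `a` on. -/
def subcycle (c : ClosedSeq G) (a L : ℕ) (hL : 0 < L) (h : c.vert (a + L) = c.vert a) :
    G.Subgraph where
  verts := {x | ∃ n, a ≤ n ∧ n < a + L ∧ c.vert n = x}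
  Adj x y := ∃ n, a ≤ n ∧ n < a + L ∧ s(c.vert n, c.vert (n + 1)) = s(x, y)
  adj_sub := by
    rintro x y ⟨n, -, -, hn⟩
    have := c.adj n
    rwa [← SimpleGraph.mem_edgeSet, hn] at this
  edge_vert := by
    have key : ∀ n, a ≤ n → n ≤ a + L → ∃ m, a ≤ m ∧ m < a + L ∧ c.vert m = c.vert n := by
      intro n h1 h2
      rcases h2.lt_or_eq with h3 | rfl
      · exact ⟨n, h1, h3, rfl⟩
      · exact ⟨a, le_rfl, by omega, h.symm⟩
    rintro x y ⟨n, h1, h2, hn⟩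
    rcases Sym2.eq_iff.1 hn with ⟨rfl, -⟩ | ⟨-, rfl⟩
    · exact key n h1 h2.le
    · exact key (n + 1) (by omega) (by omega)
  symm := ⟨by
    rintro x y ⟨n, h1, h2, hn⟩
    exact ⟨n, h1, h2, hn.trans Sym2.eq_swap⟩⟩

section Subcycle

variable {a L : ℕ} {hL : 0 < L} {h : c.vert (a + L) = c.vert a}

theorem mem_subcycle {n : ℕ} (h1 : a ≤ n) (h2 : n ≤ a + L) :
    c.vert n ∈ (c.subcycle a L hL h).verts := by
  rcases h2.lt_or_eq with h3 | rfl
  · exact ⟨n, h1, h3, rfl⟩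
  · exact ⟨a, le_rfl, by omega, h.symm⟩

theorem subcycle_adj (n : ℕ) :
    (c.subcycle a L hL h).Adj (c.vert (a + n % L)) (c.vert (a + (n + 1) % L)) := by
  have hlt := Nat.mod_lt n hL
  refine ⟨a + n % L, by omega, by omega, ?_⟩
  rcases (Nat.succ_le_of_lt hlt).lt_or_eq with h1 | h1
  · have : (n + 1) % L = n % L + 1 := by
      rw [Nat.add_mod, Nat.mod_eq_of_lt (a := 1) (by omega), Nat.mod_eq_of_lt (by omega)]
    rw [this, add_assoc]
  · have : (n + 1) % L = 0 := by
      rw [← Nat.mod_add_mod]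
      change n % L + 1 = L at h1
      rw [h1, Nat.mod_self]
    rw [this, add_assoc, show n % L + 1 = L from h1, h, add_zero]

/-- Deleting `v_m` from a loop without repetitions leaves the path through the positions `m + 1, …,
m + L - 1`, counted cyclically. -/
theorem subcycle_biconnected
    (hinj : ∀ k l, a ≤ k → k < l → l < a + L → c.vert k ≠ c.vert l) :
    IsBiconnected (c.subcycle a L hL h) := by
  have hmem : ∀ n, c.vert (a + n % L) ∈ (c.subcycle a L hL h).verts := fun n =>
    mem_subcycle (by omega) (by have := Nat.mod_lt n hL; omega)
  have hinj' : ∀ m n, c.vert (a + m % L) = c.vert (a + n % L) → m % L = n % L := by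
    intro m n hmn
    have h1 := Nat.mod_lt m hL
    have h2 := Nat.mod_lt n hL
    by_contra hne
    rcases Nat.lt_or_gt_of_ne hne with hlt | hlt
    · exact hinj _ _ (by omega) (by omega) (by omega) hmn
    · exact hinj _ _ (by omega) (by omega) (by omega) hmn.symm
  constructor
  · rw [Subgraph.connected_iff', connected_iff_exists_forall_reachable]
    refine ⟨⟨_, hmem 0⟩, ?_⟩
    have key : ∀ n, (c.subcycle a L hL h).coe.Reachable ⟨_, hmem 0⟩ ⟨_, hmem n⟩ := by
      intro n
      induction n with
      | zero => exact Reachable.refl _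
      | succ n ih =>
        refine ih.trans (Adj.reachable ?_)
        exact subcycle_adj (hL := hL) (h := h) n
    rintro ⟨_, n, h1, h2, rfl⟩
    have h3 := key (n - a)
    have h4 : a + (n - a) % L = n := by
      rw [Nat.mod_eq_of_lt (by omega)]
      omega
    simpa only [h4] using h3
  · rintro _ ⟨m, hm1, hm2, rfl⟩
    have hmod : ∀ k, 0 < k → k < L → (m - a + k) % L ≠ (m - a) % L := by
      intro k h1 h2 h3
      have h4 : (m - a + k) ≡ (m - a) [MOD L] := h3
      have h5 : k ≡ 0 [MOD L] := by
        have : m - a + k ≡ m - a + 0 [MOD L] := h4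
        exact Nat.ModEq.add_left_cancel' _ this
      rw [Nat.ModEq, Nat.zero_mod, Nat.mod_eq_of_lt h2] at h5
      omega
    have hma : a + (m - a) % L = m := by
      rw [Nat.mod_eq_of_lt (by omega)]
      omega
    have hmem' : ∀ k, 0 < k → k < L → c.vert (a + (m - a + k) % L) ∈
        ((c.subcycle a L hL h).deleteVerts {c.vert m}).verts := by
      intro k h1 h2
      refine ⟨hmem _, fun h3 => hmod k h1 h2 (hinj' _ _ ?_)⟩
      rw [hma]
      exact h3
    have key : ∀ k (h1 : k + 1 < L) (h2 : 1 < L),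
        ((c.subcycle a L hL h).deleteVerts {c.vert m}).coe.Reachable
          ⟨_, hmem' 1 one_pos h2⟩ ⟨_, hmem' (k + 1) (Nat.succ_pos k) h1⟩ := by
      intro k
      induction k with
      | zero => exact fun _ _ => Reachable.refl _
      | succ k ih =>
        intro h1 h2
        refine (ih (by omega) h2).trans (Adj.reachable ?_)
        rw [Subgraph.coe_adj, Subgraph.deleteVerts_adj]
        have h3 := hmem' (k + 1) (Nat.succ_pos k) (by omega)
        have h4 := hmem' (k + 1 + 1) (Nat.succ_pos _) h1
        exact ⟨h3.1, h3.2, h4.1, h4.2, subcycle_adj _⟩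
    have hrepr : ∀ y ∈ ((c.subcycle a L hL h).deleteVerts {c.vert m}).verts,
        ∃ k, k + 1 < L ∧ c.vert (a + (m - a + (k + 1)) % L) = y := by
      rintro _ ⟨⟨n, h1, h2, rfl⟩, h3⟩
      have hne : n ≠ m := by
        rintro rfl
        exact h3 rfl
      rcases Nat.lt_or_gt_of_ne hne with hlt | hlt
      · refine ⟨n + L - m - 1, by omega, ?_⟩
        have : m - a + (n + L - m - 1 + 1) = (n - a) + L := by omega
        rw [this, Nat.add_mod_right, Nat.mod_eq_of_lt (by omega), Nat.add_sub_cancel' h1]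
      · refine ⟨n - m - 1, by omega, ?_⟩
        have : m - a + (n - m - 1 + 1) = n - a := by omega
        rw [this, Nat.mod_eq_of_lt (by omega), Nat.add_sub_cancel' h1]
    refine ⟨?_⟩
    rintro ⟨x, hx⟩ ⟨y, hy⟩
    obtain ⟨k, hk, rfl⟩ := hrepr x hx
    obtain ⟨l, hl, rfl⟩ := hrepr y hy
    exact (key k hk (by omega)).symm.trans (key l hl (by omega))

end Subcycle

/-! ### Chords of the walk that are not bridges -/

section Bridges

variable {u : V} {w : G.Walk u u} {heven : Even w.length} {hpos : 0 < w.length}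

theorem edge_mod (n : ℕ) : s(c.vert (n % (2 * c.half)), c.vert (n % (2 * c.half) + 1))
    = s(c.vert n, c.vert (n + 1)) := by
  rw [c.vert_mod, ← c.vert_mod (n % (2 * c.half) + 1), Nat.mod_add_mod, c.vert_mod]

theorem toSubgraph_adj_iff_exists {x y : V} : w.toSubgraph.Adj x y ↔
    ∃ n, s((ofWalk w heven hpos).vert n, (ofWalk w heven hpos).vert (n + 1)) = s(x, y) := by
  rw [Walk.toSubgraph_adj_iff]
  constructor
  · rintro ⟨i, hi, hlt⟩
    exact ⟨i, by rw [ofWalk_vert hlt.le, ofWalk_vert hlt, hi]⟩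
  · rintro ⟨n, hn⟩
    have hlt := Nat.mod_lt n hpos
    refine ⟨n % w.length, ?_, hlt⟩
    rw [← hn, ← edge_mod n, ofWalk_two_mul_half, ofWalk_vert hlt.le, ofWalk_vert hlt]

theorem subcycle_le {a L : ℕ} {hL : 0 < L}
    {h : (ofWalk w heven hpos).vert (a + L) = (ofWalk w heven hpos).vert a} :
    (ofWalk w heven hpos).subcycle a L hL h ≤ w.toSubgraph := by
  constructor
  · rintro _ ⟨n, -, -, rfl⟩
    rw [Walk.mem_verts_toSubgraph]
    exact w.getVert_mem_support _
  · rintro x y ⟨n, -, -, hn⟩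
    exact toSubgraph_adj_iff_exists.2 ⟨n, hn⟩

/-- A vertex visited once has as neighbours in `w` only its predecessor and its successor, and both
lie on the loop because `p'` is strictly inside it. The position `p'` allows a loop that runs past
the end of the period. -/
theorem mem_subcycle_of_adj {a L p p' : ℕ} {hL : 0 < L}
    {h : (ofWalk w heven hpos).vert (a + L) = (ofWalk w heven hpos).vert a}
    (hp : (ofWalk w heven hpos).IsSimpleAt p) (hp' : p' = p ∨ p' = p + 2 * (ofWalk w heven hpos).half)
    (h1 : a < p') (h2 : p' < a + L) {y : V}
    (hy : w.toSubgraph.Adj ((ofWalk w heven hpos).vert p) y) :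
    y ∈ ((ofWalk w heven hpos).subcycle a L hL h).verts := by
  rw [toSubgraph_adj_iff_exists (heven := heven) (hpos := hpos)] at hy
  generalize ofWalk w heven hpos = c at *
  have hc := c.half_pos
  have hmod : ∀ n, c.vert n = c.vert p → n % (2 * c.half) = p := fun n hn =>
    hp _ (Nat.mod_lt _ (by omega)) (by rw [c.vert_mod, hn])
  have hnext : ∀ n, c.vert n = c.vert p → c.vert (n + 1) = c.vert (p' + 1) := by
    intro n hn
    rw [← c.vert_mod (n + 1), ← Nat.mod_add_mod, hmod n hn, c.vert_mod]
    rcases hp' with rfl | rfl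
    · rfl
    · rw [add_right_comm, c.periodic]
  have hprev : ∀ n, c.vert (n + 1) = c.vert p → c.vert n = c.vert (p' - 1) := by
    intro n hn
    have h3 : c.vert (n + 2 * c.half) = c.vert (p + (2 * c.half - 1)) := by
      have : n + 2 * c.half = n + 1 + (2 * c.half - 1) := by omega
      rw [this, ← c.vert_mod, ← Nat.mod_add_mod, hmod _ hn, c.vert_mod]
    rw [← c.periodic n, h3]
    rcases hp' with rfl | rfl
    · rw [← c.periodic (p' - 1)]
      congr 1
      omega
    · congr 1
      omega
  obtain ⟨n, hn⟩ := hy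
  rcases Sym2.eq_iff.1 hn with ⟨h3, rfl⟩ | ⟨rfl, h3⟩
  · rw [hnext n h3]
    exact mem_subcycle (by omega) (by omega)
  · rw [hprev n h3]
    exact mem_subcycle (by omega) (by omega)

/-- Every block through either vertex contains the whole loop, and blocks with two common vertices
coincide. -/
theorem not_isBridgeAt_of_subcycle {a L p q p' q' : ℕ} (hL : 0 < L)
    (h : (ofWalk w heven hpos).vert (a + L) = (ofWalk w heven hpos).vert a)
    (hinj : ∀ k l, a ≤ k → k < l → l < a + L →
      (ofWalk w heven hpos).vert k ≠ (ofWalk w heven hpos).vert l)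
    (hpw : p < w.length) (hqw : q < w.length)
    (hp : (ofWalk w heven hpos).IsSimpleAt p) (hq : (ofWalk w heven hpos).IsSimpleAt q)
    (hp' : p' = p ∨ p' = p + 2 * (ofWalk w heven hpos).half)
    (hq' : q' = q ∨ q' = q + 2 * (ofWalk w heven hpos).half)
    (h1 : a < p') (h2 : p' < a + L) (h3 : a < q') (h4 : q' < a + L) : ¬ IsBridgeAt w p q := by
  rintro ⟨B₁, B₂, hB₁, hB₂, hne, hpB, hqB⟩
  have hbi := subcycle_biconnected (hL := hL) (h := h) hinj
  have ep : (ofWalk w heven hpos).vert p' = (ofWalk w heven hpos).vert p := by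
    rcases hp' with rfl | rfl
    · rfl
    · rw [periodic]
  have eq : (ofWalk w heven hpos).vert q' = (ofWalk w heven hpos).vert q := by
    rcases hq' with rfl | rfl
    · rfl
    · rw [periodic]
  rw [← ofWalk_vert (heven := heven) (hpos := hpos) hpw.le] at hpB
  rw [← ofWalk_vert (heven := heven) (hpos := hpos) hqw.le] at hqB
  have h5 := le_of_isBlock hB₁ subcycle_le hbi hpB (ep ▸ mem_subcycle h1.le h2.le)
    fun y hy => mem_subcycle_of_adj hp hp' h1 h2 hy
  have h6 := le_of_isBlock hB₂ subcycle_le hbi hqB (eq ▸ mem_subcycle h3.le h4.le)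
    fun y hy => mem_subcycle_of_adj hq hq' h3 h4 hy
  exact hne (eq_of_isBlock hB₁ hB₂ h5 h6 ((ofWalk w heven hpos).adj a).ne
    (mem_subcycle le_rfl (by omega)) (mem_subcycle (by omega) (by omega)))

variable [Finite V]

/-- A repetition inside the loop and the complementary loop would be two separate recurrences; one
at the base vertex contradicts parity. -/
theorem injective_on_subcycle (hG : CondSharp G) (hP : IsPrimitivePair c.plus c.minus)
    (hS : ¬ HasSplit c.plus c.minus) {a L : ℕ} (hL' : L < 2 * c.half)
    (h : c.vert (a + L) = c.vert a) {k l : ℕ} (hk : a ≤ k) (hkl : k < l) (hl : l < a + L) :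
    c.vert k ≠ c.vert l := by
  intro hv
  rcases hk.lt_or_eq with hk | rfl
  · refine false_of_two_doubles hG hP hS hkl hl (l := a + 2 * c.half) (by omega) (by omega) hv ?_
    rw [h, c.periodic]
  · have h1 := odd_of_vert_eq hP hkl (by omega) hv
    have h2 := odd_of_vert_eq hP hl (by omega) (hv.symm.trans h.symm)
    have h3 := odd_of_vert_eq hP (a := a) (b := a + L) (by omega) (by omega) h.symm
    rw [Nat.odd_iff] at *
    omega

/-- A chord between positions of the same parity, which are visited only once, joins two vertices
of the same block. -/
theorem not_isBridgeAt (hG : CondSharp G)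
    (hP : IsPrimitivePair (ofWalk w heven hpos).plus (ofWalk w heven hpos).minus)
    (hS : ¬ HasSplit (ofWalk w heven hpos).plus (ofWalk w heven hpos).minus) {p q : ℕ}
    (hpq : p + 1 < q) (hqw : q < w.length)
    (hp : (ofWalk w heven hpos).IsSimpleAt p) (hq : (ofWalk w heven hpos).IsSimpleAt q)
    (hadj : G.Adj (w.getVert p) (w.getVert q)) : ¬ IsBridgeAt w p q := by
  have hlen := ofWalk_two_mul_half (w := w) (heven := heven) (hpos := hpos)
  rw [← ofWalk_vert (heven := heven) (hpos := hpos) (by omega),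
    ← ofWalk_vert (heven := heven) (hpos := hpos) hqw.le] at hadj
  -- A repeated vertex cuts the walk into the loops `[i, j]` and `[j, i + w.length]`. The ends of
  -- the chord differ from it, and `not_adj_of_crossing` places them on the same loop.
  by_cases hd : ∃ i j, i < j ∧ j < w.length ∧
      (ofWalk w heven hpos).vert i = (ofWalk w heven hpos).vert j
  · obtain ⟨i, j, hij, hj, hv⟩ := hd
    have hne : ∀ x, (ofWalk w heven hpos).IsSimpleAt x → x ≠ i ∧ x ≠ j := by
      intro x hx
      constructor
      · rintro rfl
        exact hij.ne' (hx j (by omega) hv.symm)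
      · rintro rfl
        exact hij.ne (hx i (by omega) hv)
    have hpne := hne p hp
    have hqne := hne q hq
    have hin : (ofWalk w heven hpos).vert (i + (j - i)) = (ofWalk w heven hpos).vert i := by
      rw [Nat.add_sub_cancel' hij.le, hv]
    have hout : (ofWalk w heven hpos).vert (j + (i + w.length - j))
        = (ofWalk w heven hpos).vert j := by
      rw [Nat.add_sub_cancel' (by omega), ← hlen, periodic, hv]
    have hout' : ∀ p' q', (p' = p ∨ p' = p + 2 * (ofWalk w heven hpos).half) →
        (q' = q ∨ q' = q + 2 * (ofWalk w heven hpos).half) → j < p' → p' < i + w.length →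
        j < q' → q' < i + w.length → ¬ IsBridgeAt w p q := by
      intro p' q' h1 h2 h3 h4 h5 h6
      exact not_isBridgeAt_of_subcycle (L := i + w.length - j) (by omega) hout
        (fun k l h7 h8 h9 => injective_on_subcycle hG hP hS (by omega) hout h7 h8 h9)
        (by omega) hqw hp hq h1 h2 h3 (by omega) h5 (by omega)
    rcases Nat.lt_or_gt_of_ne hpne.1 with h1 | h1
    · rcases Nat.lt_or_gt_of_ne hqne.1 with h2 | h2
      · exact hout' _ _ (Or.inr rfl) (Or.inr rfl) (by omega) (by omega) (by omega) (by omega)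
      · rcases Nat.lt_or_gt_of_ne hqne.2 with h3 | h3
        · refine absurd hadj.symm ?_
          rw [← periodic _ p]
          exact not_adj_of_crossing hP hS h2 h3 (by omega) (by omega) hv
        · exact hout' _ _ (Or.inr rfl) (Or.inl rfl) (by omega) (by omega) (by omega) (by omega)
    · rcases Nat.lt_or_gt_of_ne hpne.2 with h2 | h2
      · rcases Nat.lt_or_gt_of_ne hqne.2 with h3 | h3
        · exact not_isBridgeAt_of_subcycle (L := j - i) (by omega) hin
            (fun k l h7 h8 h9 => injective_on_subcycle hG hP hS (by omega) hin h7 h8 h9)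
            (by omega) hqw hp hq (Or.inl rfl) (Or.inl rfl) (by omega) (by omega) (by omega)
            (by omega)
        · exact absurd hadj (not_adj_of_crossing hP hS h1 h2 h3 (by omega) hv)
      · exact hout' _ _ (Or.inl rfl) (Or.inl rfl) (by omega) (by omega) (by omega) (by omega)
  · push Not at hd
    -- The whole walk is a cycle here. Started at `p + 1`, it has both `q` and `p + 2 * half` as
    -- inner positions.
    refine not_isBridgeAt_of_subcycle (a := p + 1) (L := 2 * (ofWalk w heven hpos).half)
      (by omega) (periodic _ _) ?_ (by omega) hqw hp hq (Or.inr rfl) (Or.inl rfl) (by omega)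
      (by omega) (by omega) (by omega)
    intro k l h1 h2 h3 h4
    have hmod : k % w.length ≠ l % w.length := by
      intro h5
      have h6 : w.length ∣ l - k := (Nat.modEq_iff_dvd' h2.le).1 h5
      have := Nat.le_of_dvd (by omega) h6
      omega
    rw [← vert_mod _ k, ← vert_mod _ l, hlen] at h4
    rcases Nat.lt_or_gt_of_ne hmod with h5 | h5
    · exact hd _ _ h5 (Nat.mod_lt _ hpos) h4
    · exact hd _ _ h5 (Nat.mod_lt _ hpos) h4.symm

end Bridges

end ClosedSeq

namespace ClosedSeq

/-! ### Crossing chords -/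

variable {V : Type*} {G : SimpleGraph V} {c : ClosedSeq G}

/-- The even edges pair up the positions of a period, so each visit of a vertex contributes 1. -/
theorem degA_plus (c : ClosedSeq G) :
    degA (edgeVec G) c.plus = ∑ n ∈ Finset.range (2 * c.half), delta (c.vert n) := by
  rw [plus_eq_sum]
  generalize c.half = s
  induction s with
  | zero => simp [degA_zero]
  | succ s ih =>
    rw [Finset.sum_range_succ, degA_add, ih, degA_single, edge, edgeVec_mk, mul_add_one,
      Finset.sum_range_succ, Finset.sum_range_succ, add_assoc]

theorem degA_plus_of_isSimpleAt {p : ℕ} (hp : p < 2 * c.half) (h : c.IsSimpleAt p) :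
    degA (edgeVec G) c.plus (c.vert p) = 1 := by
  rw [degA_plus, Finset.sum_apply, Finset.sum_eq_single p, delta_self]
  · intro n hn hne
    refine delta_of_ne fun heq => hne ?_
    exact h n (Finset.mem_range.1 hn) heq.symm
  · intro hn
    exact absurd (Finset.mem_range.2 hp) hn

theorem eq_of_degA_eq_one [Finite V] {Q : G.edgeSet →₀ ℕ} {x : V}
    (h : degA (edgeVec G) Q x = 1) {e e' : G.edgeSet} (he : x ∈ (e : Sym2 V))
    (he' : x ∈ (e' : Sym2 V)) (hQ : 0 < Q e) (hQ' : 0 < Q e') : e = e' := by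
  by_contra hne
  have hle : Finsupp.single e 1 + Finsupp.single e' 1 ≤ Q := by
    classical
    intro f
    rw [Finsupp.add_apply, Finsupp.single_apply, Finsupp.single_apply]
    split_ifs with h1 h2 h2
    · exact absurd (h1.trans h2.symm) hne
    · rw [← h1]
      omega
    · rw [← h2]
      omega
    · omega
  have := degA_apply_mono hle x
  rw [degA_add, degA_single, degA_single, Pi.add_apply, edgeVec_of_mem he, edgeVec_of_mem he',
    h] at this
  omega

theorem edge_eq_edge_mod (n : ℕ) : c.edge (n % (2 * c.half)) = c.edge n :=
  Subtype.ext (edge_mod n)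

/-- An edge of the walk joins neighbouring positions, of opposite parity, and each end of the chord
has only one position. -/
theorem edge_ne_chord {p q : ℕ} (hp : p < 2 * c.half) (hq : q < 2 * c.half)
    (hsp : c.IsSimpleAt p) (hsq : c.IsSimpleAt q) (heven : Even (p + q))
    (h : G.Adj (c.vert p) (c.vert q)) (n : ℕ) : c.edge n ≠ ⟨s(c.vert p, c.vert q), h⟩ := by
  intro heq
  rw [← edge_eq_edge_mod] at heq
  have hlt := Nat.mod_lt n (show 0 < 2 * c.half by omega)
  generalize n % (2 * c.half) = m at *
  have key : ∀ x y, y < 2 * c.half → c.IsSimpleAt x → c.IsSimpleAt y →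
      c.vert m = c.vert x → c.vert (m + 1) = c.vert y → Odd (x + y) := by
    intro x y hy hx hsy h1 h2
    obtain rfl := hx m hlt h1
    rcases (Nat.succ_le_of_lt hlt).lt_or_eq with h3 | h3
    · obtain rfl := hsy (m + 1) h3 h2
      exact ⟨m, by omega⟩
    · have h3' : m + 1 = 2 * c.half := h3
      rw [h3', ← zero_add (2 * c.half), c.periodic] at h2
      obtain rfl := hsy 0 (by omega) h2
      exact ⟨c.half - 1, by omega⟩
  rcases Sym2.eq_iff.1 (congrArg Subtype.val heq) with ⟨h1, h2⟩ | ⟨h1, h2⟩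
  · exact (Nat.not_even_iff_odd.2 (key p q hq hsp hsq h1 h2)) heven
  · have := key q p hp hsq hsp h1 h2
    rw [add_comm] at this
    exact (Nat.not_even_iff_odd.2 this) heven

theorem plus_chord_eq_zero {f : G.edgeSet} (hf : ∀ n, c.edge n ≠ f) : c.plus f = 0 := by
  by_contra h
  obtain ⟨n, -, -, hn⟩ := exists_of_plus_pos (Nat.pos_of_ne_zero h)
  exact hf n hn

theorem minus_chord_eq_zero {f : G.edgeSet} (hf : ∀ n, c.edge n ≠ f) : c.minus f = 0 := by
  by_contra h
  obtain ⟨n, -, -, hn⟩ := exists_of_minus_pos (Nat.pos_of_ne_zero h)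
  exact hf n hn

/-- The monomial `Q` contains the chord `{v_p, v_q}`. -/
def IsChordIn (c : ClosedSeq G) (Q : G.edgeSet →₀ ℕ) (p q : ℕ) : Prop :=
  p < q ∧ q < 2 * c.half ∧ c.IsSimpleAt p ∧ c.IsSimpleAt q ∧ Even (p + q) ∧
    ∃ h : G.Adj (c.vert p) (c.vert q), 0 < Q ⟨s(c.vert p, c.vert q), h⟩

theorem pos_of_edge {M N Q : G.edgeSet →₀ ℕ}
    (hM : IsCritical (edgeVec G) M)
    (hMN : (c.plus = M ∧ c.minus = N) ∨ (c.plus = N ∧ c.minus = M))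
    (hQ : degA (edgeVec G) Q = degA (edgeVec G) M) (hQM : Q ≠ M) {n : ℕ}
    (hn : n < 2 * c.half) (he : 0 < Q (c.edge n)) : 0 < N (c.edge n) := by
  have h1 := hM.disjoint hQ hQM (c.edge n)
  have h2 : 0 < c.plus (c.edge n) ∨ 0 < c.minus (c.edge n) :=
    (Nat.even_or_odd n).imp (plus_pos hn) (minus_pos hn)
  rcases hMN with ⟨rfl, rfl⟩ | ⟨rfl, rfl⟩ <;> omega

/-- The even edges of `S` have the degree of the odd edges of `S` times `f` and `f'`. The two
monomials differ because `f` is not in the walk, so the first is a non-rigid divisor of a critical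
monomial and exhausts it. -/
theorem odd_of_mem_compl_of_isCritical_plus (hM : IsCritical (edgeVec G) c.plus) {S : Finset ℕ}
    (hS : S ⊆ Finset.range (2 * c.half)) {f f' : G.edgeSet} (hf : ∀ n, c.edge n ≠ f)
    (h : c.altDeg S = edgeVec G f + edgeVec G f') :
    ∀ n ∈ Finset.range (2 * c.half) \ S, Odd n := by
  have heq : degA (edgeVec G) (c.oddOn S + Finsupp.single f 1 + Finsupp.single f' 1)
      = degA (edgeVec G) (c.evenOn S) := by
    rw [degA_add, degA_add, degA_single, degA_single, add_assoc, ← h, ← degA_evenOn_sub_oddOn]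
    ring
  have hsum := c.evenOn_add_sdiff hS
  change _ = c.plus at hsum
  have hle : c.evenOn S ≤ c.plus := hsum ▸ le_self_add
  have hnr : ¬ IsRigid (edgeVec G) (c.evenOn S) := by
    intro hr
    have h1 := DFunLike.congr_fun (hr _ heq) f
    have h2 := hle f
    rw [plus_chord_eq_zero hf] at h2
    simp only [Finsupp.add_apply, Finsupp.single_eq_same] at h1
    omega
  have h0 : c.evenOn (Finset.range (2 * c.half) \ S) = 0 := by
    rw [hM.eq_of_le hnr hle] at hsum
    exact add_eq_left.1 hsum
  intro n hn
  by_contra hne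
  rw [Nat.not_odd_iff_even] at hne
  have h1 : Finsupp.single (c.edge n) 1 ≤ c.evenOn (Finset.range (2 * c.half) \ S) :=
    Finset.single_le_sum (f := fun n => Finsupp.single (c.edge n) 1) (fun _ _ => zero_le)
      (Finset.mem_filter.2 ⟨hn, hne⟩)
  rw [h0] at h1
  have := h1 (c.edge n)
  simp at this

theorem even_of_mem_compl_of_isCritical_minus (hM : IsCritical (edgeVec G) c.minus) {S : Finset ℕ}
    (hS : S ⊆ Finset.range (2 * c.half)) {f f' : G.edgeSet} (hf : ∀ n, c.edge n ≠ f)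
    (h : c.altDeg S = -(edgeVec G f + edgeVec G f')) :
    ∀ n ∈ Finset.range (2 * c.half) \ S, Even n := by
  have heq : degA (edgeVec G) (c.evenOn S + Finsupp.single f 1 + Finsupp.single f' 1)
      = degA (edgeVec G) (c.oddOn S) := by
    rw [degA_add, degA_add, degA_single, degA_single, add_assoc, ← neg_eq_iff_eq_neg.2 h,
      ← degA_evenOn_sub_oddOn]
    ring
  have hsum := c.oddOn_add_sdiff hS
  change _ = c.minus at hsum
  have hle : c.oddOn S ≤ c.minus := hsum ▸ le_self_add
  have hnr : ¬ IsRigid (edgeVec G) (c.oddOn S) := by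
    intro hr
    have h1 := DFunLike.congr_fun (hr _ heq) f
    have h2 := hle f
    rw [minus_chord_eq_zero hf] at h2
    simp only [Finsupp.add_apply, Finsupp.single_eq_same] at h1
    omega
  have h0 : c.oddOn (Finset.range (2 * c.half) \ S) = 0 := by
    rw [hM.eq_of_le hnr hle] at hsum
    exact add_eq_left.1 hsum
  intro n hn
  by_contra hne
  rw [Nat.not_even_iff_odd] at hne
  have h1 : Finsupp.single (c.edge n) 1 ≤ c.oddOn (Finset.range (2 * c.half) \ S) :=
    Finset.single_le_sum (f := fun n => Finsupp.single (c.edge n) 1) (fun _ _ => zero_le)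
      (Finset.mem_filter.2 ⟨hn, hne⟩)
  rw [h0] at h1
  have := h1 (c.edge n)
  simp at this

/-- Effectively crossing chords of a walk with a critical monomial `M` form a square with two edges
of the other monomial `N`. -/
theorem square_of_crossing_chords {M N Q : G.edgeSet →₀ ℕ} (hM : IsCritical (edgeVec G) M)
    (hMN : (c.plus = M ∧ c.minus = N) ∨ (c.plus = N ∧ c.minus = M)) {p r q t : ℕ} (hpr : p < r)
    (hrq : r < q) (hqt : q < t) (hpq : c.IsChordIn Q p q) (hrt : c.IsChordIn Q r t)
    (hodd : Odd (p + r)) :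
    (r = p + 1 ∧ t = q + 1 ∧ 0 < N (c.edge p) ∧ 0 < N (c.edge q)) ∨
      (q = r + 1 ∧ p = 0 ∧ t + 1 = 2 * c.half ∧ 0 < N (c.edge r) ∧ 0 < N (c.edge t)) := by
  obtain ⟨-, hq, hsp, hsq, he, hadj, -⟩ := hpq
  obtain ⟨-, ht, hsr, hst, he', hadj', -⟩ := hrt
  have hS : Finset.Ico p r ∪ Finset.Ico q t ⊆ Finset.range (2 * c.half) :=
    Finset.union_subset (Ico_subset_period (by omega)) (Ico_subset_period (by omega))
  have halt : c.altDeg (Finset.Ico p r ∪ Finset.Ico q t)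
      = (-1) ^ p * (edgeVec G ⟨s(_, _), hadj⟩ + edgeVec G ⟨s(_, _), hadj'⟩) := by
    rw [c.altDeg_Ico_union hpr.le hrq.le hqt.le, edgeVec_mk, edgeVec_mk,
      neg_one_pow_eq_of_even_add he, neg_one_pow_eq_of_even_add he', neg_one_pow_eq_of_odd_add hodd]
    ring
  have hf := edge_ne_chord (by omega) hq hsp hsq he hadj
  have hcompl := c.altDeg_sdiff hS
  have hsdd : Finset.range (2 * c.half) \ (Finset.range (2 * c.half) \
      (Finset.Ico p r ∪ Finset.Ico q t)) = Finset.Ico p r ∪ Finset.Ico q t :=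
    Finset.sdiff_sdiff_eq_self hS
  have hmem : ∀ n, n ∈ Finset.Ico p r ∪ Finset.Ico q t ↔ (p ≤ n ∧ n < r) ∨ (q ≤ n ∧ n < t) := by
    intro n
    rw [Finset.mem_union, Finset.mem_Ico, Finset.mem_Ico]
  rw [Nat.even_iff] at he he'
  rw [Nat.odd_iff] at hodd
  -- An arc whose positions all have the same parity contains at most one position.
  have hin : (∀ n ∈ Finset.Ico p r ∪ Finset.Ico q t, (n + p) % 2 = 0) → r = p + 1 ∧ t = q + 1 := by
    intro h
    constructor
    · by_contra hne
      have := h (p + 1) ((hmem _).2 (by omega))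
      omega
    · by_contra hne
      have := h (q + 1) ((hmem _).2 (by omega))
      omega
  have hout : (∀ n ∈ Finset.range (2 * c.half) \ (Finset.Ico p r ∪ Finset.Ico q t),
      (n + p) % 2 = 1) → q = r + 1 ∧ p = 0 ∧ t + 1 = 2 * c.half := by
    intro h
    have h' : ∀ n, n < 2 * c.half → ¬ ((p ≤ n ∧ n < r) ∨ (q ≤ n ∧ n < t)) → (n + p) % 2 = 1 :=
      fun n h1 h2 => h n (Finset.mem_sdiff.2 ⟨Finset.mem_range.2 h1, fun h3 => h2 ((hmem n).1 h3)⟩)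
    have h1 : q = r + 1 := by
      by_contra hne
      have := h' (r + 1) (by omega) (by omega)
      omega
    have h2 : t + 1 = 2 * c.half := by
      by_contra hne
      have := h' (t + 1) (by omega) (by omega)
      omega
    refine ⟨h1, ?_, h2⟩
    by_contra hne
    -- For `p = 1` the subtraction truncates; then `t` is even, contrary to `t + 1 = 2 * c.half`.
    have := h' (p - 2) (by omega) (by omega)
    omega
  -- According to the sign, all edges of `M` lie in the two arcs or all lie outside. The other set
  -- has only positions of `N`, so its arcs are single edges.
  rcases hMN with ⟨rfl, rfl⟩ | ⟨rfl, rfl⟩ <;> rcases Nat.even_or_odd p with hp | hp <;>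
    rw [hp.neg_one_pow] at halt
  · rw [one_mul] at halt
    rw [Nat.even_iff] at hp
    obtain ⟨h1, h2, h3⟩ := hout fun n hn => by
      have := odd_of_mem_compl_of_isCritical_plus hM hS hf halt n hn
      rw [Nat.odd_iff] at this
      omega
    exact Or.inr ⟨h1, h2, h3, minus_pos (by omega) (by rw [Nat.odd_iff]; omega),
      minus_pos (by omega) (by rw [Nat.odd_iff]; omega)⟩
  · rw [halt, neg_one_mul, neg_neg] at hcompl
    rw [Nat.odd_iff] at hp
    obtain ⟨h1, h2⟩ := hin fun n hn => by
      rw [← hsdd] at hn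
      have := odd_of_mem_compl_of_isCritical_plus hM Finset.sdiff_subset hf hcompl n hn
      rw [Nat.odd_iff] at this
      omega
    exact Or.inl ⟨h1, h2, minus_pos (by omega) (by rw [Nat.odd_iff]; omega),
      minus_pos (by omega) (by rw [Nat.odd_iff]; omega)⟩
  · rw [halt, one_mul] at hcompl
    rw [Nat.even_iff] at hp
    obtain ⟨h1, h2⟩ := hin fun n hn => by
      rw [← hsdd] at hn
      have := even_of_mem_compl_of_isCritical_minus hM Finset.sdiff_subset hf hcompl n hn
      rw [Nat.even_iff] at this
      omega
    exact Or.inl ⟨h1, h2, plus_pos (by omega) (by rw [Nat.even_iff]; omega),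
      plus_pos (by omega) (by rw [Nat.even_iff]; omega)⟩
  · rw [neg_one_mul] at halt
    rw [Nat.odd_iff] at hp
    obtain ⟨h1, h2, h3⟩ := hout fun n hn => by
      have := even_of_mem_compl_of_isCritical_minus hM hS hf halt n hn
      rw [Nat.even_iff] at this
      omega
    -- This case would force `p = 0` although `p` is odd.
    omega

variable [Finite V]

theorem exists_edge_of_adj_of_odd (hP : IsPrimitivePair c.plus c.minus)
    (hS : ¬ HasSplit c.plus c.minus) {p q : ℕ} (hp : p < 2 * c.half) (hq : q < 2 * c.half)
    (hodd : Odd (p + q)) (h : G.Adj (c.vert p) (c.vert q)) :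
    ∃ n < 2 * c.half, s(c.vert n, c.vert (n + 1)) = s(c.vert p, c.vert q) := by
  have key : ∀ p q, p < q → q < 2 * c.half → Odd (p + q) → G.Adj (c.vert p) (c.vert q) →
      ∃ n < 2 * c.half, s(c.vert n, c.vert (n + 1)) = s(c.vert p, c.vert q) := by
    intro p q hpq hq hodd h
    rcases consecutive_of_adj hP hS hpq (by omega) hodd h with rfl | h1
    · exact ⟨p, by omega, rfl⟩
    · obtain rfl : p = 0 := by omega
      refine ⟨q, hq, ?_⟩
      rw [h1, c.periodic, Sym2.eq_swap]
  rcases lt_trichotomy p q with hlt | rfl | hlt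
  · exact key p q hlt hq hodd h
  · exact absurd rfl h.ne
  · rw [Sym2.eq_swap (a := c.vert p)]
    exact key q p hlt hp (by rwa [add_comm]) h.symm

/-- Two adjacent vertices of the walk are either joined by an edge of the walk, or they are each
visited only once, at positions of the same parity. -/
theorem edge_or_chord_of_adj (hP : IsPrimitivePair c.plus c.minus)
    (hS : ¬ HasSplit c.plus c.minus) {p q : ℕ} (hp : p < 2 * c.half) (hq : q < 2 * c.half)
    (h : G.Adj (c.vert p) (c.vert q)) :
    (∃ n < 2 * c.half, s(c.vert n, c.vert (n + 1)) = s(c.vert p, c.vert q)) ∨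
      (Even (p + q) ∧ c.IsSimpleAt p ∧ c.IsSimpleAt q) := by
  by_contra! hno
  obtain ⟨h1, h2⟩ := hno
  have heven : Even (p + q) := by
    by_contra hodd
    obtain ⟨n, hn, hn'⟩ := exists_edge_of_adj_of_odd hP hS hp hq (Nat.not_even_iff_odd.1 hodd) h
    exact h1 n hn hn'
  -- A second visit would have the other parity, hence odd distance from `q`, which makes the edge
  -- an edge of the walk.
  have hsp : c.IsSimpleAt p := by
    intro m hm hmp
    by_contra hne
    have h3 := odd_of_vert_eq_of_ne hP hne (by omega) (by omega) hmp
    obtain ⟨n, hn, hn'⟩ := exists_edge_of_adj_of_odd hP hS hm hq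
      (by rw [Nat.odd_iff, Nat.even_iff] at *; omega) (hmp ▸ h)
    exact h1 n hn (hmp ▸ hn')
  refine h2 heven hsp ?_
  intro m hm hmq
  by_contra hne
  have h3 := odd_of_vert_eq_of_ne hP hne (by omega) (by omega) hmq
  obtain ⟨n, hn, hn'⟩ := exists_edge_of_adj_of_odd hP hS hp hm
    (by rw [Nat.odd_iff, Nat.even_iff] at *; omega) (hmq ▸ h)
  exact h1 n hn (hmq ▸ hn')

/-! ### Further monomials of the same degree -/

section Fibre

variable {M N Q : G.edgeSet →₀ ℕ}

theorem isPrimitivePair_of_isCritical (hM : IsCritical (edgeVec G) M)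
    (hMN : (c.plus = M ∧ c.minus = N) ∨ (c.plus = N ∧ c.minus = M)) (hne : N ≠ M) :
    IsPrimitivePair c.plus c.minus ∧ ¬ HasSplit c.plus c.minus := by
  have hd := c.degA_plus_eq
  rcases hMN with ⟨rfl, rfl⟩ | ⟨rfl, rfl⟩
  · exact ⟨hM.primitivePair hd.symm hne, hM.not_hasSplit _⟩
  · exact ⟨(hM.primitivePair hd hne).symm, fun h => hM.not_hasSplit _ (h.symm hd)⟩

theorem exists_vert_eq_of_mem (hMN : (c.plus = M ∧ c.minus = N) ∨ (c.plus = N ∧ c.minus = M))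
    (hQ : degA (edgeVec G) Q = degA (edgeVec G) M) {e : G.edgeSet} (he : 0 < Q e) {x : V}
    (hx : x ∈ (e : Sym2 V)) : ∃ p < 2 * c.half, c.vert p = x := by
  have h1 : 0 < degA (edgeVec G) Q x := by
    have := le_degA_apply Q hx
    omega
  have hd : degA (edgeVec G) c.plus = degA (edgeVec G) M := by
    rcases hMN with ⟨h, -⟩ | ⟨-, h⟩
    · rw [h]
    · rw [c.degA_plus_eq, h]
  rw [hQ, ← hd] at h1
  obtain ⟨e', hxe, hpos⟩ := exists_of_degA_apply_pos h1
  obtain ⟨n, hn, -, rfl⟩ := exists_of_plus_pos hpos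
  rcases Sym2.mem_iff.1 hxe with rfl | rfl
  · exact ⟨n, hn, rfl⟩
  · exact c.exists_lt_vert_eq (n + 1)

/-- An edge of a monomial `Q` of the same degree as `M` is an edge of `N` or a chord. -/
theorem chord_of_mem (hM : IsCritical (edgeVec G) M)
    (hMN : (c.plus = M ∧ c.minus = N) ∨ (c.plus = N ∧ c.minus = M)) (hNM : N ≠ M)
    (hQ : degA (edgeVec G) Q = degA (edgeVec G) M) (hQM : Q ≠ M) {e : G.edgeSet} (he : 0 < Q e)
    (hNe : N e = 0) : ∃ p q, c.IsChordIn Q p q ∧ (e : Sym2 V) = s(c.vert p, c.vert q) := by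
  obtain ⟨hP, hS⟩ := isPrimitivePair_of_isCritical hM hMN hNM
  obtain ⟨e, hadj⟩ := e
  induction e with
  | h x y =>
    obtain ⟨p, hp, rfl⟩ := exists_vert_eq_of_mem hMN hQ he (Sym2.mem_mk_left x y)
    obtain ⟨q, hq, rfl⟩ := exists_vert_eq_of_mem hMN hQ he (Sym2.mem_mk_right _ y)
    have hadj' : G.Adj (c.vert p) (c.vert q) := hadj
    rcases edge_or_chord_of_adj hP hS hp hq hadj with ⟨n, hn, hn'⟩ | ⟨h1, h2, h3⟩
    · have heq : c.edge n = ⟨s(c.vert p, c.vert q), hadj⟩ := Subtype.ext hn'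
      have := pos_of_edge hM hMN hQ hQM hn (by rwa [heq])
      rw [heq] at this
      omega
    · rcases lt_trichotomy p q with hlt | rfl | hlt
      · exact ⟨p, q, ⟨hlt, hq, h2, h3, h1, hadj', he⟩, rfl⟩
      · exact absurd rfl hadj'.ne
      · refine ⟨q, p, ⟨hlt, hp, h3, h2, by rwa [add_comm], hadj'.symm, ?_⟩, Sym2.eq_swap⟩
        have heq : (⟨s(c.vert q, c.vert p), hadj'.symm⟩ : G.edgeSet)
            = ⟨s(c.vert p, c.vert q), hadj⟩ := Subtype.ext Sym2.eq_swap
        rw [heq]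
        exact he

/-- If `Q` had at `x` only edges of `N`, squarefreeness would give `Q ≤ N` there, and the equal
degrees at `x` would force `Q e = N e`. -/
theorem exists_chord_at (hG : CondSharp G) (hM : IsCritical (edgeVec G) M)
    (hMN : (c.plus = M ∧ c.minus = N) ∨ (c.plus = N ∧ c.minus = M)) (hNM : N ≠ M)
    (hQ : degA (edgeVec G) Q = degA (edgeVec G) M) (hQM : Q ≠ M) {e : G.edgeSet} (hNe : 0 < N e)
    (hQe : Q e = 0) {x : V} (hx : x ∈ (e : Sym2 V)) :
    ∃ p q, c.IsChordIn Q p q ∧ (x = c.vert p ∨ x = c.vert q) := by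
  have hd : degA (edgeVec G) N = degA (edgeVec G) M := by
    have := c.degA_plus_eq
    rcases hMN with ⟨h, h'⟩ | ⟨h, h'⟩ <;> rw [h, h'] at this
    exacts [this.symm, this]
  suffices ∃ f : G.edgeSet, x ∈ (f : Sym2 V) ∧ 0 < Q f ∧ N f = 0 by
    obtain ⟨f, hxf, hf, hNf⟩ := this
    obtain ⟨p, q, hpq, hpq'⟩ := chord_of_mem hM hMN hNM hQ hQM hf hNf
    rw [hpq'] at hxf
    exact ⟨p, q, hpq, Sym2.mem_iff.1 hxf⟩
  by_contra! hno
  have hle : ∀ f : G.edgeSet, x ∈ (f : Sym2 V) → Q f ≤ N f := by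
    intro f hf
    have h1 := (hM.squarefree_pair hG hQ hQM f).2
    rcases Nat.eq_zero_or_pos (Q f) with h0 | h0
    · omega
    · have := hno f hf h0
      omega
  have := eq_of_degA_apply_eq hle (by rw [hQ, hd]) hx
  omega

/-- A third monomial in the fibre contains two chords which cross effectively. -/
theorem exists_crossing_chords (hG : CondSharp G) (hM : IsCritical (edgeVec G) M)
    (hMN : (c.plus = M ∧ c.minus = N) ∨ (c.plus = N ∧ c.minus = M)) (hNM : N ≠ M)
    (hQ : degA (edgeVec G) Q = degA (edgeVec G) M) (hQM : Q ≠ M) (hQN : Q ≠ N) :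
    ∃ p r q t, p < r ∧ r < q ∧ q < t ∧ c.IsChordIn Q p q ∧ c.IsChordIn Q r t ∧ Odd (p + r) := by
  classical
  have hd : degA (edgeVec G) N = degA (edgeVec G) M := by
    have := c.degA_plus_eq
    rcases hMN with ⟨h, h'⟩ | ⟨h, h'⟩ <;> rw [h, h'] at this
    exacts [this.symm, this]
  have hdp : degA (edgeVec G) Q = degA (edgeVec G) c.plus := by
    rcases hMN with ⟨h, -⟩ | ⟨h, -⟩ <;> rw [h, hQ]
    rw [hd]
  -- The argument takes a chord of `Q` that spans as few positions as possible.
  have hex : ∃ d, ∃ i j, j = i + d ∧ c.IsChordIn Q i j := by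
    have : ∃ e, Q e < N e := by
      by_contra! hle
      exact hQN (eq_of_le_of_degA_eq hle (by rw [hd, hQ])).symm
    obtain ⟨e, he⟩ := this
    have hN1 := (hM.squarefree_pair hG hd hNM e).2
    obtain ⟨⟨x, y⟩, hxy⟩ := e.1.exists_rep
    have hx : x ∈ (e : Sym2 V) := hxy ▸ Sym2.mem_mk_left x y
    obtain ⟨p, q, hpq, -⟩ := exists_chord_at hG hM hMN hNM hQ hQM (by omega) (by omega) hx
    exact ⟨q - p, p, q, (Nat.add_sub_cancel' hpq.1.le).symm, hpq⟩
  obtain ⟨i, j, hjd, hij⟩ := Nat.find_spec hex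
  have hmin : ∀ p q, c.IsChordIn Q p q → j - i ≤ q - p := by
    intro p q hpq
    have := Nat.find_min' hex ⟨p, q, (Nat.add_sub_cancel' hpq.1.le).symm, hpq⟩
    omega
  clear hjd
  obtain ⟨hlt, hj, hsi, hsj, heven, hadj, hpos⟩ := id hij
  rw [Nat.even_iff] at heven
  -- an edge of the walk at an end of the chord is not in `Q`
  have hnot : ∀ n x, (x = i ∨ x = j) → c.vert x ∈ (c.edge n : Sym2 V) → Q (c.edge n) = 0 := by
    intro n x hx hmem
    by_contra h0
    have h1 : degA (edgeVec G) Q (c.vert x) = 1 := by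
      rw [hdp]
      rcases hx with rfl | rfl
      · exact degA_plus_of_isSimpleAt (by omega) hsi
      · exact degA_plus_of_isSimpleAt hj hsj
    have hmem' : c.vert x ∈ s(c.vert i, c.vert j) := by
      rcases hx with rfl | rfl
      · exact Sym2.mem_mk_left _ _
      · exact Sym2.mem_mk_right _ _
    have := eq_of_degA_eq_one h1 hmem hmem' (Nat.pos_of_ne_zero h0) hpos
    exact edge_ne_chord (by omega) hj hsi hsj (Nat.even_iff.2 heven) hadj n this
  -- A chord of `Q` that starts inside the shortest one cannot be nested in it, so its other end is
  -- outside; parity gives effectiveness.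
  have hcross : ∀ x, i < x → x < j → Odd (i + x) → (∃ p q, c.IsChordIn Q p q ∧
      (c.vert x = c.vert p ∨ c.vert x = c.vert q)) →
      ∃ p r q t, p < r ∧ r < q ∧ q < t ∧ c.IsChordIn Q p q ∧ c.IsChordIn Q r t ∧ Odd (p + r) := by
    rintro x hix hxj hodd ⟨p, q, hpq, hx⟩
    obtain ⟨h1, h2, h3, h4, h5, -⟩ := id hpq
    have h6 := hmin p q hpq
    rw [Nat.even_iff] at h5
    rw [Nat.odd_iff] at hodd
    have hx' : x = p ∨ x = q := hx.imp (h3 x (by omega)) (h4 x (by omega))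
    rcases hx' with rfl | rfl
    · exact ⟨i, x, j, q, hix, hxj, by omega, hij, hpq, Nat.odd_iff.2 hodd⟩
    · exact ⟨p, i, x, j, by omega, hix, hxj, hpq, hij, by rw [Nat.odd_iff]; omega⟩
  -- The first and the last edge of the arc have opposite parity, so one is in `N`. It is not in
  -- `Q`, whose degree 1 at the end of the chord is used up, hence `Q` has a chord at its inner end.
  have hN : 0 < N (c.edge i) ∨ 0 < N (c.edge (j - 1)) := by
    rcases hMN with ⟨-, rfl⟩ | ⟨rfl, -⟩
    · rcases Nat.even_or_odd i with h | h
      · rw [Nat.even_iff] at h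
        exact Or.inr (minus_pos (by omega) (by rw [Nat.odd_iff]; omega))
      · exact Or.inl (minus_pos (by omega) h)
    · rcases Nat.even_or_odd i with h | h
      · exact Or.inl (plus_pos (by omega) h)
      · rw [Nat.odd_iff] at h
        exact Or.inr (plus_pos (by omega) (by rw [Nat.even_iff]; omega))
  rcases hN with hN | hN
  · refine hcross (i + 1) (by omega) (by omega) ⟨i, by omega⟩
      (exists_chord_at hG hM hMN hNM hQ hQM hN (hnot i i (Or.inl rfl) (Sym2.mem_mk_left _ _)) ?_)
    exact Sym2.mem_mk_right _ _
  · have hjj : j - 1 + 1 = j := by omega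
    refine hcross (j - 1) (by omega) (by omega) (by rw [Nat.odd_iff]; omega)
      (exists_chord_at hG hM hMN hNM hQ hQM hN (hnot (j - 1) j (Or.inr rfl) ?_) ?_)
    · change c.vert j ∈ s(c.vert (j - 1), c.vert (j - 1 + 1))
      rw [hjj]
      exact Sym2.mem_mk_right _ _
    · exact Sym2.mem_mk_left _ _

end Fibre

end ClosedSeq

/-! ### Squares and indispensable monomials -/

section Squares

variable {V : Type*} {G : SimpleGraph V} {M N Q : G.edgeSet →₀ ℕ}

theorem not_isRigid_of_square {e e' f f' : G.edgeSet}
    (h : edgeVec G f + edgeVec G f' = edgeVec G e + edgeVec G e') (hef : e ≠ f) (hef' : e ≠ f') :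
    ¬ IsRigid (edgeVec G) (Finsupp.single e 1 + Finsupp.single e' 1) := by
  classical
  intro hr
  have := hr (Finsupp.single f 1 + Finsupp.single f' 1)
    (by simp only [degA_add, degA_single, h])
  have := DFunLike.congr_fun this e
  rw [Finsupp.add_apply, Finsupp.add_apply, Finsupp.single_apply, Finsupp.single_apply,
    Finsupp.single_eq_same, if_neg hef.symm, if_neg hef'.symm] at this
  omega

theorem single_add_single_le {e e' : G.edgeSet} (hne : e ≠ e') (he : 0 < N e) (he' : 0 < N e') :
    Finsupp.single e 1 + Finsupp.single e' 1 ≤ N := by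
  classical
  intro f
  rw [Finsupp.add_apply, Finsupp.single_apply, Finsupp.single_apply]
  split_ifs with h1 h2 h2
  · exact absurd (h1.trans h2.symm) hne
  · rw [← h1]
    omega
  · rw [← h2]
    omega
  · omega

/-- Opposite sides of a square have the same total degree, and `e`, `e'` belong to the same half of
the walk. -/
theorem HasF4.exists_not_isRigid {u : V} {w : G.Walk u u} (h : HasF4 w) :
    ∃ D : G.edgeSet →₀ ℕ, D.degree = 2 ∧ ¬ IsRigid (edgeVec G) D ∧
      (D ≤ evenPart w ∨ D ≤ oddPart w) := by
  classical
  obtain ⟨i, i', t, j, t', j', a, ξ, hpar, ⟨-, -, hadj, -⟩, ⟨-, -, hadj', -⟩, -, hcyc, hedges⟩ := h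
  have hnd := hcyc.1.1.edges_nodup
  rw [hedges] at hnd
  simp only [List.nodup_cons, List.mem_cons, List.not_mem_nil, or_false, not_or] at hnd
  obtain ⟨⟨h1, h2, h3⟩, -⟩ := hnd
  refine ⟨Finsupp.single (walkEdge w i) 1 + Finsupp.single (walkEdge w i') 1, by simp,
    not_isRigid_of_square (f := ⟨s(_, _), hadj⟩) (f' := ⟨s(_, _), hadj'⟩) ?_
      (fun h => h1 (congrArg Subtype.val h)) (fun h => h3 (congrArg Subtype.val h)), ?_⟩
  · clear hcyc
    match ξ, hedges with
    | .nil, h | .cons _ .nil, h | .cons _ (.cons _ .nil), h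
    | .cons _ (.cons _ (.cons _ .nil)), h => simp at h
    | .cons _ (.cons _ (.cons _ (.cons _ (.cons _ _)))), h => simp at h
    | .cons k1 (.cons k2 (.cons k3 (.cons k4 .nil))), hedges =>
      simp only [SimpleGraph.Walk.edges_cons, SimpleGraph.Walk.edges_nil, List.cons.injEq,
        and_true] at hedges
      obtain ⟨g1, g2, g3, g4⟩ := hedges
      have e1 : walkEdge w i = ⟨_, k1⟩ := Subtype.ext g1.symm
      have e2 : (⟨s(_, _), hadj⟩ : G.edgeSet) = ⟨_, k2⟩ := Subtype.ext g2.symm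
      have e3 : walkEdge w i' = ⟨_, k3⟩ := Subtype.ext g3.symm
      have e4 : (⟨s(_, _), hadj'⟩ : G.edgeSet) = ⟨_, k4⟩ := Subtype.ext g4.symm
      rw [e1, e2, e3, e4, edgeVec_mk, edgeVec_mk, edgeVec_mk, edgeVec_mk]
      abel
  · have hne : i ≠ i' := fun h => h2 (by rw [h])
    have hsum : Finsupp.single (walkEdge w i) 1 + Finsupp.single (walkEdge w i') 1
        = ∑ k ∈ {i, i'}, Finsupp.single (edgeAt w k) 1 := by
      rw [Finset.sum_pair hne]
      rfl
    rw [hsum]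
    rcases Nat.even_or_odd i with hi | hi
    · refine Or.inl (Finset.sum_le_sum_of_subset_of_nonneg ?_ fun _ _ _ => zero_le)
      rintro k hk
      rcases Finset.mem_insert.1 hk with rfl | hk
      · simpa using hi
      · rw [Finset.mem_singleton.1 hk]
        simpa using hpar.1 hi
    · refine Or.inr (Finset.sum_le_sum_of_subset_of_nonneg ?_ fun _ _ _ => zero_le)
      rintro k hk
      rcases Finset.mem_insert.1 hk with rfl | hk
      · simpa using hi
      · rw [Finset.mem_singleton.1 hk]
        have : Odd (i' : ℕ) := by
          rw [← Nat.not_even_iff_odd] at hi ⊢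
          exact fun h => hi (hpar.2 h)
        simpa using this

namespace ClosedSeq

variable {c : ClosedSeq G}

/-- Effectively crossing chords form a square with two edges `e_i`, `e_j` of the walk. -/
theorem exists_square (hM : IsCritical (edgeVec G) M)
    (hMN : (c.plus = M ∧ c.minus = N) ∨ (c.plus = N ∧ c.minus = M)) {p r q t : ℕ} (hpr : p < r)
    (hrq : r < q) (hqt : q < t) (hpq : c.IsChordIn Q p q) (hrt : c.IsChordIn Q r t)
    (hodd : Odd (p + r)) :
    ∃ i j a b, i < j ∧ j < 2 * c.half ∧ 0 < N (c.edge i) ∧ 0 < N (c.edge j) ∧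
      c.IsChordIn Q i j ∧ c.IsChordIn Q a b ∧ Odd (a + i) ∧
      ((i < a ∧ a < j ∧ j < b) ∨ (a < i ∧ i < b ∧ b < j)) ∧
      s(c.vert a, c.vert b) = s(c.vert (i + 1), c.vert (j + 1)) := by
  rcases square_of_crossing_chords hM hMN hpr hrq hqt hpq hrt hodd with
    ⟨rfl, rfl, h1, h2⟩ | ⟨rfl, rfl, h3, h1, h2⟩
  · exact ⟨p, q, p + 1, q + 1, by omega, hpq.2.1, h1, h2, hpq, hrt, by rwa [add_comm],
      Or.inl (by omega), rfl⟩
  -- The edge at the last position `t` ends at `v_0`, so the chord parallel to `{v_r, v_t}` is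
  -- `{v_0, v_{r+1}}`.
  · refine ⟨r, t, 0, r + 1, by omega, by omega, h1, h2, hrt, hpq, hodd, Or.inr (by omega), ?_⟩
    rw [h3, ← zero_add (2 * c.half), c.periodic, Sym2.eq_swap]

theorem IsChordIn.edge_ne {p q : ℕ} (h : c.IsChordIn Q p q) (n : ℕ) :
    (c.edge n : Sym2 V) ≠ s(c.vert p, c.vert q) := by
  obtain ⟨h1, h2, h3, h4, h5, hadj, -⟩ := h
  exact fun heq => edge_ne_chord (by omega) h2 h3 h4 h5 hadj n (Subtype.ext heq)

/-- A critical monomial of a walk with two effectively crossing chords is quadratic. -/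
theorem degree_eq_two_of_crossing_chords (hM : IsCritical (edgeVec G) M)
    (hN : IsCritical (edgeVec G) N)
    (hMN : (c.plus = M ∧ c.minus = N) ∨ (c.plus = N ∧ c.minus = M)) {p r q t : ℕ} (hpr : p < r)
    (hrq : r < q) (hqt : q < t) (hpq : c.IsChordIn Q p q) (hrt : c.IsChordIn Q r t)
    (hodd : Odd (p + r)) : N.degree = 2 := by
  obtain ⟨i, j, a, b, hij, hj, hNi, hNj, h1, h2, -, hab, hs⟩ :=
    exists_square hM hMN hpr hrq hqt hpq hrt hodd
  have hne : c.edge i ≠ c.edge j := by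
    intro heq
    have hmem : c.vert i ∈ (c.edge j : Sym2 V) := heq ▸ Sym2.mem_mk_left _ _
    rcases Sym2.mem_iff.1 hmem with h | h
    · exact hij.ne' (h1.2.2.1 j hj h.symm)
    · have hmem' : c.vert (j + 1) ∈ s(c.vert a, c.vert b) := hs ▸ Sym2.mem_mk_right _ _
      have ha := h2.1
      have hb := h2.2.1
      rcases Sym2.mem_iff.1 hmem' with h' | h'
      · have := h1.2.2.1 a (by omega) (h'.symm.trans h.symm)
        omega
      · have := h1.2.2.1 b (by omega) (h'.symm.trans h.symm)
        omega
  obtain ⟨hadj, -⟩ := h1.2.2.2.2.2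
  obtain ⟨hadj', -⟩ := h2.2.2.2.2.2
  -- Two sides of the square form a non-rigid quadratic divisor of the critical `N`, hence all of
  -- `N`.
  have hnr := not_isRigid_of_square (e := c.edge i) (e' := c.edge j) (f := ⟨s(_, _), hadj⟩)
    (f' := ⟨s(_, _), hadj'⟩) ?_ (fun h => h1.edge_ne i (congrArg Subtype.val h))
    (fun h => h2.edge_ne i (congrArg Subtype.val h))
  · rw [← hN.eq_of_le hnr (single_add_single_le hne hNi hNj)]
    simp
  · have hadj'' : G.Adj (c.vert (i + 1)) (c.vert (j + 1)) := by
      rw [← SimpleGraph.mem_edgeSet, ← hs]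
      exact hadj'
    have : (⟨s(_, _), hadj'⟩ : G.edgeSet) = ⟨s(_, _), hadj''⟩ := Subtype.ext hs
    rw [this, edge, edge, edgeVec_mk, edgeVec_mk, edgeVec_mk, edgeVec_mk]
    abel

end ClosedSeq

theorem isCycle_of_square {x y z t : V} (h1 : G.Adj x y) (h2 : G.Adj y z) (h3 : G.Adj z t)
    (h4 : G.Adj t x) (hxz : x ≠ z) (hyt : y ≠ t) :
    (SimpleGraph.Walk.cons h1 (.cons h2 (.cons h3 (.cons h4 .nil)))).IsCycle := by
  rw [SimpleGraph.Walk.cons_isCycle_iff]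
  constructor
  · simp [SimpleGraph.Walk.isPath_def, h2.ne, h3.ne, h4.ne, hyt, h1.ne.symm, hxz.symm]
  · simp [h1.ne, hxz, hyt, h4.ne.symm]

/-! ### From crossing chords to an 𝓕₄ -/

section OfWalk

variable [Finite V] {u : V} {w : G.Walk u u}

open ClosedSeq in
theorem isOddChord_of_isChordIn (hG : CondSharp G) {heven : Even w.length} {hpos : 0 < w.length}
    (hP : IsPrimitivePair (ofWalk w heven hpos).plus (ofWalk w heven hpos).minus)
    (hS : ¬ HasSplit (ofWalk w heven hpos).plus (ofWalk w heven hpos).minus) {p q : ℕ}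
    (h : (ofWalk w heven hpos).IsChordIn Q p q) : IsOddChord w p q := by
  have hne := h.edge_ne
  obtain ⟨hpq, hq, hsp, hsq, he, hadj, -⟩ := h
  have hlen := ofWalk_two_mul_half (w := w) (heven := heven) (hpos := hpos)
  rw [hlen] at hq
  rw [ofWalk_vert hq.le, ofWalk_vert (hpq.trans hq).le] at hadj hne
  rw [Nat.even_iff] at he heven
  refine ⟨hpq, hq, hadj, fun hmem => ?_, not_isBridgeAt hG hP hS (by omega) hq hsp hsq hadj,
    by rw [Nat.odd_iff]; omega, by rw [Nat.odd_iff]; omega⟩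
  rw [← SimpleGraph.Walk.adj_toSubgraph_iff_mem_edges,
    toSubgraph_adj_iff_exists (heven := Nat.even_iff.2 heven) (hpos := hpos)] at hmem
  obtain ⟨n, hn⟩ := hmem
  exact hne n hn

open ClosedSeq in
-- Exchanging a proper critical divisor `N'` of `N` for another monomial `N''` of its degree gives a
-- third monomial of the fibre. It differs from `M` because it keeps a variable of `N`.
theorem hasF4_of_not_isCritical (hG : CondSharp G) (hM : IsCritical (edgeVec G) M)
    (heven : Even w.length) (hpos : 0 < w.length)
    (hMN : (evenPart w = M ∧ oddPart w = N) ∨ (evenPart w = N ∧ oddPart w = M)) (hNM : N ≠ M)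
    (hN : ¬ IsCritical (edgeVec G) N) : HasF4 w := by
  have hd : degA (edgeVec G) N = degA (edgeVec G) M := by
    have := degA_evenPart_eq heven
    rcases hMN with ⟨h, h'⟩ | ⟨h, h'⟩ <;> rw [h, h'] at this
    exacts [this.symm, this]
  rw [← ofWalk_plus (heven := heven) (hpos := hpos),
    ← ofWalk_minus (heven := heven) (hpos := hpos)] at hMN
  obtain ⟨N', hle, hN'⟩ := exists_isCritical_le (not_isRigid_iff.2 ⟨M, hd.symm, hNM.symm⟩)
  obtain ⟨N'', hdeg, hne⟩ := not_isRigid_iff.1 hN'.1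
  have hN'N : N' ≠ N := fun h => hN (h ▸ hN')
  have hQ : degA (edgeVec G) (N'' + (N - N')) = degA (edgeVec G) M := by
    rw [degA_add, degA_sub hle, hdeg, ← hd]
    abel
  have hQN : N'' + (N - N') ≠ N := fun h => hne <| by
    exact add_right_cancel (h.trans (add_tsub_cancel_of_le hle).symm)
  have hQM : N'' + (N - N') ≠ M := by
    intro h
    obtain ⟨e, he⟩ : ∃ e, N' e < N e := by
      by_contra! hge
      exact hN'N (le_antisymm hle hge)
    have h1 := DFunLike.congr_fun h e
    rw [Finsupp.add_apply, Finsupp.tsub_apply] at h1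
    have := hM.disjoint hd hNM e
    omega
  obtain ⟨p, r, q, t, hpr, hrq, hqt, hpq, hrt, hodd⟩ :=
    exists_crossing_chords hG hM hMN hNM hQ hQM hQN
  obtain ⟨i, j, a, b, hij, hj, -, -, h1, h2, hodd', hab, hs⟩ :=
    exists_square hM hMN hpr hrq hqt hpq hrt hodd
  obtain ⟨hP, hS⟩ := isPrimitivePair_of_isCritical hM hMN hNM
  have o1 := isOddChord_of_isChordIn hG hP hS h1
  have o2 := isOddChord_of_isChordIn hG hP hS h2
  have hlen := ofWalk_two_mul_half (w := w) (heven := heven) (hpos := hpos)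
  have hia : w.getVert i ≠ w.getVert a ∧ w.getVert i ≠ w.getVert b ∧
      w.getVert j ≠ w.getVert a ∧ w.getVert j ≠ w.getVert b := by
    have hs1 := h1.2.2.1
    have hs2 := h1.2.2.2.1
    have ha := h2.1
    have hb := h2.2.1
    rw [← ofWalk_vert (heven := heven) (hpos := hpos) (n := i) (by omega),
      ← ofWalk_vert (heven := heven) (hpos := hpos) (n := j) (by omega),
      ← ofWalk_vert (heven := heven) (hpos := hpos) (n := a) (by omega),
      ← ofWalk_vert (heven := heven) (hpos := hpos) (n := b) (by omega)]
    refine ⟨fun h => ?_, fun h => ?_, fun h => ?_, fun h => ?_⟩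
    · have := hs1 a (by omega) h.symm
      omega
    · have := hs1 b (by omega) h.symm
      omega
    · have := hs2 a (by omega) h.symm
      omega
    · have := hs2 b (by omega) h.symm
      omega
  rw [hlen] at hj
  rw [ofWalk_vert (n := a) (by have := o2.1; have := o2.2.1; omega),
    ofWalk_vert (n := b) o2.2.1.le, ofWalk_vert (n := i + 1) (by omega),
    ofWalk_vert (n := j + 1) (by omega)] at hs
  have hadj : G.Adj (w.getVert (i + 1)) (w.getVert (j + 1)) := by
    rw [← SimpleGraph.mem_edgeSet, ← hs]
    exact o2.2.2.1
  have hne' : w.getVert i ≠ w.getVert (j + 1) ∧ w.getVert (i + 1) ≠ w.getVert j := by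
    rcases Sym2.eq_iff.1 hs with ⟨e1, e2⟩ | ⟨e1, e2⟩
    · exact ⟨e2 ▸ hia.2.1, e1 ▸ hia.2.2.1.symm⟩
    · exact ⟨e1 ▸ hia.1, e2 ▸ hia.2.2.2.symm⟩
  -- The square runs through `v_i, v_{i+1}, v_{j+1}, v_j`; its second side is `{v_a, v_b}` and its
  -- fourth is `{v_i, v_j}`.
  refine ⟨⟨i, by omega⟩, ⟨j, hj⟩, a, b, i, j, w.getVert i, _, ?_, o2, o1, ⟨?_, by omega⟩,
    isCycle_of_square (w.adj_getVert_succ (by omega)) hadj (w.adj_getVert_succ hj).symm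
      o1.2.2.1.symm hne'.1 hne'.2, ?_⟩
  · have := h1.2.2.2.2.1
    rw [Nat.even_add] at this
    exact this
  · rw [Nat.odd_iff] at hodd'
    rw [Int.odd_iff]
    omega
  · simp only [SimpleGraph.Walk.edges_cons, SimpleGraph.Walk.edges_nil]
    rw [hs, Sym2.eq_swap (a := w.getVert (j + 1)),
      Sym2.eq_swap (a := w.getVert j) (b := w.getVert i)]
    rfl

end OfWalk

variable [Finite V]

/-- A fibre contains at most three critical monomials. -/
theorem eq_of_isCritical_of_fibre (hG : CondSharp G) {Q' : G.edgeSet →₀ ℕ}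
    (hM : IsCritical (edgeVec G) M) (hN : IsCritical (edgeVec G) N)
    (hQ : IsCritical (edgeVec G) Q) (hNM : degA (edgeVec G) N = degA (edgeVec G) M)
    (hQM : degA (edgeVec G) Q = degA (edgeVec G) M)
    (hQM' : degA (edgeVec G) Q' = degA (edgeVec G) M) (h1 : N ≠ M) (h2 : Q ≠ M) (h3 : Q ≠ N)
    (h4 : Q' ≠ M) (h5 : Q' ≠ N) : Q' = Q := by
  by_contra hne
  obtain ⟨c, hc, hc'⟩ := (hM.primitivePair hNM h1).exists_closedSeq hM.ne_zero
  have hc2 : (c.plus = M ∧ c.minus = N) ∨ (c.plus = N ∧ c.minus = M) := Or.inl ⟨hc, hc'⟩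
  obtain ⟨p, r, q, t, hpr, hrq, hqt, hpq, hrt, hodd⟩ :=
    ClosedSeq.exists_crossing_chords hG hM hc2 h1 hQM h2 h3
  obtain ⟨p', r', q', t', hpr', hrq', hqt', hpq', hrt', -⟩ :=
    ClosedSeq.exists_crossing_chords hG hM hc2 h1 hQM' h4 h5
  have hdeg := ClosedSeq.degree_eq_two_of_crossing_chords hM hN hc2 hpr hrq hqt hpq hrt hodd
  rw [degree_eq_of_degA_eq hNM, ← hc, c.degree_plus] at hdeg
  have ht := hrt.2.1
  have ht' := hrt'.2.1
  -- The walk has length 4, so `Q` and `Q'` both contain the diagonal `{v_0, v_2}`, whereas distinct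
  -- monomials of the fibre are coprime to the critical `Q`.
  obtain ⟨rfl, rfl, rfl, rfl⟩ : p = 0 ∧ q = 2 ∧ p' = 0 ∧ q' = 2 := by omega
  obtain ⟨hadj, hpos⟩ := hpq.2.2.2.2.2
  obtain ⟨hadj', hpos'⟩ := hpq'.2.2.2.2.2
  have := hQ.disjoint (hQM'.trans hQM.symm) hne ⟨s(c.vert 0, c.vert 2), hadj⟩
  omega

end Squares

/-! ### The components of the complex -/

section Components

variable {V : Type*} [Finite V] {G : SimpleGraph V} {M N : G.edgeSet →₀ ℕ}

theorem IsCritical.eq_of_support_subset (hG : CondSharp G) (hM : IsCritical (edgeVec G) M)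
    (hN : IsCritical (edgeVec G) N) (h : N.support ⊆ M.support) : N = M :=
  hM.eq_of_le hN.1 (le_of_squarefree (hN.squarefree hG) h)

theorem isIndispensableMonomial_edgeVec_iff (K : Type*) [Field K] :
    IsIndispensableMonomial (toricIdeal K (edgeVec G)) M ↔ IsCritical (edgeVec G) M :=
  isIndispensableMonomial_iff fun _ _ => degree_eq_of_degA_eq

/-- Supports of distinct critical monomials are incomparable, so minimality is automatic. -/
theorem mem_minimalSupports_iff (K : Type*) [Field K] (hG : CondSharp G) {E : Finset G.edgeSet} :
    E ∈ minimalSupports (toricIdeal K (edgeVec G)) ↔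
      ∃ M, IsCritical (edgeVec G) M ∧ M.support = E := by
  constructor
  · rintro ⟨⟨M, hM, rfl⟩, -⟩
    exact ⟨M, (isIndispensableMonomial_edgeVec_iff K).1 hM, rfl⟩
  · rintro ⟨M, hM, rfl⟩
    refine ⟨⟨M, (isIndispensableMonomial_edgeVec_iff K).2 hM, rfl⟩, ?_⟩
    rintro _ ⟨N, hN, rfl⟩ hle
    rw [isIndispensableMonomial_edgeVec_iff] at hN
    rw [hM.eq_of_support_subset hG hN hle]

/-- The supports of the critical monomials of the same degree as `M`. -/
def fibreSupports (M : G.edgeSet →₀ ℕ) : Finset (Finset G.edgeSet) :=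
  (Set.toFinite {E | ∃ N, IsCritical (edgeVec G) N ∧ degA (edgeVec G) N = degA (edgeVec G) M ∧
    N.support = E}).toFinset

theorem mem_fibreSupports {E : Finset G.edgeSet} : E ∈ fibreSupports M ↔
    ∃ N, IsCritical (edgeVec G) N ∧ degA (edgeVec G) N = degA (edgeVec G) M ∧ N.support = E := by
  simp [fibreSupports]

theorem support_mem_fibreSupports (hM : IsCritical (edgeVec G) M) :
    M.support ∈ fibreSupports M :=
  mem_fibreSupports.2 ⟨M, hM, rfl, rfl⟩

/-- `IsCritical.degA_eq_of_support` replaces the arbitrary monomials in the definition of a face by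
the critical ones. -/
theorem mem_faces_iff (K : Type*) [Field K] (hG : CondSharp G) {T : Finset (Finset G.edgeSet)} :
    T ∈ (gammaGraph K G).faces ↔
      T.Nonempty ∧ ∃ M, IsCritical (edgeVec G) M ∧ T ⊆ fibreSupports M := by
  constructor
  · rintro ⟨hT, hmin, u, hu, hdeg⟩
    refine ⟨hT, ?_⟩
    obtain ⟨E₀, hE₀⟩ := hT
    obtain ⟨M, hM, hME⟩ := (mem_minimalSupports_iff K hG).1 (hmin E₀ hE₀)
    refine ⟨M, hM, fun E hE => ?_⟩
    obtain ⟨N, hN, rfl⟩ := (mem_minimalSupports_iff K hG).1 (hmin E hE)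
    exact mem_fibreSupports.2 ⟨N, hN, hN.degA_eq_of_support hG hM (hu _ hE)
      ((hu _ hE₀).trans hME.symm) (hdeg _ hE _ hE₀), rfl⟩
  · rintro ⟨hT, M, hM, hsub⟩
    have : ∀ E, ∃ N, E ∈ T → IsCritical (edgeVec G) N ∧
        degA (edgeVec G) N = degA (edgeVec G) M ∧ N.support = E := by
      intro E
      by_cases hE : E ∈ T
      · obtain ⟨N, hN⟩ := mem_fibreSupports.1 (hsub hE)
        exact ⟨N, fun _ => hN⟩
      · exact ⟨0, fun h => absurd h hE⟩
    choose f hf using this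
    exact ⟨hT, fun E hE => (mem_minimalSupports_iff K hG).2 ⟨f E, (hf E hE).1, (hf E hE).2.2⟩,
      f, fun E hE => (hf E hE).2.2, fun E hE E' hE' => (hf E hE).2.1.trans (hf E' hE').2.1.symm⟩

theorem mem_fibreSupports_of_reachable (K : Type*) [Field K] (hG : CondSharp G)
    (hM : IsCritical (edgeVec G) M) {E : Finset G.edgeSet}
    (h : Relation.ReflTransGen (CommonFace (gammaGraph K G)) M.support E) :
    E ∈ fibreSupports M := by
  induction h with
  | refl => exact support_mem_fibreSupports hM
  | tail _ hcf ih =>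
    obtain ⟨T, hT, hb, hc⟩ := hcf
    obtain ⟨-, P, -, hTP⟩ := (mem_faces_iff K hG).1 hT
    obtain ⟨N, hN, hNM, rfl⟩ := mem_fibreSupports.1 ih
    obtain ⟨N', hN', hNP, hsupp⟩ := mem_fibreSupports.1 (hTP hb)
    obtain rfl := hN.eq_of_support_subset hG hN' hsupp.le
    obtain ⟨Q, hQ, hQP, rfl⟩ := mem_fibreSupports.1 (hTP hc)
    exact mem_fibreSupports.2 ⟨Q, hQ, by rw [hQP, ← hNP, hNM], rfl⟩

/-- The components of the complex are the simplices on the critical monomials of a fibre. -/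
theorem componentAt_support (K : Type*) [Field K] (hG : CondSharp G)
    (hM : IsCritical (edgeVec G) M) :
    componentAt (gammaGraph K G) M.support = simplexOn (fibreSupports M) := by
  classical
  refine PreAbstractSimplicialComplex.ext (Set.ext fun T => ⟨?_, ?_⟩)
  · rintro ⟨hT, hr⟩
    exact ⟨((mem_faces_iff K hG).1 hT).1,
      fun E hE => mem_fibreSupports_of_reachable K hG hM (hr E hE)⟩
  · rintro ⟨hT, hsub⟩
    refine ⟨(mem_faces_iff K hG).2 ⟨hT, M, hM, hsub⟩, fun E hE => .single ?_⟩
    refine ⟨{M.support, E}, (mem_faces_iff K hG).2 ⟨by simp, M, hM, ?_⟩, by simp, by simp⟩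
    rw [Finset.insert_subset_iff, Finset.singleton_subset_iff]
    exact ⟨support_mem_fibreSupports hM, hsub hE⟩

theorem isConnectedComponent_iff (K : Type*) [Field K] (hG : CondSharp G)
    {H : PreAbstractSimplicialComplex (Finset G.edgeSet)} :
    IsConnectedComponent (gammaGraph K G) H ↔
      ∃ M, IsCritical (edgeVec G) M ∧ H = simplexOn (fibreSupports M) := by
  constructor
  · rintro ⟨E, hE, rfl⟩
    obtain ⟨-, P, -, hEP⟩ := (mem_faces_iff K hG).1 hE
    obtain ⟨M, hM, -, rfl⟩ := mem_fibreSupports.1 (hEP (Finset.mem_singleton_self E))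
    exact ⟨M, hM, componentAt_support K hG hM⟩
  · rintro ⟨M, hM, rfl⟩
    exact ⟨M.support, (mem_faces_iff K hG).2 ⟨Finset.singleton_nonempty _, M, hM,
      Finset.singleton_subset_iff.2 (support_mem_fibreSupports hM)⟩,
      (componentAt_support K hG hM).symm⟩

theorem simplexOn_injective {α : Type*} : Function.Injective (simplexOn (α := α)) := by
  have key : ∀ s t : Finset α, simplexOn s = simplexOn t → s ⊆ t := by
    intro s t h x hx
    have : {x} ∈ (simplexOn s).faces :=
      ⟨Finset.singleton_nonempty x, Finset.singleton_subset_iff.2 hx⟩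
    rw [h] at this
    exact Finset.singleton_subset_iff.1 this.2
  exact fun s t h => (key s t h).antisymm (key t s h.symm)

theorem isConnectedComponent_singleton_iff (K : Type*) [Field K] (hG : CondSharp G)
    (hM : IsCritical (edgeVec G) M) :
    IsConnectedComponent (gammaGraph K G) (simplexOn {M.support}) ↔
      ∀ N, IsCritical (edgeVec G) N → degA (edgeVec G) N = degA (edgeVec G) M → N = M := by
  rw [isConnectedComponent_iff K hG]
  constructor
  · rintro ⟨P, hP, heq⟩ N hN hNM
    have heq' := simplexOn_injective heq
    have hMP : M.support ∈ fibreSupports P := heq' ▸ Finset.mem_singleton_self _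
    obtain ⟨M', hM', hMP', hsupp⟩ := mem_fibreSupports.1 hMP
    obtain rfl := hM.eq_of_support_subset hG hM' hsupp.le
    have : N.support ∈ fibreSupports P := mem_fibreSupports.2 ⟨N, hN, hNM.trans hMP', rfl⟩
    rw [← heq', Finset.mem_singleton] at this
    exact hM.eq_of_support_subset hG hN this.le
  · intro h
    refine ⟨M, hM, congrArg simplexOn ?_⟩
    refine (Finset.eq_singleton_iff_unique_mem.2 ⟨support_mem_fibreSupports hM, ?_⟩).symm
    intro E hE
    obtain ⟨N, hN, hNM, rfl⟩ := mem_fibreSupports.1 hE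
    rw [h N hN hNM]

theorem card_fibreSupports_le (hG : CondSharp G) (hM : IsCritical (edgeVec G) M) :
    (fibreSupports M).card ≤ 3 := by
  classical
  by_contra hcard
  have h2 : 2 < ((fibreSupports M).erase M.support).card := by
    rw [Finset.card_erase_of_mem (support_mem_fibreSupports hM)]
    omega
  obtain ⟨E₁, E₂, E₃, h1, h2, h3, h12, h13, h23⟩ := Finset.two_lt_card_iff.1 h2
  rw [Finset.mem_erase, mem_fibreSupports] at h1 h2 h3
  obtain ⟨k1, N, hN, hNM, rfl⟩ := h1
  obtain ⟨k2, Q, hQ, hQM, rfl⟩ := h2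
  obtain ⟨k3, Q', hQ', hQM', rfl⟩ := h3
  have hne : ∀ {a b : G.edgeSet →₀ ℕ}, a.support ≠ b.support → a ≠ b :=
    fun h h' => h (congrArg _ h')
  exact hne h23 (eq_of_isCritical_of_fibre hG hM hN hQ hNM hQM hQM' (hne k1) (hne k2)
    (hne h12.symm) (hne k3) (hne h13.symm)).symm

/-- If `M` is the only critical monomial of its degree, the other half of every walk through `M` is
not critical. If a second one exists, an 𝓕₄ of the walk that joins them would make one of them,
hence both, quadratic. -/
theorem forall_isCritical_eq_iff (K : Type*) [Field K] (hG : CondSharp G)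
    (hM : IsCritical (edgeVec G) M) (hdeg : M.degree ≠ 2) :
    (∀ N, IsCritical (edgeVec G) N → degA (edgeVec G) N = degA (edgeVec G) M → N = M) ↔
      ∀ (u : V) (w : G.Walk u u), Even w.length → M ∈ (walkBinomial K w).support → HasF4 w := by
  constructor
  · intro h u w heven hmem
    rw [walkBinomial_eq, mem_support_monomial_sub] at hmem
    obtain ⟨hne, hor⟩ := hmem
    have hd := degA_evenPart_eq heven
    have hpos : 0 < w.length := by
      by_contra h0
      have hsum := degree_evenPart_add_degree_oddPart w
      have h1 : (evenPart w).degree = 0 := by omega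
      have h2 : (oddPart w).degree = 0 := by omega
      rw [Finsupp.degree_eq_zero_iff] at h1 h2
      exact hne (h1.trans h2.symm)
    rcases hor with rfl | rfl
    · exact hasF4_of_not_isCritical hG hM heven hpos (Or.inl ⟨rfl, rfl⟩) hne.symm
        fun hN => hne (h _ hN hd.symm).symm
    · exact hasF4_of_not_isCritical hG hM heven hpos (Or.inr ⟨rfl, rfl⟩) hne
        fun hN => hne (h _ hN hd)
  · intro h N hN hNM
    by_contra hne
    obtain ⟨u, w, heven, -, hw⟩ := (hM.primitivePair hNM hne).exists_walk hM.ne_zero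
    have hF : HasF4 w := h u w heven <| by
      rw [walkBinomial_eq, mem_support_monomial_sub]
      rcases hw with ⟨h1, h2⟩ | ⟨h1, h2⟩ <;> rw [h1, h2]
      exacts [⟨Ne.symm hne, Or.inl rfl⟩, ⟨hne, Or.inr rfl⟩]
    obtain ⟨D, hD, hnr, hle⟩ := hF.exists_not_isRigid
    have hle' : D ≤ M ∨ D ≤ N := by
      rcases hw with ⟨h1, h2⟩ | ⟨h1, h2⟩ <;> rw [h1, h2] at hle
      exacts [hle, hle.symm]
    rcases hle' with hle' | hle'
    · exact hdeg (hM.eq_of_le hnr hle' ▸ hD)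
    · rw [← degree_eq_of_degA_eq hNM] at hdeg
      exact hdeg (hN.eq_of_le hnr hle' ▸ hD)

end Components

end GraphToric
end

theorem theorem3p11 {V : Type*} [Fintype V] (K : Type*) [Field K] (G : SimpleGraph V)
    (hconn : G.Connected) (hsharp : GraphToric.CondSharp G) :
    (∀ M : G.edgeSet →₀ ℕ,
      GraphToric.IsIndispensableMonomial (GraphToric.toricIdeal K (GraphToric.edgeVec G)) M →
      M.degree ≠ 2 →
      (GraphToric.IsConnectedComponent (GraphToric.gammaGraph K G)
          (GraphToric.simplexOn {M.support}) ↔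
        ∀ (u : V) (w : G.Walk u u), Even w.length →
          M ∈ (GraphToric.walkBinomial K w).support → GraphToric.HasF4 w)) ∧
    (∀ H : PreAbstractSimplicialComplex (Finset G.edgeSet),
      GraphToric.IsConnectedComponent (GraphToric.gammaGraph K G) H →
      ∃ s : Finset (Finset G.edgeSet),
        (s.card = 1 ∨ s.card = 2 ∨ s.card = 3) ∧ H = GraphToric.simplexOn s) := by
  refine ⟨fun M hM hdeg => ?_, fun H hH => ?_⟩
  · rw [GraphToric.isIndispensableMonomial_edgeVec_iff] at hM
    exact (GraphToric.isConnectedComponent_singleton_iff K hsharp hM).trans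
      (GraphToric.forall_isCritical_eq_iff K hsharp hM hdeg)
  · obtain ⟨M, hM, rfl⟩ := (GraphToric.isConnectedComponent_iff K hsharp).1 hH
    have h1 := GraphToric.card_fibreSupports_le hsharp hM
    have h2 := Finset.card_pos.2 ⟨_, GraphToric.support_mem_fibreSupports hM⟩
    exact ⟨_, by omega, rfl⟩
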